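/- Let $D\subset\mathbb R^2$ be a bounded domain with boundary of class $\mathcal C^{1,\alpha}$, $0<\alpha\le1$, outward unit normal $\nu=(\nu_1,\nu_2)$ and arc length measure $\sigma$ on $\partial D$. On the complex space $L^2(\partial D)$ consider the Neumann–Poincaré operator $$\mathcal K^*[\phi](x)=\frac1{2\pi}\int_{\partial D}\frac{\langle x-y,\nu_x\rangle}{|x-y|^2}\,\phi(y)\,d\sigma(y),$$ the single layer potential $\mathcal S[\phi](x)=\frac1{2\pi}\int_{\partial D}\log|x-y|\,\phi(y)\,d\sigma(y)$, and $\langle\phi,\psi\rangle_{\mathcal H}=-\int_{\partial D}\overline{\phi}\,\mathcal S[\psi]\,d\sigma$. For $\lambda\notin\sigma(\mathcal K^*)$ let $M(\lambda)$ be the polarization tensor, the $2\times2$ matrix with entries $$m_{kl}(\lambda)=\int_{\partial D}y_k\,(\lambda I-\mathcal K^*)^{-1}[\nu_l](y)\,d\sigma(y).$$ Assume that all eigenvalues of $\mathcal K^*$ are simple. Let $\lambda_1\ge\lambda_2\ge\dots\ge0$ be numbers $<1/2$, and let $\phi_i^\pm$ ($i\ge1$) be mean-zero functions in $L^2(\partial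 D)$, orthonormal with respect to $\langle\cdot,\cdot\rangle_{\mathcal H}$, such that $\mathcal K^*\phi_i^\pm=\pm\lambda_i\phi_i^\pm$ for all $i$ and every nonzero eigenvalue of $\mathcal K^*$ other than $1/2$ is one of the numbers $\pm\lambda_i$. Let $c_i^\pm$ be the $2\times 2$ matrices with entries $$(c_i^\pm)_{kl}=\langle\phi_i^\pm,\nu_l\rangle_{\mathcal H}\int_{\partial D}y_k\,\phi_i^\pm(y)\,d\sigma(y).$$ Let $\gamma$ be a piecewise $C^1$ simple closed curve in $\mathbb C$ enclosing $\sigma(\mathcal K^*)$ once counterclockwise (it does not meet $\sigma(\mathcal K^*)$ and has winding number $1$ about each of its points), and for $j\ge1$, $n\ge0$ put $$h_j^{(n)}=\frac1{2\pi i}\int_\gamma\lambda^{2n}M(\lambda)\,d\lambda-\sum_{i=1}^{j-1}(c_i^++c_i^-)\,\lambda_i^{2n}.$$ Then for every $j\ge 1$ such that the matrix $c_j^++c_j^-$ is not zero, $$\lim_{n\to\infty}\frac{\big(h_j^{(n)}\big)_{kl}}{\big(h_j^{(n-1)}\big)_{kl}}=\lambda_j^2\quad\text{for all }k,l\in\{1,2\}\text{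 with }(c_j^++c_j^-)_{kl}\neq0,\qquad\text{and}\qquad \lim_{n\to\infty}\frac{h_j^{(n)}}{\lambda_j^{2n}}=c_j^++c_j^-\ .$$ -/

import Mathlib

open MeasureTheory Filter Topology
open scoped NNReal ENNReal ComplexConjugate

noncomputable section

namespace NP

/-- The Euclidean plane `ℝ²`. -/
abbrev Plane : Type := EuclideanSpace ℝ (Fin 2)

/-- A bounded domain (open connected set) of the plane whose boundary is of class `C^{1,a}`:
near each boundary point, in suitable Cartesian coordinates, `D` is the part of the plane lying
strictly above the graph of a differentiable function whose derivative is `a`-Hölder. -/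
structure IsC1HolderDomain (a : ℝ≥0) (D : Set Plane) : Prop where
  isOpen : IsOpen D
  isConnected : IsConnected D
  isBounded : Bornology.IsBounded D
  localGraph : ∀ p ∈ frontier D, ∃ (e : Plane ≃ᵃⁱ[ℝ] Plane) (g : ℝ → ℝ) (r : ℝ),
    0 < r ∧ Differentiable ℝ g ∧ (∃ C : ℝ≥0, HolderWith C a (deriv g)) ∧
      ∀ x ∈ Metric.ball p r, x ∈ D ↔ g (e x 0) < e x 1

/-- The arc length measure `dσ` on `∂D`. -/
def bdry (D : Set Plane) : Measure Plane := (μH[1] : Measure Plane).restrict (frontier D)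

/-- `v` is the outward unit normal of `D` at the boundary point `x`: up to an error
`o(|y - x|)`, the points of `D` near `x` lie in the half plane `⟨y - x, v⟩ ≤ 0` and the points
outside `D` lie in the half plane `⟨y - x, v⟩ ≥ 0`.  There is at most one such vector. -/
def IsOutwardNormal (D : Set Plane) (x v : Plane) : Prop :=
  ‖v‖ = 1 ∧ ∀ ε : ℝ, 0 < ε → ∀ᶠ y in 𝓝 x,
    (y ∈ D → inner ℝ (y - x) v ≤ ε * ‖y - x‖) ∧
    (y ∉ D → -(ε * ‖y - x‖) ≤ inner ℝ (y - x) v)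

open Classical in
/-- The outward unit normal field `ν` on `∂D` (and `0` where there is no normal). -/
def normal (D : Set Plane) (x : Plane) : Plane :=
  if h : ∃ v, IsOutwardNormal D x v then h.choose else 0

/-- The complex Hilbert space `L²(∂D)`. -/
abbrev L2 (D : Set Plane) : Type := Lp ℂ 2 (bdry D)

open Classical in
/-- The class in `L²(∂D)` of a square integrable function on `∂D`. -/
def toL2 (D : Set Plane) (f : Plane → ℂ) : L2 D :=
  if h : MemLp f 2 (bdry D) then h.toLp f else 0

/-- The component `ν_l` of the outward normal, as an element of `L²(∂D)`. -/
def normalL2 (D : Set Plane) (l : Fin 2) : L2 D := toL2 D fun x => (normal D x l : ℂ)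

/-- The Neumann–Poincaré kernel `(1 / 2π) ⟨x - y, ν_x⟩ / |x - y|²`. -/
def npKernel (D : Set Plane) (x y : Plane) : ℝ :=
  1 / (2 * Real.pi) * (inner ℝ (x - y) (normal D x) / ‖x - y‖ ^ 2)

/-- `K` is the bounded operator on `L²(∂D)` given by the Neumann–Poincaré kernel. -/
def IsNPOperator (D : Set Plane) (K : L2 D →L[ℂ] L2 D) : Prop :=
  ∀ φ : L2 D, K φ =ᵐ[bdry D] fun x => ∫ y, (npKernel D x y : ℂ) * φ y ∂(bdry D)

open Classical in
/-- The Neumann–Poincaré operator `K*` on `L²(∂D)`.  The operator with the given kernel is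
unique, and for `C^{1,a}` domains it exists. -/
def npOp (D : Set Plane) : L2 D →L[ℂ] L2 D :=
  if h : ∃ K, IsNPOperator D K then h.choose else 0

/-- The single layer potential `S[φ](x) = ∫ Γ(x - y) φ(y) dσ(y)`, with
`Γ(x) = (1 / 2π) log |x|`. -/
def singleLayer (D : Set Plane) (φ : L2 D) (x : Plane) : ℂ :=
  ∫ y, ((1 / (2 * Real.pi) * Real.log ‖x - y‖ : ℝ) : ℂ) * φ y ∂(bdry D)

/-- The inner product `⟨φ, ψ⟩_H = -∫ conj φ S[ψ] dσ`, conjugate-linear in `φ`. -/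
def innerH (D : Set Plane) (φ ψ : L2 D) : ℂ :=
  -∫ x, conj (φ x) * singleLayer D ψ x ∂(bdry D)

/-- The bilinear pairing `⟨φ, y_k⟩ = ∫ y_k φ(y) dσ(y)` with the `k`-th coordinate function. -/
def coordPairing (D : Set Plane) (k : Fin 2) (φ : L2 D) : ℂ :=
  ∫ y, (y k : ℂ) * φ y ∂(bdry D)

/-- The polarization tensor `m_{kl}(z) = ∫ y_k (z I - K*)⁻¹[ν_l](y) dσ(y)`. -/
def polTensor (D : Set Plane) (z : ℂ) : Matrix (Fin 2) (Fin 2) ℂ :=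
  Matrix.of fun k l => coordPairing D k (resolvent (npOp D) z (normalL2 D l))

/-- All the eigenvalues of `K*` are simple. -/
def SimpleEigenvalues (D : Set Plane) : Prop :=
  ∀ μ : ℂ, Module.End.HasEigenvalue (npOp D : Module.End ℂ (L2 D)) μ →
    Module.finrank ℂ (Module.End.eigenspace (npOp D : Module.End ℂ (L2 D)) μ) = 1

/-- `lam` is the decreasing enumeration of the numbers `λ_i ∈ [0, 1/2)` such that the `±λ_i` are
the eigenvalues of `K*` other than `1/2`, and `φ i true = φ_i⁺`, `φ i false = φ_i⁻` are the
corresponding eigenfunctions, of mean zero and orthonormal for `⟨·,·⟩_H`.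
The index `i` starts at `0`. -/
structure IsEigensystem (D : Set Plane) (lam : ℕ → ℝ) (φ : ℕ → Bool → L2 D) : Prop where
  antitone : Antitone lam
  nonneg : ∀ i, 0 ≤ lam i
  lt_half : ∀ i, lam i < 1 / 2
  mean_zero : ∀ i s, ∫ y, φ i s y ∂(bdry D) = 0
  eigen_pos : ∀ i, npOp D (φ i true) = (lam i : ℂ) • φ i true
  eigen_neg : ∀ i, npOp D (φ i false) = (-lam i : ℂ) • φ i false
  orthonormal : ∀ i s j t, innerH D (φ i s) (φ j t) = if i = j ∧ s = t then 1 else 0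
  /-- No eigenvalue is left out (except possibly `0`, and `1/2`). -/
  exhaustive : ∀ μ : ℂ, Module.End.HasEigenvalue (npOp D : Module.End ℂ (L2 D)) μ →
    μ ≠ 0 → μ ≠ 1 / 2 → ∃ i, μ = lam i ∨ μ = -lam i

/-- The matrix `⟨φ, y_k⟩_{L²} ⟨φ, ν_l⟩_H`; for `φ = φ_i^±` it is `c_i^±`. -/
def coeff (D : Set Plane) (φ : L2 D) : Matrix (Fin 2) (Fin 2) ℂ :=
  Matrix.of fun k l => coordPairing D k φ * innerH D φ (normalL2 D l)

/-- The contour integral `∫_γ f(z) dz` over `γ : [0,1] → ℂ`. -/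
def contourIntegral (γ : ℝ → ℂ) (f : ℂ → ℂ) : ℂ :=
  ∫ t in (0 : ℝ)..1, f (γ t) * deriv γ t

/-- `γ : [0,1] → ℂ` is a piecewise continuously differentiable simple closed curve. -/
structure IsSimpleClosedCurve (γ : ℝ → ℂ) : Prop where
  closed : γ 0 = γ 1
  simple : Set.InjOn γ (Set.Ico 0 1)
  piecewise : ∃ (m : ℕ) (t : ℕ → ℝ), t 0 = 0 ∧ t m = 1 ∧ ∀ i < m, t i < t (i + 1) ∧
    ContDiffOn ℝ 1 γ (Set.Icc (t i) (t (i + 1)))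

/-- `γ` encloses the set `s` once, counterclockwise: it avoids `s` and has winding number `1`
about each point of `s`. -/
def Encloses (γ : ℝ → ℂ) (s : Set ℂ) : Prop :=
  ∀ z ∈ s, z ∉ γ '' Set.Icc 0 1 ∧
    (2 * Real.pi * Complex.I)⁻¹ * contourIntegral γ (fun w => (w - z)⁻¹) = 1

/-- `h_j^{(n)} = (1 / 2πi) ∫_γ z^{2n} M(z) dz - ∑_{i < j} (c_i⁺ + c_i⁻) λ_i^{2n}`, with indices
`i, j` starting at `0`. -/
def moment (D : Set Plane) (γ : ℝ → ℂ) (lam : ℕ → ℝ) (φ : ℕ → Bool → L2 D) (j n : ℕ) :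
    Matrix (Fin 2) (Fin 2) ℂ :=
  (Matrix.of fun k l => (2 * Real.pi * Complex.I)⁻¹ *
      contourIntegral γ (fun z => z ^ (2 * n) * polTensor D z k l)) -
    ∑ i ∈ Finset.range j, (lam i : ℂ) ^ (2 * n) • (coeff D (φ i true) + coeff D (φ i false))

end NP

end

/-! Write A for `npOp D` and ℓ_k for the pairing with the coordinate y_k. Functional calculus turns
the contour integral of λ^{2n} m_{kl}(λ) into ℓ_k(A^{2n} ν_l), so the question is how A^{2n} grows
on a vector of mean zero. The functionals f_i^± = ⟨φ_i^±, ·⟩_H are left eigenvectors of A,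
biorthogonal to the φ_i^±. Removing from ν_l its components along the pairs with index below J
(`tail`) gives a vector in a closed A-invariant subspace, the common kernel of the mean and of those
f_i^±. No eigenvalue on that subspace exceeds `lam J` in modulus, so, A being compact, Gelfand's
formula bounds ‖A^n tail‖ by C r^n for every r > `lam J` (`exists_norm_pow_tail_le`). The moment of
index j is ℓ_k(A^{2n} tail_j); the step from tail_j to tail_{j+1} splits off exactly λ_j^{2n}(c_j^+
+ c_j^-) and leaves O(r^{2n}) with r < λ_j. Both limits follow. Completeness of the eigenfunctions
and the spectral theorem in the energy space are not needed.

Simplicity and orthonormality forbid coincidences among the ±λ_i. Hence the λ_i are positive and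
strictly decreasing, and compactness forces them to tend to 0.

The eigenvalue 1/2 must be kept out of the mean-zero subspace. The mean is a left eigenvector for
1/2 (Gauss' lemma). If a mean-zero w were an eigenvector for 1/2, simplicity and Fredholm theory
would give w = (A - 1/2)x (`exists_apply_sub_smul_eq`); symmetry of A in the H-form then gives ⟨w,
w⟩_H = 0, and definiteness of the single layer on mean-zero densities gives w = 0.

The winding number of γ is known only at points of the spectrum, so no contour is deformed. The
Cauchy formula is checked on eigenvectors, where the resolvent is explicit, and on a tail whose
orbit decays faster than dist(0, γ)^n, where the Neumann series converges on γ
(`contourIntegral_resolvent`).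

The analytic input concerns the kernels on a C^{1,a} curve: compactness of A by Schur's test, Gauss'
lemma, Plemelj's symmetrization K S = S K*, and definiteness of S. Gauss' lemma and Plemelj's
identity come from replacing |x - y|² by |x - y|² + ε², applying Gauss–Green to the smooth kernels
and letting ε tend to 0; the Laplacian of the regularized logarithm is an approximate identity, half
of whose mass near a boundary point lies in D. Definiteness comes from Frullani's formula, which
writes -log as a superposition of Gaussians. -/

noncomputable section

namespace NP

/-! ### Compact operators with biorthogonal eigenvectors -/

section Spectral

variable {E : Type*} [NormedAddCommGroup E] [NormedSpace ℂ E]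

/-- A compact operator whose nonzero eigenvalues on a closed invariant subspace are bounded by `r₀`
has powers of growth at most `r ^ n` on this subspace, for every `r > r₀`. -/
theorem exists_norm_pow_apply_le [CompleteSpace E] {A : E →L[ℂ] E}
    (hA : IsCompactOperator A) {W : Submodule ℂ E}
    (hWc : IsClosed (W : Set E)) (hW : ∀ w ∈ W, A w ∈ W) {r₀ : ℝ} (hr₀ : 0 ≤ r₀)
    (hev : ∀ μ : ℂ, μ ≠ 0 → ∀ w ∈ W, w ≠ 0 → A w = μ • w → ‖μ‖ ≤ r₀)
    {r : ℝ} (hr : r₀ < r) :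
    ∃ C : ℝ, ∀ w ∈ W, ∀ n : ℕ, ‖(A ^ n) w‖ ≤ C * r ^ n * ‖w‖ := by
  have : CompleteSpace W := hWc.completeSpace_coe
  let T : W →L[ℂ] W := (A.comp W.subtypeL).codRestrict W fun w => hW _ w.2
  have hTapp : ∀ w : W, ((T w : W) : E) = A w := fun w => rfl
  have hTc : IsCompactOperator T := (hA.comp_clm W.subtypeL).codRestrict _ hWc
  -- Nonzero spectrum of a compact operator consists of eigenvalues, so the eigenvalue bound on the
  -- subspace bounds the spectral radius of the restriction.
  have hspec : spectralRadius ℂ T ≤ ENNReal.ofReal r₀ := by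
    refine iSup₂_le fun μ hμ => ?_
    rw [ENNReal.ofReal, ENNReal.coe_le_coe, ← NNReal.coe_le_coe, Real.coe_toNNReal _ hr₀, coe_nnnorm]
    by_cases h0 : μ = 0
    · simpa [h0] using hr₀
    obtain ⟨w, hw⟩ := ((hTc.hasEigenvalue_iff_mem_spectrum h0).2 hμ).exists_hasEigenvector
    refine hev μ h0 w w.2 (by simpa using hw.2) ?_
    exact congrArg (Subtype.val) hw.apply_eq_smul
  have hlim := spectrum.pow_nnnorm_pow_one_div_tendsto_nhds_spectralRadius T
  have hrpos : 0 < r := hr₀.trans_lt hr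
  have hlt : spectralRadius ℂ T < ENNReal.ofReal r :=
    hspec.trans_lt ((ENNReal.ofReal_lt_ofReal_iff hrpos).2 hr)
  have hev' : ∀ᶠ n : ℕ in atTop, ‖T ^ n‖ ≤ r ^ n := by
    filter_upwards [hlim.eventually (gt_mem_nhds hlt), eventually_gt_atTop 0] with n hn hn0
    have h1 := ENNReal.rpow_le_rpow hn.le (Nat.cast_nonneg n : (0 : ℝ) ≤ n)
    rw [← ENNReal.rpow_mul, one_div, inv_mul_cancel₀ (by positivity), ENNReal.rpow_one,
      ENNReal.rpow_natCast, ← ENNReal.ofReal_pow hrpos.le, ENNReal.ofReal, ENNReal.coe_le_coe,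
      ← NNReal.coe_le_coe, Real.coe_toNNReal _ (by positivity), coe_nnnorm] at h1
    exact h1
  obtain ⟨N, hN⟩ := eventually_atTop.1 hev'
  have hpow : ∀ (n : ℕ) (w : W), (((T ^ n) w : W) : E) = (A ^ n) (w : E) := by
    intro n
    induction n with
    | zero => intro w; simp
    | succ n ih =>
      intro w
      rw [pow_succ, pow_succ, mul_apply_eq_comp, mul_apply_eq_comp, ih, hTapp]
  -- Gelfand's formula gives constant 1 from N on; the sum absorbs the finitely many earlier powers.
  refine ⟨1 + ∑ n ∈ Finset.range N, ‖T ^ n‖ / r ^ n, fun w hw n => ?_⟩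
  have h2 : ‖T ^ n‖ ≤ (1 + ∑ n ∈ Finset.range N, ‖T ^ n‖ / r ^ n) * r ^ n := by
    rcases lt_or_ge n N with h | h
    · have : ‖T ^ n‖ / r ^ n ≤ ∑ n ∈ Finset.range N, ‖T ^ n‖ / r ^ n :=
        Finset.single_le_sum (f := fun n => ‖T ^ n‖ / r ^ n) (fun i _ => by positivity)
          (Finset.mem_range.2 h)
      rw [← div_le_iff₀ (by positivity)]
      linarith
    · refine (hN n h).trans (le_mul_of_one_le_left (by positivity) ?_)
      have : 0 ≤ ∑ n ∈ Finset.range N, ‖T ^ n‖ / r ^ n := Finset.sum_nonneg fun i _ => by positivity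
      linarith
  rw [← hpow n ⟨w, hw⟩]
  calc ‖(((T ^ n) ⟨w, hw⟩ : W) : E)‖ ≤ ‖T ^ n‖ * ‖w‖ := (T ^ n).le_opNorm ⟨w, hw⟩
    _ ≤ _ := by gcongr

theorem isCompactOperator_smulRight (f : E →L[ℂ] ℂ) (u : E) :
    IsCompactOperator (f.smulRight u) := by
  have : IsCompactOperator f :=
    (isCompactOperator_id_iff_locallyCompactSpace.2 inferInstance :
      IsCompactOperator (id : ℂ → ℂ)).comp_clm f
  exact this.clm_comp ((1 : ℂ →L[ℂ] ℂ).smulRight u)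

/-- If `μ ≠ 0` is a geometrically simple eigenvalue of a compact operator, then an eigenvector
annihilated by a nonzero left eigenvector is in the range of `A - μ`. -/
theorem exists_apply_sub_smul_eq [CompleteSpace E] {A : E →L[ℂ] E} (hA : IsCompactOperator A)
    {μ : ℂ} (hμ : μ ≠ 0) {w : E} (hw0 : w ≠ 0)
    (hsimple : ∀ x, A x = μ • x → ∃ c : ℂ, x = c • w)
    {m : E →L[ℂ] ℂ} (hm : ∀ x, m (A x) = μ * m x) {u : E} (hu : m u ≠ 0) (hmw : m w = 0) :
    ∃ x, A x - μ • x = w := by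
  obtain ⟨f, -, hf⟩ := exists_dual_vector ℂ w (norm_ne_zero_iff.2 hw0)
  have hfw : f w ≠ 0 := by rw [hf]; simpa using hw0
  -- A rank-one perturbation that destroys the eigenvalue: applying `m` to (T - μ)x = y leaves f(x)
  -- m(u) = m(y). So m(y) = 0 forces f(x) = 0, hence T x = A x. For y = 0 this makes T - μ
  -- injective, so surjective by compactness; for y = w the preimage under T - μ is one under A - μ.
  let T : E →L[ℂ] E := A + f.smulRight u
  have hTapp : ∀ x, T x = A x + f x • u := fun x => rfl
  have hTc : IsCompactOperator T := by
    exact hA.add (isCompactOperator_smulRight f u)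
  have key : ∀ x y, T x - μ • x = y → m y = 0 → f x = 0 := by
    intro x y hxy hy
    have := congrArg m hxy
    rw [hTapp, hy] at this
    simp only [map_sub, map_add, map_smul, hm, smul_eq_mul] at this
    have : f x * m u = 0 := by linear_combination this
    exact (mul_eq_zero.1 this).resolve_right hu
  have hne : ¬ Module.End.HasEigenvalue (T : Module.End ℂ E) μ := by
    intro h
    obtain ⟨x, hx⟩ := h.exists_hasEigenvector
    have hx1 : T x = μ • x := hx.apply_eq_smul
    have hfx : f x = 0 := key x 0 (by rw [hx1, sub_self]) (map_zero m)
    obtain ⟨c, rfl⟩ := hsimple x (by rw [← hx1, hTapp, hfx, zero_smul, add_zero])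
    rw [map_smul, smul_eq_mul] at hfx
    have hc : c = 0 := (mul_eq_zero.1 hfx).resolve_right hfw
    exact hx.2 (by rw [hc, zero_smul])
  have hres := (hTc.hasEigenvalue_or_mem_resolventSet hμ).resolve_left hne
  rw [spectrum.mem_resolventSet_iff, ContinuousLinearMap.isUnit_iff_bijective] at hres
  obtain ⟨x, hx⟩ := hres.2 (-w)
  have hx' : T x - μ • x = w := by
    have : μ • x - T x = -w := by simpa [Algebra.algebraMap_eq_smul_one] using hx
    rw [← neg_sub, this, neg_neg]
  refine ⟨x, ?_⟩
  have hfx := key x w hx' hmw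
  rwa [hTapp, hfx, zero_smul, add_zero] at hx'

/-- The eigenvalue `±lam i` with sign given by a Boolean. -/
def signed (lam : ℕ → ℝ) (i : ℕ) (s : Bool) : ℂ := if s then (lam i : ℂ) else -(lam i : ℂ)

/-- A compact operator with eigenvectors `φ i s` for the eigenvalues `±lam i`, a biorthogonal family
`f i s` of left eigenvectors, and a further left eigenvector `m` for the eigenvalue `1 / 2`. -/
structure IsBiorthogonalSystem (A : E →L[ℂ] E) (lam : ℕ → ℝ) (φ : ℕ → Bool → E)
    (f : ℕ → Bool → E →L[ℂ] ℂ) (m : E →L[ℂ] ℂ) : Prop where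
  compact : IsCompactOperator A
  simple : ∀ μ : ℂ, Module.End.HasEigenvalue (A : Module.End ℂ E) μ →
    Module.finrank ℂ (Module.End.eigenspace (A : Module.End ℂ E) μ) = 1
  antitone : Antitone lam
  nonneg : ∀ i, 0 ≤ lam i
  lt_half : ∀ i, lam i < 1 / 2
  apply_eq : ∀ i s, A (φ i s) = signed lam i s • φ i s
  left_apply : ∀ i s v, f i s (A v) = signed lam i s * f i s v
  biorth : ∀ i s j t, f i s (φ j t) = if i = j ∧ s = t then 1 else 0
  exhaustive : ∀ μ : ℂ, Module.End.HasEigenvalue (A : Module.End ℂ E) μ →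
    μ ≠ 0 → μ ≠ 1 / 2 → ∃ i, μ = lam i ∨ μ = -lam i
  mean_apply : ∀ v, m (A v) = 1 / 2 * m v
  mean_φ : ∀ i s, m (φ i s) = 0
  half : ∀ w, m w = 0 → A w = (1 / 2 : ℂ) • w → w = 0

namespace IsBiorthogonalSystem

variable {A : E →L[ℂ] E} {lam : ℕ → ℝ} {φ : ℕ → Bool → E}
    {f : ℕ → Bool → E →L[ℂ] ℂ} {m : E →L[ℂ] ℂ}

theorem φ_ne_zero (h : IsBiorthogonalSystem A lam φ f m) (i : ℕ) (s : Bool) : φ i s ≠ 0 := by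
  intro h0
  have := h.biorth i s i s
  simp [h0] at this

theorem hasEigenvalue (h : IsBiorthogonalSystem A lam φ f m) (i : ℕ) (s : Bool) :
    Module.End.HasEigenvalue (A : Module.End ℂ E) (signed lam i s) :=
  Module.End.hasEigenvalue_of_hasEigenvector (x := φ i s)
    ⟨Module.End.mem_eigenspace_iff.2 (h.apply_eq i s), h.φ_ne_zero i s⟩

theorem exists_smul_eq (h : IsBiorthogonalSystem A lam φ f m) (i : ℕ) (s : Bool) {v : E}
    (hv : A v = signed lam i s • v) : ∃ c : ℂ, v = c • φ i s := by
  have h1 := h.simple _ (h.hasEigenvalue i s)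
  have hmem : φ i s ∈ Module.End.eigenspace (A : Module.End ℂ E) (signed lam i s) :=
    Module.End.mem_eigenspace_iff.2 (h.apply_eq i s)
  obtain ⟨c, hc⟩ := exists_smul_eq_of_finrank_eq_one h1
    (x := ⟨φ i s, hmem⟩) (by simpa using h.φ_ne_zero i s)
    ⟨v, Module.End.mem_eigenspace_iff.2 hv⟩
  exact ⟨c, by simpa using (congrArg Subtype.val hc).symm⟩

/-- By simplicity, equal eigenvalues make the two eigenvectors proportional, which biorthogonality
allows only for equal indices. -/
theorem signed_injective (h : IsBiorthogonalSystem A lam φ f m) {i j : ℕ} {s t : Bool}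
    (hij : signed lam i s = signed lam j t) : i = j ∧ s = t := by
  obtain ⟨c, hc⟩ := h.exists_smul_eq i s (v := φ j t) (by rw [h.apply_eq, hij])
  by_contra hne
  have h1 := h.biorth i s j t
  rw [if_neg hne, hc, map_smul, h.biorth, if_pos ⟨rfl, rfl⟩, smul_eq_mul, mul_one] at h1
  exact h.φ_ne_zero j t (by rw [hc, h1, zero_smul])

/-- If `lam i` were 0, its two signs would give the same eigenvalue. -/
theorem pos (h : IsBiorthogonalSystem A lam φ f m) (i : ℕ) : 0 < lam i := by
  refine (h.nonneg i).lt_of_ne fun h0 => ?_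
  have := h.signed_injective (i := i) (j := i) (s := true) (t := false) (by simp [signed, ← h0])
  simp at this

theorem strictAnti (h : IsBiorthogonalSystem A lam φ f m) : StrictAnti lam := by
  refine h.antitone.strictAnti_of_injective fun i j hij => ?_
  exact (h.signed_injective (s := true) (t := true) (by simp [signed, hij])).1

/-- The infimum of the `lam i` lies in the closed spectrum. Were it nonzero, it would be an
eigenvalue by compactness, hence one of the `lam i`, and strict decrease would take the sequence
below it. -/
theorem tendsto_zero [CompleteSpace E] (h : IsBiorthogonalSystem A lam φ f m) :
    Tendsto lam atTop (𝓝 0) := by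
  have hb : BddBelow (Set.range lam) := ⟨0, by rintro _ ⟨i, rfl⟩; exact h.nonneg i⟩
  have hlim := tendsto_atTop_ciInf h.antitone hb
  set L := ⨅ i, lam i
  have hLle : ∀ i, L ≤ lam i := fun i => ciInf_le hb i
  have hL0 : 0 ≤ L := le_ciInf h.nonneg
  have hmem : (L : ℂ) ∈ spectrum ℂ A := by
    refine (spectrum.isClosed (𝕜 := ℂ) A).mem_of_tendsto
      ((Complex.continuous_ofReal.tendsto L).comp hlim) (Eventually.of_forall fun i => ?_)
    refine (h.compact.hasEigenvalue_iff_mem_spectrum ?_).1 ?_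
    · exact Complex.ofReal_ne_zero.2 (h.pos i).ne'
    · simpa [signed] using h.hasEigenvalue i true
  by_cases hL : L = 0
  · rwa [hL] at hlim
  have hev := (h.compact.hasEigenvalue_iff_mem_spectrum (by exact_mod_cast hL)).2 hmem
  obtain ⟨i, hi⟩ := h.exhaustive _ hev (by exact_mod_cast hL) fun h2 => by
    have : L = 1 / 2 := by exact_mod_cast (by simpa using h2 : (L : ℂ) = ((1 / 2 : ℝ) : ℂ))
    linarith [h.lt_half 0, hLle 0]
  have hs := h.strictAnti (Nat.lt_succ_self i)
  rcases hi with hi | hi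
  · have : L = lam i := by exact_mod_cast hi
    linarith [hLle (i + 1)]
  · have : L = -lam i := by exact_mod_cast hi
    linarith [h.pos i]

/-- The component of `v` not carried by the first `J` pairs of eigenvectors. -/
def tail (φ : ℕ → Bool → E) (f : ℕ → Bool → E →L[ℂ] ℂ) (J : ℕ) (v : E) : E :=
  v - ∑ i ∈ Finset.range J, (f i true v • φ i true + f i false v • φ i false)

/-- Kernels of left eigenvectors are invariant, and an eigenvector annihilated by `m` and by the
first J pairs of functionals can only belong to an eigenvalue of modulus at most `lam J`. -/
theorem exists_norm_pow_tail_le [CompleteSpace E] (h : IsBiorthogonalSystem A lam φ f m)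
    (J : ℕ) {v : E}
    (hv : m v = 0) {r : ℝ} (hr : lam J < r) :
    ∃ C : ℝ, ∀ n : ℕ, ‖(A ^ n) (tail φ f J v)‖ ≤ C * r ^ n := by
  let W : Submodule ℂ E := LinearMap.ker (m : E →ₗ[ℂ] ℂ) ⊓
    ⨅ i ∈ Finset.range J, ⨅ s : Bool, LinearMap.ker (f i s : E →ₗ[ℂ] ℂ)
  have hWmem : ∀ w, w ∈ W ↔ m w = 0 ∧ ∀ i < J, ∀ s, f i s w = 0 := by
    intro w; simp [W, Submodule.mem_iInf]
  have hWc : IsClosed (W : Set E) := by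
    have : (W : Set E) = {w | m w = 0} ∩ ⋂ i, ⋂ (_ : i < J), ⋂ s, {w | f i s w = 0} := by
      ext w; simp [hWmem]
    rw [this]
    refine (isClosed_eq m.continuous continuous_const).inter ?_
    exact isClosed_iInter fun i => isClosed_iInter fun _ => isClosed_iInter fun s =>
      isClosed_eq (f i s).continuous continuous_const
  have htail : tail φ f J v ∈ W := by
    refine (hWmem _).2 ⟨by simp [tail, hv, h.mean_φ], fun i hi s => ?_⟩
    have hsum : ∑ k ∈ Finset.range J,
        (f k true v * f i s (φ k true) + f k false v * f i s (φ k false)) = f i s v := by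
      rw [Finset.sum_eq_single i]
      · cases s <;> simp [h.biorth]
      · intro k _ hk
        simp [h.biorth, hk.symm]
      · intro h'; exact absurd (Finset.mem_range.2 hi) h'
    rw [tail, map_sub, map_sum]
    simp only [map_add, map_smul, smul_eq_mul]
    rw [hsum, sub_self]
  have hinv : ∀ w ∈ W, A w ∈ W := by
    intro w hw
    rw [hWmem] at hw ⊢
    exact ⟨by rw [h.mean_apply, hw.1, mul_zero], fun i hi s => by
      rw [h.left_apply, hw.2 i hi s, mul_zero]⟩
  obtain ⟨C, hC⟩ := exists_norm_pow_apply_le h.compact hWc hinv (h.nonneg J)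
    (fun μ hμ w hw hw0 hAw => by
      have hev : Module.End.HasEigenvalue (A : Module.End ℂ E) μ :=
        Module.End.hasEigenvalue_of_hasEigenvector (x := w)
          ⟨Module.End.mem_eigenspace_iff.2 hAw, hw0⟩
      rw [hWmem] at hw
      by_cases hhalf : μ = 1 / 2
      · exact absurd (h.half w hw.1 (by rw [hAw, hhalf])) hw0
      obtain ⟨i, hi⟩ := h.exhaustive μ hev hμ hhalf
      have hnorm : ‖μ‖ = lam i := by
        rcases hi with rfl | rfl <;> simp [abs_of_nonneg (h.nonneg i)]
      rw [hnorm]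
      -- For an index below J, simplicity makes the eigenvector a multiple of some `φ i s`, while `f
      -- i s` vanishes on it.
      refine h.antitone (not_lt.1 fun hiJ => ?_)
      obtain ⟨s, hs⟩ : ∃ s, μ = signed lam i s := by
        rcases hi with hi | hi
        · exact ⟨true, by simp [signed, hi]⟩
        · exact ⟨false, by simp [signed, hi]⟩
      obtain ⟨c, hc⟩ := h.exists_smul_eq i s (v := w) (by rw [hAw, hs])
      have h1 := hw.2 i hiJ s
      rw [hc, map_smul, h.biorth, if_pos ⟨rfl, rfl⟩, smul_eq_mul, mul_one] at h1
      exact hw0 (by rw [hc, h1, zero_smul])) hr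
  exact ⟨C * ‖tail φ f J v‖, fun n => (hC _ htail n).trans_eq (by ring)⟩

theorem pow_apply (h : IsBiorthogonalSystem A lam φ f m) (i : ℕ) (s : Bool) (n : ℕ) :
    (A ^ n) (φ i s) = signed lam i s ^ n • φ i s := by
  induction n with
  | zero => simp
  | succ n ih => rw [pow_succ', mul_apply_eq_comp, ih, map_smul, h.apply_eq, smul_smul,
      pow_succ]

end IsBiorthogonalSystem

end Spectral

/-! ### Contour integrals and functional calculus for powers -/

section Contour

/-- A piecewise `C¹` partition of the parameter interval of `γ`. -/
theorem IsSimpleClosedCurve.exists_bound {γ : ℝ → ℂ} (hγ : IsSimpleClosedCurve γ) :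
    ContinuousOn γ (Set.Icc 0 1) ∧ IntervalIntegrable (deriv γ) volume 0 1 ∧
      ∀ F f : ℂ → ℂ, (∀ z ∈ γ '' Set.Icc 0 1, HasDerivAt F (f z) z) →
        ContinuousOn f (γ '' Set.Icc 0 1) → contourIntegral γ f = 0 := by
  obtain ⟨m, t, h0, h1, ht⟩ := hγ.piecewise
  have hmono : ∀ i ≤ m, ∀ j ≤ i, t j ≤ t i := by
    intro i
    induction i with
    | zero => intro _ j hj; rw [Nat.le_zero.1 hj]
    | succ i ih =>
      intro hi j hj
      rcases Nat.le_succ_iff.1 hj with h | rfl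
      · exact (ih (by omega) j h).trans (ht i (by omega)).1.le
      · exact le_rfl
  have hsub : ∀ i < m, Set.Icc (t i) (t (i + 1)) ⊆ Set.Icc 0 1 := by
    intro i hi
    exact Set.Icc_subset_Icc (h0 ▸ hmono i hi.le 0 (Nat.zero_le _)) (h1 ▸ hmono m le_rfl (i + 1) hi)
  have hcover : ∀ n ≤ m, ContinuousOn γ (Set.Icc 0 (t n)) := by
    intro n
    induction n with
    | zero => intro _; rw [h0, Set.Icc_self]; exact continuousOn_singleton _ _
    | succ n ih =>
      intro hn
      have := (ih (by omega)).union_of_isClosed (ht n (by omega)).2.continuousOn isClosed_Icc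
        isClosed_Icc
      rwa [Set.Icc_union_Icc_eq_Icc (h0 ▸ hmono n (by omega) 0 (Nat.zero_le _))
        (ht n (by omega)).1.le] at this
  have hcont : ContinuousOn γ (Set.Icc 0 1) := h1 ▸ hcover m le_rfl
  have hderivW : ∀ i < m, ContinuousOn (derivWithin γ (Set.Icc (t i) (t (i + 1))))
      (Set.Icc (t i) (t (i + 1))) := fun i hi =>
    (ht i hi).2.continuousOn_derivWithin (uniqueDiffOn_Icc (ht i hi).1) le_rfl
  -- `deriv γ` may take the junk value 0 at the corners; inside each piece it agrees with the
  -- continuous one-sided derivative, which suffices for integrability.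
  have hderiv_eq : ∀ i < m, ∀ x ∈ Set.Ioo (t i) (t (i + 1)),
      HasDerivAt γ (deriv γ x) x ∧ deriv γ x = derivWithin γ (Set.Icc (t i) (t (i + 1))) x := by
    intro i hi x hx
    have hn : Set.Icc (t i) (t (i + 1)) ∈ 𝓝 x := Icc_mem_nhds hx.1 hx.2
    refine ⟨?_, (derivWithin_of_mem_nhds hn).symm⟩
    exact (((ht i hi).2.differentiableOn one_ne_zero).differentiableAt hn).hasDerivAt
  have hint : ∀ i < m, IntervalIntegrable (deriv γ) volume (t i) (t (i + 1)) := by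
    intro i hi
    have h2 : IntervalIntegrable (derivWithin γ (Set.Icc (t i) (t (i + 1)))) volume
        (t i) (t (i + 1)) := by
      refine ContinuousOn.intervalIntegrable ?_
      rw [Set.uIcc_of_le (ht i hi).1.le]
      exact hderivW i hi
    refine h2.congr_uIoo ?_
    intro x hx
    rw [Set.uIoo_of_le (ht i hi).1.le] at hx
    exact ((hderiv_eq i hi x hx).2).symm
  have hintegrable : IntervalIntegrable (deriv γ) volume 0 1 := by
    have := IntervalIntegrable.trans_iterate (μ := volume) (f := deriv γ) (a := t) (n := m) hint
    rwa [h0, h1] at this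
  refine ⟨hcont, hintegrable, fun F f hF hf => ?_⟩
  have hfγ : ContinuousOn (fun s => f (γ s)) (Set.Icc 0 1) :=
    hf.comp hcont (Set.mapsTo_image _ _)
  have hFγ : ContinuousOn (fun s => F (γ s)) (Set.Icc 0 1) := fun s hs =>
    (hF _ ⟨s, hs, rfl⟩).continuousAt.comp_continuousWithinAt (hcont s hs)
  have hpint : ∀ i < m, IntervalIntegrable (fun s => f (γ s) * deriv γ s) volume
      (t i) (t (i + 1)) := by
    intro i hi
    refine (hint i hi).continuousOn_mul ?_
    rw [Set.uIcc_of_le (ht i hi).1.le]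
    exact hfγ.mono (hsub i hi)
  -- The fundamental theorem applies piece by piece; the boundary terms telescope, and the curve is
  -- closed.
  have hpiece : ∀ i < m, ∫ s in (t i)..(t (i + 1)), f (γ s) * deriv γ s =
      F (γ (t (i + 1))) - F (γ (t i)) := by
    intro i hi
    refine intervalIntegral.integral_eq_sub_of_hasDerivAt_of_le (ht i hi).1.le
      (hFγ.mono (hsub i hi)) (fun x hx => ?_) (hpint i hi)
    exact (hF _ ⟨x, hsub i hi (Set.Ioo_subset_Icc_self hx), rfl⟩).comp x (hderiv_eq i hi x hx).1
  have hsum := intervalIntegral.sum_integral_adjacent_intervals (μ := volume)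
    (f := fun s => f (γ s) * deriv γ s) (a := t) (n := m) hpint
  rw [contourIntegral, ← h0, ← h1, ← hsum, Finset.sum_congr rfl fun i hi =>
    hpiece i (Finset.mem_range.1 hi), Finset.sum_range_sub (fun i => F (γ (t i))), h0, h1,
    hγ.closed, sub_self]

variable {γ : ℝ → ℂ}

theorem IsSimpleClosedCurve.intervalIntegrable (hγ : IsSimpleClosedCurve γ) {f : ℂ → ℂ}
    (hf : ContinuousOn f (γ '' Set.Icc 0 1)) :
    IntervalIntegrable (fun s => f (γ s) * deriv γ s) volume 0 1 := by
  obtain ⟨hc, hd, -⟩ := hγ.exists_bound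
  refine hd.continuousOn_mul ?_
  rw [Set.uIcc_of_le zero_le_one]
  exact hf.comp hc (Set.mapsTo_image _ _)

theorem IsSimpleClosedCurve.contourIntegral_add (hγ : IsSimpleClosedCurve γ) {f g : ℂ → ℂ}
    (hf : ContinuousOn f (γ '' Set.Icc 0 1)) (hg : ContinuousOn g (γ '' Set.Icc 0 1)) :
    contourIntegral γ (fun z => f z + g z) = contourIntegral γ f + contourIntegral γ g := by
  simp only [contourIntegral, add_mul]
  exact intervalIntegral.integral_add (hγ.intervalIntegrable hf) (hγ.intervalIntegrable hg)

theorem contourIntegral_const_mul (c : ℂ) (f : ℂ → ℂ) :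
    contourIntegral γ (fun z => c * f z) = c * contourIntegral γ f := by
  simp only [contourIntegral, mul_assoc]
  exact intervalIntegral.integral_const_mul _ _

theorem IsSimpleClosedCurve.contourIntegral_sum (hγ : IsSimpleClosedCurve γ) {ι : Type*}
    (s : Finset ι) {f : ι → ℂ → ℂ} (hf : ∀ i ∈ s, ContinuousOn (f i) (γ '' Set.Icc 0 1)) :
    contourIntegral γ (fun z => ∑ i ∈ s, f i z) = ∑ i ∈ s, contourIntegral γ (f i) := by
  simp only [contourIntegral, Finset.sum_mul]
  exact intervalIntegral.integral_finsetSum fun i hi => hγ.intervalIntegrable (hf i hi)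

theorem contourIntegral_congr {f g : ℂ → ℂ} (h : Set.EqOn f g (γ '' Set.Icc 0 1)) :
    contourIntegral γ f = contourIntegral γ g := by
  refine intervalIntegral.integral_congr fun s hs => ?_
  rw [Set.uIcc_of_le zero_le_one] at hs
  simp only [h ⟨s, hs, rfl⟩]

/-- The contour integral is bounded by a multiple of the supremum of the integrand. -/
theorem IsSimpleClosedCurve.exists_norm_contourIntegral_le (hγ : IsSimpleClosedCurve γ) :
    ∃ C : ℝ, 0 ≤ C ∧ ∀ (f : ℂ → ℂ) (M : ℝ), (∀ z ∈ γ '' Set.Icc 0 1, ‖f z‖ ≤ M) →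
      ‖contourIntegral γ f‖ ≤ M * C := by
  obtain ⟨hc, hd, -⟩ := hγ.exists_bound
  refine ⟨∫ s in (0 : ℝ)..1, ‖deriv γ s‖, intervalIntegral.integral_nonneg zero_le_one
    fun _ _ => norm_nonneg _, fun f M hM => ?_⟩
  rw [← intervalIntegral.integral_const_mul]
  refine intervalIntegral.norm_integral_le_of_norm_le zero_le_one ?_ (hd.norm.const_mul M)
  refine Eventually.of_forall fun s hs => ?_
  rw [norm_mul]
  exact mul_le_mul_of_nonneg_right (hM _ ⟨s, Set.Ioc_subset_Icc_self hs, rfl⟩) (norm_nonneg _)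

theorem IsSimpleClosedCurve.contourIntegral_pow (hγ : IsSimpleClosedCurve γ) (n : ℕ) :
    contourIntegral γ (fun z => z ^ n) = 0 := by
  refine hγ.exists_bound.2.2 (fun z => z ^ (n + 1) / (n + 1)) _ (fun z _ => ?_)
    (continuous_pow n).continuousOn
  have := (hasDerivAt_pow (n + 1) z).div_const ((n : ℂ) + 1)
  have hne : (n : ℂ) + 1 ≠ 0 := Nat.cast_add_one_ne_zero n
  simpa [mul_div_cancel_left₀ _ hne] using this

theorem IsSimpleClosedCurve.contourIntegral_inv_pow (hγ : IsSimpleClosedCurve γ)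
    (h0 : (0 : ℂ) ∉ γ '' Set.Icc 0 1) (n : ℕ) :
    contourIntegral γ (fun z => (z ^ (n + 2))⁻¹) = 0 := by
  refine hγ.exists_bound.2.2 (fun z => -(z ^ (n + 1))⁻¹ / (n + 1)) _ (fun z hz => ?_)
    (fun z hz => ?_)
  · have hz0 : z ≠ 0 := fun h => h0 (h ▸ hz)
    have h1 := (((hasDerivAt_pow (n + 1) z).inv (pow_ne_zero _ hz0)).neg).div_const ((n : ℂ) + 1)
    have hne : (n : ℂ) + 1 ≠ 0 := Nat.cast_add_one_ne_zero n
    refine h1.congr_deriv ?_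
    push_cast
    field_simp
    ring
  · have hz0 : z ≠ 0 := fun h => h0 (h ▸ hz)
    exact ((continuous_pow _).continuousAt.inv₀ (pow_ne_zero _ hz0)).continuousWithinAt

/-- The winding number form of Cauchy's formula for a power. -/
theorem IsSimpleClosedCurve.contourIntegral_pow_div (hγ : IsSimpleClosedCurve γ) {μ : ℂ}
    (hμ : μ ∉ γ '' Set.Icc 0 1)
    (hw : (2 * Real.pi * Complex.I)⁻¹ * contourIntegral γ (fun w => (w - μ)⁻¹) = 1) (n : ℕ) :
    (2 * Real.pi * Complex.I)⁻¹ * contourIntegral γ (fun z => z ^ n * (z - μ)⁻¹) = μ ^ n := by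
  have hinv : ContinuousOn (fun z => (z - μ)⁻¹) (γ '' Set.Icc 0 1) := fun z hz =>
    ((continuous_id.sub continuous_const).continuousAt.inv₀
      (sub_ne_zero.2 fun h : z = μ => hμ (h ▸ hz))).continuousWithinAt
  have hcont : ∀ k, ContinuousOn (fun z => μ * (z ^ k * (z - μ)⁻¹)) (γ '' Set.Icc 0 1) :=
    fun k => continuousOn_const.mul ((continuous_pow k).continuousOn.mul hinv)
  induction n with
  | zero => simpa using hw
  | succ n ih =>
    have h1 : contourIntegral γ (fun z => z ^ (n + 1) * (z - μ)⁻¹) =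
        contourIntegral γ (fun z => z ^ n + μ * (z ^ n * (z - μ)⁻¹)) := by
      refine contourIntegral_congr fun z hz => ?_
      have : z - μ ≠ 0 := sub_ne_zero.2 fun h : z = μ => hμ (h ▸ hz)
      field_simp
      ring
    rw [h1, hγ.contourIntegral_add (continuous_pow n).continuousOn (hcont n),
      hγ.contourIntegral_pow, zero_add, contourIntegral_const_mul, mul_left_comm, ih, pow_succ']

variable {E : Type*} [NormedAddCommGroup E] [NormedSpace ℂ E]

theorem resolvent_apply_eq {A : E →L[ℂ] E} {z : ℂ} (hz : z ∉ spectrum ℂ A) {v w : E}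
    (h : z • w - A w = v) : resolvent A z v = w := by
  have hu : IsUnit (algebraMap ℂ (E →L[ℂ] E) z - A) := by
    rwa [spectrum.notMem_iff] at hz
  have h1 : (resolvent A z * (algebraMap ℂ (E →L[ℂ] E) z - A)) w = w := by
    rw [resolvent, Ring.inverse_mul_cancel _ hu]; rfl
  rw [← h]
  simpa [Algebra.algebraMap_eq_smul_one] using h1

theorem smul_sub_resolvent_apply {A : E →L[ℂ] E} {z : ℂ} (hz : z ∉ spectrum ℂ A) (v : E) :
    z • resolvent A z v - A (resolvent A z v) = v := by
  have hu : IsUnit (algebraMap ℂ (E →L[ℂ] E) z - A) := by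
    rwa [spectrum.notMem_iff] at hz
  have h1 : ((algebraMap ℂ (E →L[ℂ] E) z - A) * resolvent A z) v = v := by
    rw [resolvent, Ring.mul_inverse_cancel _ hu]; rfl
  simpa [Algebra.algebraMap_eq_smul_one] using h1

/-- Finite Neumann expansion of the resolvent. -/
theorem resolvent_apply_neumann {A : E →L[ℂ] E} {z : ℂ} (hz : z ∉ spectrum ℂ A) (hz0 : z ≠ 0)
    (v : E) (M : ℕ) :
    resolvent A z v = ∑ k ∈ Finset.range M, (z ^ (k + 1))⁻¹ • (A ^ k) v +
      (z ^ M)⁻¹ • resolvent A z ((A ^ M) v) := by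
  induction M with
  | zero => simp
  | succ M ih =>
    have h1 : resolvent A z ((A ^ M) v) =
        z⁻¹ • ((A ^ M) v) + z⁻¹ • resolvent A z ((A ^ (M + 1)) v) := by
      refine resolvent_apply_eq hz ?_
      have h2 := smul_sub_resolvent_apply hz ((A ^ (M + 1)) v)
      have h3 : (A ^ (M + 1)) v = A ((A ^ M) v) := by rw [pow_succ', mul_apply_eq_comp]
      rw [map_add, map_smul, map_smul, smul_add, smul_smul, smul_smul, mul_inv_cancel₀ hz0,
        one_smul, one_smul]
      have h4 : resolvent A z ((A ^ (M + 1)) v) =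
          z⁻¹ • ((A ^ (M + 1)) v) + z⁻¹ • A (resolvent A z ((A ^ (M + 1)) v)) := by
        rw [← smul_add]
        nth_rewrite 2 [← h2]
        rw [sub_add_cancel, smul_smul, inv_mul_cancel₀ hz0, one_smul]
      rw [← h3]
      nth_rewrite 1 [h4]
      abel
    rw [ih, Finset.sum_range_succ, h1, smul_add, smul_smul, smul_smul, ← mul_inv, ← pow_succ]
    abel

theorem continuousOn_resolvent [CompleteSpace E] (A : E →L[ℂ] E) {s : Set ℂ}
    (hs : Disjoint s (spectrum ℂ A)) : ContinuousOn (resolvent A) s := by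
  intro z hz
  have hz' : z ∈ resolventSet ℂ A := by
    by_contra h; exact Set.disjoint_left.1 hs hz h
  exact (spectrum.hasDerivAt_resolvent_const_left (𝕜 := ℂ) hz').continuousAt.continuousWithinAt

/-- The holomorphic functional calculus for powers, on a vector whose orbit decays fast. -/
theorem IsSimpleClosedCurve.contourIntegral_resolvent_of_decay [CompleteSpace E]
    (hγ : IsSimpleClosedCurve γ) {A : E →L[ℂ] E} (hγA : Disjoint (γ '' Set.Icc 0 1) (spectrum ℂ A))
    (h0 : (0 : ℂ) ∉ γ '' Set.Icc 0 1)
    (hw : (2 * Real.pi * Complex.I)⁻¹ * contourIntegral γ (fun w => (w - 0)⁻¹) = 1)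
    {δ r C : ℝ} (hr : 0 ≤ r) (hrδ : r < δ) (hδ : ∀ z ∈ γ '' Set.Icc 0 1, δ ≤ ‖z‖) {w : E}
    (hC : ∀ n : ℕ, ‖(A ^ n) w‖ ≤ C * r ^ n) (ℓ : E →L[ℂ] ℂ) (N : ℕ) :
    (2 * Real.pi * Complex.I)⁻¹ * contourIntegral γ (fun z => z ^ N * ℓ (resolvent A z w)) =
      ℓ ((A ^ N) w) := by
  have hγc := hγ.exists_bound.1
  have hδ0 : 0 < δ := hr.trans_lt hrδ
  have hK : IsCompact (γ '' Set.Icc 0 1) := isCompact_Icc.image_of_continuousOn hγc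
  have hne : ∀ z ∈ γ '' Set.Icc 0 1, z ≠ 0 := fun z hz h => h0 (h ▸ hz)
  have hns : ∀ z ∈ γ '' Set.Icc 0 1, z ∉ spectrum ℂ A := fun z hz => Set.disjoint_left.1 hγA hz
  have hRc : ∀ v : E, ContinuousOn (fun z => resolvent A z v) (γ '' Set.Icc 0 1) := fun v =>
    (continuousOn_resolvent A hγA).clm_apply continuousOn_const
  obtain ⟨B, hB⟩ := hK.exists_bound_of_continuousOn (continuousOn_resolvent A hγA)
  obtain ⟨R, hR⟩ := hK.exists_bound_of_continuousOn continuousOn_id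
  obtain ⟨L, hL0, hL⟩ := hγ.exists_norm_contourIntegral_le
  have hpowc : ∀ k, ContinuousOn (fun z : ℂ => (z ^ k)⁻¹) (γ '' Set.Icc 0 1) := fun k z hz =>
    ((continuous_pow k).continuousAt.inv₀ (pow_ne_zero _ (hne z hz))).continuousWithinAt
  -- The k-th Neumann term is a multiple of z^{N-k-1}. Only k = N gives 1/z and the winding number;
  -- every other power has a primitive along the curve.
  have hterm : ∀ k, (2 * Real.pi * Complex.I)⁻¹ *
      contourIntegral γ (fun z => z ^ N * ((z ^ (k + 1))⁻¹ * ℓ ((A ^ k) w))) =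
      if k = N then ℓ ((A ^ N) w) else 0 := by
    intro k
    have e1 : contourIntegral γ (fun z => z ^ N * ((z ^ (k + 1))⁻¹ * ℓ ((A ^ k) w))) =
        ℓ ((A ^ k) w) * contourIntegral γ (fun z => z ^ N * (z ^ (k + 1))⁻¹) := by
      rw [← contourIntegral_const_mul]
      exact contourIntegral_congr fun z _ => by ring
    rcases lt_trichotomy k N with hk | rfl | hk
    · obtain ⟨d, rfl⟩ := Nat.exists_eq_add_of_lt hk
      rw [e1, contourIntegral_congr (g := fun z => z ^ d), hγ.contourIntegral_pow, mul_zero,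
        mul_zero, if_neg hk.ne]
      intro z hz
      have := hne z hz
      simp only
      field_simp
      ring
    · rw [if_pos rfl, e1, contourIntegral_congr (g := fun z => (z - 0)⁻¹), mul_left_comm, hw,
        mul_one]
      intro z hz
      have := hne z hz
      simp only
      field_simp
      ring
    · obtain ⟨d, rfl⟩ := Nat.exists_eq_add_of_lt hk
      rw [e1, contourIntegral_congr (g := fun z => (z ^ (d + 2))⁻¹),
        hγ.contourIntegral_inv_pow h0, mul_zero, mul_zero, if_neg hk.ne']
      intro z hz
      have := hne z hz
      simp only
      field_simp
      ring
  have hexp : ∀ M, N < M → (2 * Real.pi * Complex.I)⁻¹ *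
      contourIntegral γ (fun z => z ^ N * ℓ (resolvent A z w)) = ℓ ((A ^ N) w) +
      (2 * Real.pi * Complex.I)⁻¹ *
        contourIntegral γ (fun z => z ^ N * ((z ^ M)⁻¹ * ℓ (resolvent A z ((A ^ M) w)))) := by
    intro M hM
    rw [contourIntegral_congr (g := fun z =>
      (∑ k ∈ Finset.range M, z ^ N * ((z ^ (k + 1))⁻¹ * ℓ ((A ^ k) w))) +
        z ^ N * ((z ^ M)⁻¹ * ℓ (resolvent A z ((A ^ M) w)))), hγ.contourIntegral_add,
      hγ.contourIntegral_sum, mul_add, Finset.mul_sum, Finset.sum_congr rfl fun k _ => hterm k,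
      Finset.sum_ite_eq' , if_pos (Finset.mem_range.2 hM)]
    · exact fun k _ => (continuous_pow N).continuousOn.mul ((hpowc _).mul continuousOn_const)
    · exact continuousOn_finsetSum _ fun k _ =>
        (continuous_pow N).continuousOn.mul ((hpowc _).mul continuousOn_const)
    · exact (continuous_pow N).continuousOn.mul ((hpowc _).mul
        (ℓ.continuous.comp_continuousOn (hRc _)))
    · intro z hz
      simp only
      rw [resolvent_apply_neumann (hns z hz) (hne z hz) w M, map_add, map_sum]
      simp only [map_smul, smul_eq_mul]
      rw [mul_add, Finset.mul_sum]
  -- The remainder is of order (r/δ)^M, since |z| is at least δ on the curve while the orbit decays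
  -- like r^M.
  have hlim : Tendsto (fun M => (2 * Real.pi * Complex.I)⁻¹ *
        contourIntegral γ (fun z => z ^ N * ((z ^ M)⁻¹ * ℓ (resolvent A z ((A ^ M) w))))) atTop
        (𝓝 ((2 * Real.pi * Complex.I)⁻¹ * 0)) := by
    refine Tendsto.const_mul _ (squeeze_zero_norm (a := fun M : ℕ =>
      R ^ N * (‖ℓ‖ * (B * C)) * (r / δ) ^ M * L) (fun M => ?_) ?_)
    · refine hL _ _ fun z hz => ?_
      have hz1 : ‖z‖ ≤ R := hR z hz
      have hz2 : ‖ℓ (resolvent A z ((A ^ M) w))‖ ≤ ‖ℓ‖ * (B * (C * r ^ M)) := by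
        refine (ℓ.le_opNorm _).trans ?_
        gcongr
        refine ((resolvent A z).le_opNorm _).trans ?_
        have hB0 : 0 ≤ B := (norm_nonneg _).trans (hB z hz)
        exact mul_le_mul (hB z hz) (hC M) (norm_nonneg _) hB0
      have hz3 : ‖(z ^ M)⁻¹‖ ≤ (δ ^ M)⁻¹ := by
        rw [norm_inv, norm_pow]
        gcongr
        exact hδ z hz
      have hz4 : 0 ≤ ‖ℓ‖ * (B * (C * r ^ M)) := (norm_nonneg _).trans hz2
      have hR0 : 0 ≤ R := (norm_nonneg _).trans hz1
      calc ‖z ^ N * ((z ^ M)⁻¹ * ℓ (resolvent A z ((A ^ M) w)))‖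
          = ‖z‖ ^ N * (‖(z ^ M)⁻¹‖ * ‖ℓ (resolvent A z ((A ^ M) w))‖) := by
            rw [norm_mul, norm_mul, norm_pow]
        _ ≤ R ^ N * ((δ ^ M)⁻¹ * (‖ℓ‖ * (B * (C * r ^ M)))) := by gcongr
        _ = _ := by rw [div_pow]; field_simp
    · have := (tendsto_pow_atTop_nhds_zero_of_lt_one (div_nonneg hr hδ0.le)
        ((div_lt_one hδ0).2 hrδ))
      simpa using (this.const_mul (R ^ N * (‖ℓ‖ * (B * C)))).mul_const L
  rw [mul_zero] at hlim
  have hconst := (tendsto_const_nhds (x := ℓ ((A ^ N) w)) (f := atTop (α := ℕ))).add hlim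
  rw [add_zero] at hconst
  refine tendsto_nhds_unique (tendsto_const_nhds.congr' ?_) hconst
  filter_upwards [eventually_gt_atTop N] with M hM
  exact hexp M hM

end Contour

/-! ### Hausdorff measure along a regular curve -/

section ArcLength

/-- By second countability countably many of the neighbourhoods cover the space; made disjoint, they
allow the local inequalities to be summed. -/
theorem _root_.MeasureTheory.Measure.le_smul_of_locally_le {X : Type*} [TopologicalSpace X]
    [SecondCountableTopology X] [MeasurableSpace X] [OpensMeasurableSpace X] {μ ν : Measure X}
    {K : ℝ≥0∞} (h : ∀ x, ∃ U, IsOpen U ∧ x ∈ U ∧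
      ∀ s ⊆ U, MeasurableSet s → μ s ≤ K * ν s) : μ ≤ K • ν := by
  choose U hUo hxU hU using h
  obtain ⟨T, hTc, hT⟩ := TopologicalSpace.countable_cover_nhds fun x => (hUo x).mem_nhds (hxU x)
  rcases T.eq_empty_or_nonempty with rfl | hTne
  · have hempty : (Set.univ : Set X) = ∅ := by rw [← hT]; simp
    refine Measure.le_iff.2 fun s _ => ?_
    have : s = ∅ := Set.subset_eq_empty (Set.subset_univ s) hempty
    simp [this]
  obtain ⟨x, rfl⟩ := hTc.exists_eq_range hTne
  refine Measure.le_iff.2 fun s hs => ?_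
  have hcov : s = ⋃ n, s ∩ disjointed (fun n => U (x n)) n := by
    rw [← Set.inter_iUnion, iUnion_disjointed]
    have : ⋃ n, U (x n) = Set.univ := by rw [← hT]; simp
    rw [this, Set.inter_univ]
  have hm : ∀ n, MeasurableSet (s ∩ disjointed (fun n => U (x n)) n) := fun n =>
    hs.inter (MeasurableSet.disjointed (fun n => (hUo (x n)).measurableSet) n)
  have hd : Pairwise (Function.onFun Disjoint fun n => s ∩ disjointed (fun n => U (x n)) n) :=
    fun i j hij => (disjoint_disjointed _ hij).mono Set.inter_subset_right Set.inter_subset_right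
  rw [hcov, Measure.smul_apply, measure_iUnion hd hm, measure_iUnion hd hm, smul_eq_mul,
    ← ENNReal.tsum_mul_left]
  exact ENNReal.tsum_le_tsum fun n => hU (x n) _
    (Set.inter_subset_right.trans (disjointed_subset _ _)) (hm n)

theorem _root_.MeasureTheory.Measure.le_of_forall_one_lt_le_smul {X : Type*} [MeasurableSpace X]
    {μ ν : Measure X} (h : ∀ K : ℝ≥0, 1 < K → μ ≤ (K : ℝ≥0∞) • ν) : μ ≤ ν := by
  refine Measure.le_iff.2 fun s hs => ?_
  have hlim : Tendsto (fun K : ℝ≥0 => (K : ℝ≥0∞) * ν s) (𝓝[>] 1) (𝓝 (1 * ν s)) := by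
    refine ENNReal.Tendsto.mul_const ?_ (Or.inl one_ne_zero)
    exact (ENNReal.continuous_coe.tendsto' 1 1 (by simp)).mono_left nhdsWithin_le_nhds
  rw [one_mul] at hlim
  refine ge_of_tendsto hlim ?_
  filter_upwards [self_mem_nhdsWithin] with K hK
  simpa using Measure.le_iff.1 (h K hK) s hs

variable {F : Type*} [NormedAddCommGroup F]

theorem exists_nhds_norm_sub_le_of_hasStrictDerivAt [NormedSpace ℝ F] {G : ℝ → F} {v : F} {t : ℝ}
    (hG : HasStrictDerivAt G v t) (hv : v ≠ 0) {K : ℝ} (hK : 1 < K) :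
    ∃ U, IsOpen U ∧ t ∈ U ∧ ∀ x ∈ U, ∀ y ∈ U, ‖G x - G y‖ ≤ K * ‖v‖ * |x - y| ∧
      ‖v‖ * |x - y| ≤ K * ‖G x - G y‖ := by
  have hv' : 0 < ‖v‖ := norm_pos_iff.2 hv
  have hK0 : 0 < K := one_pos.trans hK
  -- This error serves both bounds: the lower slope is exactly ‖v‖/K, and the upper one is ‖v‖(2 -
  -- 1/K), at most K‖v‖ because (K - 1)²/K is nonnegative.
  have hη : 0 < ‖v‖ * (1 - K⁻¹) := mul_pos hv' (sub_pos.2 (inv_lt_one_of_one_lt₀ hK))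
  have h1 := (hasStrictDerivAt_iff_hasStrictFDerivAt.1 hG).isLittleO.def hη
  rw [nhds_prod_eq] at h1
  obtain ⟨U, hU, hUU⟩ := (eventually_prod_self_iff (r := fun a b : ℝ =>
    ‖G a - G b - (ContinuousLinearMap.toSpanSingleton ℝ v) (a - b)‖ ≤
      ‖v‖ * (1 - K⁻¹) * ‖a - b‖)).1 h1
  refine ⟨interior U, isOpen_interior, mem_interior_iff_mem_nhds.2 hU, fun x hx y hy => ?_⟩
  have h2 := hUU x (interior_subset hx) y (interior_subset hy)
  simp only [ContinuousLinearMap.toSpanSingleton_apply, Real.norm_eq_abs] at h2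
  have h3 : ‖(x - y) • v‖ = ‖v‖ * |x - y| := by rw [norm_smul, Real.norm_eq_abs, mul_comm]
  have h4 : ‖G x - G y‖ ≤ ‖G x - G y - (x - y) • v‖ + ‖(x - y) • v‖ := by
    simpa using norm_add_le (G x - G y - (x - y) • v) ((x - y) • v)
  have h5 : ‖(x - y) • v‖ ≤ ‖G x - G y - (x - y) • v‖ + ‖G x - G y‖ := by
    rw [norm_sub_rev (G x - G y)]
    simpa using norm_add_le ((x - y) • v - (G x - G y)) (G x - G y)
  rw [h3] at h4 h5
  have hKinv : K * K⁻¹ = 1 := mul_inv_cancel₀ hK0.ne'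
  have hkk : 0 ≤ K - 2 + K⁻¹ := by
    have : 0 ≤ (K - 1) ^ 2 * K⁻¹ := by positivity
    nlinarith
  have hb := abs_nonneg (x - y)
  have hvb : 0 ≤ ‖v‖ * |x - y| := by positivity
  constructor
  · nlinarith
  · have : ‖v‖ * |x - y| * K⁻¹ ≤ ‖G x - G y‖ := by nlinarith
    calc ‖v‖ * |x - y| = K * (‖v‖ * |x - y| * K⁻¹) := by linear_combination -(‖v‖ * |x - y|) * hKinv
      _ ≤ _ := by gcongr

variable [MeasurableSpace F] [BorelSpace F]

theorem hausdorffMeasure_image_le_of_norm_sub_le {G : ℝ → F} {s : Set ℝ} {L : ℝ≥0}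
    (h : ∀ x ∈ s, ∀ y ∈ s, ‖G x - G y‖ ≤ L * |x - y|) : μH[1] (G '' s) ≤ L * volume s := by
  have := (LipschitzOnWith.of_dist_le_mul (K := L) (f := G) (s := s) fun x hx y hy => by
    rw [dist_eq_norm, Real.dist_eq]; exact h x hx y hy).hausdorffMeasure_image_le zero_le_one
  simpa [hausdorffMeasure_real] using this

theorem volume_le_of_norm_sub_le {G : ℝ → F} {s : Set ℝ} {L : ℝ≥0}
    (h : ∀ x ∈ s, ∀ y ∈ s, |x - y| ≤ L * ‖G x - G y‖) : volume s ≤ L * μH[1] (G '' s) := by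
  have hinj : Set.InjOn G s := fun x hx y hy hxy => by
    have := h x hx y hy
    rw [hxy, sub_self, norm_zero, mul_zero] at this
    exact sub_eq_zero.1 (abs_nonpos_iff.1 this)
  have hinv := hinj.leftInvOn_invFunOn
  have := (LipschitzOnWith.of_dist_le_mul (K := L) (f := Function.invFunOn G s) (s := G '' s) ?_
    ).hausdorffMeasure_image_le zero_le_one
  · rw [hinv.image_image] at this
    simpa [hausdorffMeasure_real] using this
  · rintro _ ⟨x, hx, rfl⟩ _ ⟨y, hy, rfl⟩
    rw [Real.dist_eq, dist_eq_norm, hinv hx, hinv hy]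
    exact h x hx y hy

/-- Arc length of a regular `C¹` curve. -/
theorem comap_hausdorffMeasure_eq_withDensity [NormedSpace ℝ F] {G G' : ℝ → F}
    (hG : ∀ t, HasStrictDerivAt G (G' t) t) (hG' : Continuous G') (hne : ∀ t, G' t ≠ 0)
    (hemb : MeasurableEmbedding G) :
    Measure.comap G μH[1] = volume.withDensity fun t => ‖G' t‖ₑ := by
  have hnear : ∀ (K : ℝ≥0), 1 < K → ∀ t, ∃ U, IsOpen U ∧ t ∈ U ∧
      (∀ x ∈ U, ∀ y ∈ U, ‖G x - G y‖ ≤ K * ‖G' t‖ * |x - y| ∧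
        ‖G' t‖ * |x - y| ≤ K * ‖G x - G y‖) ∧
      ∀ x ∈ U, ‖G' t‖ ≤ K * ‖G' x‖ ∧ ‖G' x‖ ≤ K * ‖G' t‖ := by
    intro K hK t
    have hK1 : (1 : ℝ) < K := by exact_mod_cast hK
    obtain ⟨U, hUo, htU, hU⟩ := exists_nhds_norm_sub_le_of_hasStrictDerivAt (hG t) (hne t) hK1
    have hpos : 0 < ‖G' t‖ := norm_pos_iff.2 (hne t)
    have hn : {x | ‖G' t‖ < K * ‖G' x‖} ∩ {x | ‖G' x‖ < K * ‖G' t‖} ∈ 𝓝 t := by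
      refine IsOpen.mem_nhds ?_ ⟨?_, ?_⟩
      · exact (isOpen_lt continuous_const (continuous_const.mul hG'.norm)).inter
          (isOpen_lt hG'.norm continuous_const)
      · show ‖G' t‖ < K * ‖G' t‖
        nlinarith
      · show ‖G' t‖ < K * ‖G' t‖
        nlinarith
    obtain ⟨V, hV, hVo, htV⟩ := mem_nhds_iff.1 hn
    exact ⟨U ∩ V, hUo.inter hVo, ⟨htU, htV⟩, fun x hx y hy => hU x hx.1 y hy.1,
      fun x hx => ⟨(hV hx.2).1.le, (hV hx.2).2.le⟩⟩
  -- Two errors are multiplied, each of size √K: the deviation of `G` from its linear part and the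
  -- variation of ‖G'‖ over the neighbourhood. Letting K tend to 1 gives equality of the measures.
  have hsq : ∀ K : ℝ≥0, 1 < K → ∃ L : ℝ≥0, 1 < L ∧ L * L = K := fun K hK =>
    ⟨NNReal.sqrt K, by simpa using NNReal.sqrt_lt_sqrt.2 hK, NNReal.mul_self_sqrt K⟩
  refine le_antisymm ?_ ?_
  · refine Measure.le_of_forall_one_lt_le_smul fun K hK => Measure.le_smul_of_locally_le fun t => ?_
    obtain ⟨L, hL, rfl⟩ := hsq K hK
    obtain ⟨U, hUo, htU, h1, h2⟩ := hnear L hL t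
    refine ⟨U, hUo, htU, fun s hs hsm => ?_⟩
    rw [hemb.comap_apply, withDensity_apply _ hsm, ENNReal.coe_mul, mul_assoc]
    calc μH[1] (G '' s) ≤ (L * ‖G' t‖₊ : ℝ≥0) * volume s :=
          hausdorffMeasure_image_le_of_norm_sub_le fun x hx y hy => by
            simpa using (h1 x (hs hx) y (hs hy)).1
      _ = L * ∫⁻ x in s, ‖G' t‖ₑ := by
          rw [setLIntegral_const, ENNReal.coe_mul, mul_assoc]; rfl
      _ ≤ L * ∫⁻ x in s, L * ‖G' x‖ₑ := by
          gcongr 1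
          refine setLIntegral_mono_ae' hsm (Eventually.of_forall fun x hx => ?_)
          have := (h2 x (hs hx)).1
          have h3 : ‖G' t‖₊ ≤ L * ‖G' x‖₊ := this
          simpa only [enorm_eq_nnnorm] using (by exact_mod_cast h3 :
            ((‖G' t‖₊ : ℝ≥0) : ℝ≥0∞) ≤ L * (‖G' x‖₊ : ℝ≥0))
      _ = _ := by rw [lintegral_const_mul' _ _ ENNReal.coe_ne_top]
  · refine Measure.le_of_forall_one_lt_le_smul fun K hK => Measure.le_smul_of_locally_le fun t => ?_
    obtain ⟨L, hL, rfl⟩ := hsq K hK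
    obtain ⟨U, hUo, htU, h1, h2⟩ := hnear L hL t
    have hpos : 0 < ‖G' t‖₊ := nnnorm_pos.2 (hne t)
    refine ⟨U, hUo, htU, fun s hs hsm => ?_⟩
    rw [hemb.comap_apply, withDensity_apply _ hsm]
    have hvol : volume s ≤ (L * ‖G' t‖₊⁻¹ : ℝ≥0) * μH[1] (G '' s) :=
      volume_le_of_norm_sub_le fun x hx y hy => by
        have := (h1 x (hs hx) y (hs hy)).2
        have hpos' : 0 < ‖G' t‖ := hpos
        push_cast
        rw [mul_right_comm, ← div_eq_mul_inv, le_div_iff₀ hpos', mul_comm]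
        exact this
    calc ∫⁻ x in s, ‖G' x‖ₑ ≤ ∫⁻ x in s, L * ‖G' t‖ₑ := by
          refine setLIntegral_mono_ae' hsm (Eventually.of_forall fun x hx => ?_)
          have := (h2 x (hs hx)).2
          have h3 : ‖G' x‖₊ ≤ L * ‖G' t‖₊ := this
          simpa only [enorm_eq_nnnorm] using (by exact_mod_cast h3 :
            ((‖G' x‖₊ : ℝ≥0) : ℝ≥0∞) ≤ L * (‖G' t‖₊ : ℝ≥0))
      _ = (L * ‖G' t‖₊ : ℝ≥0) * volume s := by rw [setLIntegral_const, ENNReal.coe_mul]; rfl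
      _ ≤ (L * ‖G' t‖₊ : ℝ≥0) * ((L * ‖G' t‖₊⁻¹ : ℝ≥0) * μH[1] (G '' s)) := by gcongr
      _ = _ := by
          rw [← mul_assoc, ← ENNReal.coe_mul]
          congr 2
          field_simp

end ArcLength

/-! ### The outward normal -/

section Normal

/-- Moving from x in the direction v - w, the inner products with v and w are ±‖v - w‖²/2 per unit
of time. The first forbids membership in D, the second forbids non-membership. -/
theorem IsOutwardNormal.unique {D : Set Plane} {x v w : Plane} (hv : IsOutwardNormal D x v)
    (hw : IsOutwardNormal D x w) : v = w := by
  by_contra hne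
  have hpos : 0 < ‖v - w‖ := norm_pos_iff.2 (sub_ne_zero.2 hne)
  have h1 : inner ℝ (v - w) v = ‖v - w‖ ^ 2 / 2 := by
    rw [← real_inner_self_eq_norm_sq]
    simp only [inner_sub_left, inner_sub_right, real_inner_self_eq_norm_sq, hv.1, hw.1,
      real_inner_comm v w]
    ring
  have h2 : inner ℝ (v - w) w = -(‖v - w‖ ^ 2 / 2) := by
    rw [← real_inner_self_eq_norm_sq]
    simp only [inner_sub_left, inner_sub_right, real_inner_self_eq_norm_sq, hv.1, hw.1,
      real_inner_comm v w]
    ring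
  have hlim : Tendsto (fun t : ℝ => x + t • (v - w)) (𝓝[>] 0) (𝓝 x) := by
    have : Continuous fun t : ℝ => x + t • (v - w) := by fun_prop
    exact (this.tendsto' 0 x (by simp)).mono_left nhdsWithin_le_nhds
  have hε : 0 < ‖v - w‖ / 4 := by positivity
  obtain ⟨t, ⟨h3, h4⟩, ht⟩ := ((hlim.eventually ((hv.2 _ hε).and (hw.2 _ hε))).and
    self_mem_nhdsWithin).exists
  have ht : 0 < t := ht
  simp only [add_sub_cancel_left, inner_smul_left, norm_smul, Real.norm_eq_abs, abs_of_pos ht,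
    h1, h2, conj_trivial] at h3 h4
  have hc : 0 < t * ‖v - w‖ ^ 2 := by positivity
  by_cases hD : x + t • (v - w) ∈ D
  · nlinarith [h3.1 hD]
  · nlinarith [h4.2 hD]

theorem IsOutwardNormal.normal_eq {D : Set Plane} {x v : Plane} (hv : IsOutwardNormal D x v) :
    normal D x = v := by
  have h : ∃ v, IsOutwardNormal D x v := ⟨v, hv⟩
  rw [normal, dif_pos h]
  exact h.choose_spec.unique hv

theorem norm_normal_le (D : Set Plane) (x : Plane) : ‖normal D x‖ ≤ 1 := by
  rw [normal]
  split_ifs with h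
  · exact h.choose_spec.1.le
  · simp

end Normal

/-! ### Geometry of the boundary in graph coordinates -/

section Chart

/-- In the open set `U`, `D` is the part of the plane above the graph of `g` in the Cartesian
coordinates `e`. -/
structure IsChart (a C : ℝ≥0) (D : Set Plane) (e : Plane ≃ᵃⁱ[ℝ] Plane) (g : ℝ → ℝ)
    (U : Set Plane) : Prop where
  isOpen : IsOpen U
  diff : Differentiable ℝ g
  holder : HolderWith C a (deriv g)
  mem_iff : ∀ x ∈ U, x ∈ D ↔ g (e x 0) < e x 1

/-- The tangent vector of the graph. -/
def chartTangent (e : Plane ≃ᵃⁱ[ℝ] Plane) (g : ℝ → ℝ) (t : ℝ) : Plane :=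
  e.linearIsometryEquiv.symm !₂[1, deriv g t]

/-- The parametrization of the graph. -/
def chartCurve (e : Plane ≃ᵃⁱ[ℝ] Plane) (g : ℝ → ℝ) (t : ℝ) : Plane := e.symm !₂[t, g t]

/-- The unit normal pointing below the graph. -/
def chartNormal (e : Plane ≃ᵃⁱ[ℝ] Plane) (g : ℝ → ℝ) (t : ℝ) : Plane :=
  (√(1 + deriv g t ^ 2))⁻¹ • e.linearIsometryEquiv.symm !₂[deriv g t, -1]

theorem norm_vec2 (a b : ℝ) : ‖(!₂[a, b] : Plane)‖ = √(a ^ 2 + b ^ 2) := by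
  simp [EuclideanSpace.norm_eq, Fin.sum_univ_two]

theorem norm_chartTangent (e : Plane ≃ᵃⁱ[ℝ] Plane) (g : ℝ → ℝ) (t : ℝ) :
    ‖chartTangent e g t‖ = √(1 + deriv g t ^ 2) := by
  rw [chartTangent, LinearIsometryEquiv.norm_map, norm_vec2, one_pow]

theorem norm_chartNormal (e : Plane ≃ᵃⁱ[ℝ] Plane) (g : ℝ → ℝ) (t : ℝ) :
    ‖chartNormal e g t‖ = 1 := by
  have : 0 < √(1 + deriv g t ^ 2) := by positivity
  rw [chartNormal, norm_smul, LinearIsometryEquiv.norm_map, norm_vec2, norm_inv, Real.norm_eq_abs,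
    abs_of_pos this, neg_one_sq, add_comm (deriv g t ^ 2)]
  exact inv_mul_cancel₀ this.ne'

theorem inner_chartNormal (e : Plane ≃ᵃⁱ[ℝ] Plane) (g : ℝ → ℝ) (t : ℝ) (v : Plane) :
    inner ℝ v (chartNormal e g t) = (√(1 + deriv g t ^ 2))⁻¹ *
      (deriv g t * e.linearIsometryEquiv v 0 - e.linearIsometryEquiv v 1) := by
  rw [chartNormal, inner_smul_right, ← LinearIsometryEquiv.inner_map_map e.linearIsometryEquiv,
    LinearIsometryEquiv.apply_symm_apply]
  simp [PiLp.inner_apply, Fin.sum_univ_two]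
  ring_nf
  simp

theorem linearIsometryEquiv_sub (e : Plane ≃ᵃⁱ[ℝ] Plane) (x y : Plane) :
    e.linearIsometryEquiv (x - y) = e x - e y := by
  have := e.map_vsub x y
  simpa using this

theorem abs_coord_sub_le (e : Plane ≃ᵃⁱ[ℝ] Plane) (x y : Plane) (i : Fin 2) :
    |e x i - e y i| ≤ ‖x - y‖ := by
  rw [← e.linearIsometryEquiv.norm_map, linearIsometryEquiv_sub]
  exact PiLp.norm_apply_le (e x - e y) i

theorem continuous_coord (e : Plane ≃ᵃⁱ[ℝ] Plane) (i : Fin 2) : Continuous fun x => e x i := by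
  have := e.continuous
  fun_prop

theorem inv_sqrt_le_one (b : ℝ) : (√(1 + b ^ 2))⁻¹ ≤ 1 := by
  apply inv_le_one_of_one_le₀
  rw [Real.one_le_sqrt]
  nlinarith [sq_nonneg b]

theorem inv_sqrt_nonneg (b : ℝ) : 0 ≤ (√(1 + b ^ 2))⁻¹ := by positivity

namespace IsChart

variable {a C : ℝ≥0} {D : Set Plane} {e : Plane ≃ᵃⁱ[ℝ] Plane} {g : ℝ → ℝ} {U : Set Plane}

/-- The region below the graph is open and disjoint from D, so it contains no frontier point; a
point of the graph is the limit of points of D vertically above it. -/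
theorem mem_frontier_iff (h : IsChart a C D e g U) (hD : IsOpen D) {x : Plane} (hx : x ∈ U) :
    x ∈ frontier D ↔ e x 1 = g (e x 0) := by
  have hgc : Continuous g := h.diff.continuous
  have hc : Continuous fun x => g (e x 0) := hgc.comp (continuous_coord e 0)
  constructor
  · intro hf
    have h1 : ¬ g (e x 0) < e x 1 := by
      rw [← h.mem_iff x hx]
      rw [hD.frontier_eq] at hf
      exact hf.2
    refine le_antisymm (not_lt.1 h1) (not_lt.1 fun hlt => ?_)
    have hO : IsOpen (U ∩ {y | e y 1 < g (e y 0)}) :=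
      h.isOpen.inter (isOpen_lt (continuous_coord e 1) hc)
    obtain ⟨y, hy, hyD⟩ := mem_closure_iff.1 (frontier_subset_closure hf) _ hO ⟨hx, hlt⟩
    exact lt_asymm hy.2 ((h.mem_iff y hy.1).1 hyD)
  · intro heq
    rw [hD.frontier_eq]
    refine ⟨?_, fun hxD => ((h.mem_iff x hx).1 hxD).ne heq.symm⟩
    have hlim : Tendsto (fun t : ℝ => e.symm (e x + t • !₂[0, 1])) (𝓝[>] 0) (𝓝 x) := by
      have : Continuous fun t : ℝ => e.symm (e x + t • !₂[0, 1]) :=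
        e.symm.continuous.comp (by fun_prop)
      exact (this.tendsto' 0 x (by simp)).mono_left nhdsWithin_le_nhds
    refine mem_closure_of_tendsto hlim ?_
    filter_upwards [hlim.eventually (h.isOpen.mem_nhds hx), self_mem_nhdsWithin] with t htU ht
    refine (h.mem_iff _ htU).2 ?_
    have ht : 0 < t := ht
    simpa [← heq] using ht

theorem isOutwardNormal (h : IsChart a C D e g U) (hD : IsOpen D) {x : Plane} (hx : x ∈ U)
    (hxf : x ∈ frontier D) : IsOutwardNormal D x (chartNormal e g (e x 0)) := by
  refine ⟨norm_chartNormal e g _, fun ε hε => ?_⟩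
  have heq := (h.mem_frontier_iff hD hx).1 hxf
  have h1 := ((hasDerivAt_iff_isLittleO.1 (h.diff (e x 0)).hasDerivAt).comp_tendsto
    ((continuous_coord e 0).tendsto x)).def hε
  filter_upwards [h1, h.isOpen.mem_nhds hx] with y hy hyU
  simp only [Function.comp_apply, smul_eq_mul, Real.norm_eq_abs] at hy
  have h2 := abs_coord_sub_le e y x 0
  have h3 : |g (e y 0) - g (e x 0) - (e y 0 - e x 0) * deriv g (e x 0)| ≤ ε * ‖y - x‖ :=
    hy.trans (by gcongr)
  have h4 := abs_le.1 h3
  rw [inner_chartNormal, linearIsometryEquiv_sub]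
  simp only [PiLp.sub_apply]
  have h5 := inv_sqrt_le_one (deriv g (e x 0))
  have h6 := inv_sqrt_nonneg (deriv g (e x 0))
  have h7 : 0 ≤ ε * ‖y - x‖ := by positivity
  constructor
  · intro hyD
    have h8 := (h.mem_iff y hyU).1 hyD
    calc _ ≤ (√(1 + deriv g (e x 0) ^ 2))⁻¹ * (ε * ‖y - x‖) := by
          refine mul_le_mul_of_nonneg_left ?_ h6
          linarith [h4.1]
      _ ≤ _ := mul_le_of_le_one_left h7 h5
  · intro hyD
    have h8 := mt (h.mem_iff y hyU).2 hyD
    calc -(ε * ‖y - x‖) ≤ (√(1 + deriv g (e x 0) ^ 2))⁻¹ * -(ε * ‖y - x‖) := by nlinarith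
      _ ≤ _ := by
          refine mul_le_mul_of_nonneg_left ?_ h6
          linarith [h4.2]

theorem normal_eq (h : IsChart a C D e g U) (hD : IsOpen D) {x : Plane} (hx : x ∈ U)
    (hxf : x ∈ frontier D) : normal D x = chartNormal e g (e x 0) :=
  (h.isOutwardNormal hD hx hxf).normal_eq

theorem continuous_deriv (h : IsChart a C D e g U) (ha : 0 < a) : Continuous (deriv g) :=
  h.holder.continuous ha

theorem continuous_chartNormal (h : IsChart a C D e g U) (ha : 0 < a) :
    Continuous (chartNormal e g) := by
  have h1 := h.continuous_deriv ha
  have h2 : ∀ t, √(1 + deriv g t ^ 2) ≠ 0 := fun t => by positivity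
  unfold chartNormal
  refine Continuous.smul (Continuous.inv₀ (by fun_prop) h2) ?_
  exact e.linearIsometryEquiv.symm.continuous.comp (by fun_prop)

/-- The mean value inequality applied to g(x) - g'(s)x, whose derivative on the segment is at most
C|t - s|^a by the Hölder condition. -/
theorem taylor_bound (h : IsChart a C D e g U) (s t : ℝ) :
    |g t - g s - deriv g s * (t - s)| ≤ C * |t - s| ^ (1 + a : ℝ) := by
  have hb : ∀ x ∈ Set.uIcc s t, ‖deriv g x - deriv g s‖ ≤ C * |t - s| ^ (a : ℝ) := by
    intro x hx
    have h1 := h.holder.dist_le x s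
    rw [← Real.dist_eq, dist_comm t s] at *
    rw [dist_eq_norm] at h1
    refine h1.trans ?_
    gcongr
    rw [dist_comm s t, Real.dist_eq, Real.dist_eq]
    exact Set.abs_sub_left_of_mem_uIcc hx
  have h2 := (convex_uIcc s t).norm_image_sub_le_of_norm_hasDerivWithin_le
    (f := fun x => g x - deriv g s * x) (f' := fun x => deriv g x - deriv g s)
    (C := C * |t - s| ^ (a : ℝ))
    (fun x _ => (((h.diff x).hasDerivAt.sub
      ((hasDerivAt_id x).const_mul (deriv g s))).congr_deriv (by simp)).hasDerivWithinAt)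
    hb Set.left_mem_uIcc Set.right_mem_uIcc
  have h3 : g t - g s - deriv g s * (t - s) = g t - deriv g s * t - (g s - deriv g s * s) := by ring
  rw [h3]
  refine (h2.trans_eq ?_)
  rw [Real.norm_eq_abs]
  rcases eq_or_ne t s with rfl | hts
  · have h0 : (1 + (a : ℝ)) ≠ 0 := by positivity
    simp [Real.zero_rpow h0]
  · rw [Real.rpow_add (abs_pos.2 (sub_ne_zero.2 hts)), Real.rpow_one]
    ring

/-- Up to a factor at most 1, the inner product of a chord with the normal is the first-order Taylor
remainder of `g`. This gain of order a makes the Neumann–Poincaré kernel weakly singular. -/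
theorem abs_inner_normal_le (h : IsChart a C D e g U) (hD : IsOpen D) {x y : Plane}
    (hx : x ∈ U) (hxf : x ∈ frontier D) (hy : y ∈ U) (hyf : y ∈ frontier D) :
    |inner ℝ (x - y) (normal D x)| ≤ C * ‖x - y‖ ^ (1 + a : ℝ) := by
  rw [h.normal_eq hD hx hxf, inner_chartNormal, linearIsometryEquiv_sub, abs_mul,
    abs_of_nonneg (inv_sqrt_nonneg _)]
  refine (mul_le_of_le_one_left (abs_nonneg _) (inv_sqrt_le_one _)).trans ?_
  have h1 := h.taylor_bound (e x 0) (e y 0)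
  rw [PiLp.sub_apply, PiLp.sub_apply, (h.mem_frontier_iff hD hx).1 hxf,
    (h.mem_frontier_iff hD hy).1 hyf]
  calc _ = |g (e y 0) - g (e x 0) - deriv g (e x 0) * (e y 0 - e x 0)| := by
        congr 1; ring
    _ ≤ _ := h1
    _ ≤ _ := by
        gcongr
        rw [norm_sub_rev]
        exact abs_coord_sub_le e y x 0

theorem hasStrictDerivAt_chartCurve (h : IsChart a C D e g U) (ha : 0 < a) (t : ℝ) :
    HasStrictDerivAt (chartCurve e g) (chartTangent e g t) t := by
  have hg : HasStrictDerivAt g (deriv g t) t :=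
    hasStrictDerivAt_of_hasDerivAt_of_continuousAt
      (Eventually.of_forall fun s => (h.diff s).hasDerivAt) (h.continuous_deriv ha).continuousAt
  have h1 : HasStrictDerivAt (fun t => (!₂[t, g t] : Plane)) !₂[1, deriv g t] t := by
    have h2 : HasStrictDerivAt (fun t => (![t, g t] : Fin 2 → ℝ)) ![1, deriv g t] t := by
      rw [hasStrictDerivAt_pi]
      intro i
      fin_cases i
      · exact hasStrictDerivAt_id t
      · exact hg
    exact (PiLp.continuousLinearEquiv 2 ℝ fun _ : Fin 2 =>
      ℝ).symm.toContinuousLinearMap.hasStrictFDerivAt.comp_hasStrictDerivAt t h2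
  have h3 : chartCurve e g = fun t => e.linearIsometryEquiv.symm (!₂[t, g t] : Plane) + e.symm 0 := by
    funext t
    have h4 : chartCurve e g t = e.symm.linearIsometryEquiv (!₂[t, g t] : Plane) + e.symm 0 := by
      have := e.symm.map_vadd 0 !₂[t, g t]
      simpa [chartCurve] using this
    exact h4
  rw [h3]
  exact (e.linearIsometryEquiv.symm.toContinuousLinearEquiv.toContinuousLinearMap.hasStrictFDerivAt.comp_hasStrictDerivAt
    t h1).add_const _

theorem continuous_chartTangent (h : IsChart a C D e g U) (ha : 0 < a) :
    Continuous (chartTangent e g) := by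
  have h1 := h.continuous_deriv ha
  exact e.linearIsometryEquiv.symm.continuous.comp (by fun_prop)

theorem coord_chartCurve (e : Plane ≃ᵃⁱ[ℝ] Plane) (g : ℝ → ℝ) (t : ℝ) :
    e (chartCurve e g t) = !₂[t, g t] := by
  simp [chartCurve]

theorem measurableEmbedding_chartCurve (h : IsChart a C D e g U) :
    MeasurableEmbedding (chartCurve e g) := by
  have hgc : Continuous g := h.diff.continuous
  refine Continuous.measurableEmbedding (e.symm.continuous.comp (by fun_prop)) fun s t hst => ?_
  have := congrArg (fun x => e x 0) hst
  simpa [coord_chartCurve] using this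

theorem frontier_inter_eq (h : IsChart a C D e g U) (hD : IsOpen D) :
    frontier D ∩ U = Set.range (chartCurve e g) ∩ U := by
  ext x
  refine and_congr_left fun hx => ?_
  rw [h.mem_frontier_iff hD hx]
  constructor
  · intro heq
    refine ⟨e x 0, ?_⟩
    rw [chartCurve, ← heq]
    have : (!₂[e x 0, e x 1] : Plane) = e x := by ext i; fin_cases i <;> rfl
    rw [this, AffineIsometryEquiv.symm_apply_apply]
  · rintro ⟨t, rfl⟩
    simp [coord_chartCurve]

/-- The arc length measure on the part of the boundary in a chart. -/
theorem restrict_bdry (h : IsChart a C D e g U) (ha : 0 < a) (hD : IsOpen D) :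
    (bdry D).restrict U = (Measure.map (chartCurve e g)
      (volume.withDensity fun t => ‖chartTangent e g t‖ₑ)).restrict U := by
  rw [← comap_hausdorffMeasure_eq_withDensity (h.hasStrictDerivAt_chartCurve ha)
    (h.continuous_chartTangent ha) (fun t => ?_) h.measurableEmbedding_chartCurve,
    h.measurableEmbedding_chartCurve.map_comap, bdry,
    Measure.restrict_restrict h.isOpen.measurableSet,
    Measure.restrict_restrict h.isOpen.measurableSet, Set.inter_comm, h.frontier_inter_eq hD,
    Set.inter_comm]
  rw [← norm_ne_zero_iff, norm_chartTangent]
  positivity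

end IsChart

end Chart

/-! ### Riesz potentials of upper regular measures -/

section Potential

/-- Upper regularity of dimension one: balls of radius `ρ` have measure at most `K ρ`. -/
def IsUpperRegular (μ : Measure Plane) (K : ℝ≥0) : Prop :=
  ∀ (z : Plane) (ρ : ℝ≥0), μ (Metric.ball z ρ) ≤ K * ρ

/-- By the layer cake formula: the set where ‖z - y‖^{-s} exceeds t lies in a ball of radius
t^{-1/s}, whose measure is integrable in t > 1 because 1/s > 1. For t ≤ 1 the total mass is enough.
-/
theorem IsUpperRegular.exists_lintegral_rpow_le {μ : Measure Plane} {K : ℝ≥0}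
    (hμ : IsUpperRegular μ K) [IsFiniteMeasure μ] {s : ℝ} (hs0 : 0 < s) (hs1 : s < 1) :
    ∃ M : ℝ≥0, ∀ z, ∫⁻ y, ENNReal.ofReal (‖z - y‖ ^ (-s)) ∂μ ≤ M := by
  have hint : IntegrableOn (fun t : ℝ => t ^ (-(1 / s))) (Set.Ioi 1) :=
    integrableOn_Ioi_rpow_of_lt (by
      rw [neg_lt_neg_iff]; exact (one_lt_div hs0).2 hs1) one_pos
  have hfin : ∫⁻ t in Set.Ioi (1 : ℝ), ENNReal.ofReal (t ^ (-(1 / s))) ≠ ⊤ :=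
    hint.lintegral_lt_top.ne
  have hne : μ Set.univ + K * ∫⁻ t in Set.Ioi (1 : ℝ), ENNReal.ofReal (t ^ (-(1 / s))) ≠ ⊤ :=
    ENNReal.add_ne_top.2 ⟨measure_ne_top _ _, ENNReal.mul_ne_top ENNReal.coe_ne_top hfin⟩
  refine ⟨(μ Set.univ + K * ∫⁻ t in Set.Ioi (1 : ℝ), ENNReal.ofReal (t ^ (-(1 / s)))).toNNReal,
    fun z => ?_⟩
  rw [ENNReal.coe_toNNReal hne, lintegral_eq_lintegral_meas_lt μ
    (Eventually.of_forall fun y => by positivity)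
    (by fun_prop), ← Set.Ioc_union_Ioi_eq_Ioi zero_le_one]
  refine (lintegral_union_le _ _ _).trans (add_le_add ?_ ?_)
  · calc ∫⁻ t in Set.Ioc (0 : ℝ) 1, μ {y | t < ‖z - y‖ ^ (-s)}
        ≤ ∫⁻ t in Set.Ioc (0 : ℝ) 1, μ Set.univ := lintegral_mono fun t => measure_mono
          (Set.subset_univ _)
      _ = μ Set.univ := by simp
  · rw [← lintegral_const_mul' _ _ ENNReal.coe_ne_top]
    refine setLIntegral_mono_ae' measurableSet_Ioi (Eventually.of_forall fun t ht => ?_)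
    have ht : 1 < t := ht
    have ht0 : 0 < t := one_pos.trans ht
    refine (measure_mono fun y hy => ?_).trans (hμ z (t ^ (-(1 / s))).toNNReal) |>.trans ?_
    · have hy : t < ‖z - y‖ ^ (-s) := hy
      rw [Metric.mem_ball, dist_comm, dist_eq_norm]
      rw [Real.coe_toNNReal _ (by positivity)]
      -- The convention 0^{-s} = 0 keeps the centre out of the superlevel set.
      have hne : ‖z - y‖ ≠ 0 := by
        intro h0
        rw [h0, Real.zero_rpow (by linarith)] at hy
        linarith
      have hpos : 0 < ‖z - y‖ := (norm_nonneg _).lt_of_ne' hne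
      have h1 := Real.rpow_lt_rpow_of_neg ht0 hy (z := -(1 / s)) (by
        rw [neg_lt_zero]; positivity)
      rwa [← Real.rpow_mul hpos.le, neg_mul_neg, mul_one_div_cancel hs0.ne', Real.rpow_one] at h1
    · exact le_rfl

end Potential

/-! ### Global estimates on the compact boundary -/

section Boundary

variable {a : ℝ≥0} {D : Set Plane}

theorem IsC1HolderDomain.exists_isChart (hD : IsC1HolderDomain a D) {p : Plane}
    (hp : p ∈ frontier D) : ∃ (C : ℝ≥0) (e : Plane ≃ᵃⁱ[ℝ] Plane) (g : ℝ → ℝ) (r : ℝ),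
      0 < r ∧ IsChart a C D e g (Metric.ball p r) := by
  obtain ⟨e, g, r, hr, hg, ⟨C, hC⟩, h⟩ := hD.localGraph p hp
  exact ⟨C, e, g, r, hr, Metric.isOpen_ball, hg, hC, h⟩

theorem IsC1HolderDomain.isCompact_frontier (hD : IsC1HolderDomain a D) :
    IsCompact (frontier D) :=
  Metric.isCompact_of_isClosed_isBounded isClosed_frontier
    (hD.isBounded.closure.subset frontier_subset_closure)

theorem IsC1HolderDomain.isCompact_closure (hD : IsC1HolderDomain a D) :
    IsCompact (closure D) :=
  Metric.isCompact_of_isClosed_isBounded isClosed_closure hD.isBounded.closure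

theorem IsC1HolderDomain.continuousOn_normal (hD : IsC1HolderDomain a D) (ha : 0 < a) :
    ContinuousOn (normal D) (frontier D) := by
  intro x hx
  obtain ⟨C, e, g, r, hr, h⟩ := hD.exists_isChart hx
  have h1 : ContinuousWithinAt (fun y => chartNormal e g (e y 0)) (frontier D) x :=
    ((h.continuous_chartNormal ha).comp (continuous_coord e 0)).continuousWithinAt
  have hxb : x ∈ Metric.ball x r := Metric.mem_ball_self hr
  refine h1.congr_of_eventuallyEq ?_ (h.normal_eq hD.isOpen hxb hx)
  filter_upwards [mem_nhdsWithin_of_mem_nhds (Metric.ball_mem_nhds x hr), self_mem_nhdsWithin]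
    with y hy hyf
  exact h.normal_eq hD.isOpen hy hyf

theorem IsC1HolderDomain.exists_isOutwardNormal (hD : IsC1HolderDomain a D) {x : Plane}
    (hx : x ∈ frontier D) : IsOutwardNormal D x (normal D x) := by
  obtain ⟨C, e, g, r, hr, h⟩ := hD.exists_isChart hx
  have := h.isOutwardNormal hD.isOpen (Metric.mem_ball_self hr) hx
  rwa [this.normal_eq]

/-- Compactness of ∂D × ∂D: near a diagonal pair a single chart gives the bound, and near any other
pair ‖x - y‖ stays away from 0, so Cauchy–Schwarz suffices. -/
theorem IsC1HolderDomain.exists_abs_inner_normal_le (hD : IsC1HolderDomain a D) :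
    ∃ C : ℝ, 0 ≤ C ∧ ∀ x ∈ frontier D, ∀ y ∈ frontier D,
      |inner ℝ (x - y) (normal D x)| ≤ C * ‖x - y‖ ^ (1 + a : ℝ) := by
  have hK := hD.isCompact_frontier.prod hD.isCompact_frontier
  have key : ∃ C : ℝ, 0 ≤ C ∧ ∀ p ∈ frontier D ×ˢ frontier D, p ∈ frontier D ×ˢ frontier D →
      |inner ℝ (p.1 - p.2) (normal D p.1)| ≤ C * ‖p.1 - p.2‖ ^ (1 + a : ℝ) := by
    refine hK.induction_on (p := fun S => ∃ C : ℝ, 0 ≤ C ∧ ∀ p ∈ S,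
      p ∈ frontier D ×ˢ frontier D →
      |inner ℝ (p.1 - p.2) (normal D p.1)| ≤ C * ‖p.1 - p.2‖ ^ (1 + a : ℝ)) ?_ ?_ ?_ ?_
    · exact ⟨0, le_rfl, fun p hp => absurd hp (Set.notMem_empty p)⟩
    · rintro S T hST ⟨C, hC0, hC⟩
      exact ⟨C, hC0, fun p hp => hC p (hST hp)⟩
    · rintro S T ⟨C, hC0, hC⟩ ⟨C', hC0', hC'⟩
      refine ⟨max C C', le_max_of_le_left hC0, fun p hp hpF => ?_⟩
      rcases hp with hp | hp
      · exact (hC p hp hpF).trans (by gcongr; exact le_max_left _ _)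
      · exact (hC' p hp hpF).trans (by gcongr; exact le_max_right _ _)
    · rintro ⟨x, y⟩ ⟨hx, hy⟩
      by_cases hxy : x = y
      · subst hxy
        obtain ⟨C, e, g, r, hr, h⟩ := hD.exists_isChart hx
        refine ⟨Metric.ball x r ×ˢ Metric.ball x r, mem_nhdsWithin_of_mem_nhds
          (prod_mem_nhds (Metric.ball_mem_nhds x hr) (Metric.ball_mem_nhds x hr)), C, C.2,
          fun p hp hpF => h.abs_inner_normal_le hD.isOpen hp.1 hpF.1 hp.2 hpF.2⟩
      · have hd : 0 < ‖x - y‖ := norm_pos_iff.2 (sub_ne_zero.2 hxy)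
        refine ⟨{p : Plane × Plane | ‖x - y‖ / 2 < ‖p.1 - p.2‖}, mem_nhdsWithin_of_mem_nhds
          ((isOpen_lt continuous_const (by fun_prop)).mem_nhds (half_lt_self hd)),
          ((‖x - y‖ / 2) ^ (a : ℝ))⁻¹, by positivity, fun p hp _ => ?_⟩
        have hp : ‖x - y‖ / 2 < ‖p.1 - p.2‖ := hp
        have hpos : 0 < ‖p.1 - p.2‖ := (half_pos hd).trans hp
        have h1 : (1 : ℝ) ≤ ((‖x - y‖ / 2) ^ (a : ℝ))⁻¹ * ‖p.1 - p.2‖ ^ (a : ℝ) := by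
          rw [inv_mul_eq_div, one_le_div (by positivity)]
          gcongr
        have h2 : |inner ℝ (p.1 - p.2) (normal D p.1)| ≤ ‖p.1 - p.2‖ :=
          (abs_real_inner_le_norm _ _).trans
            (mul_le_of_le_one_right (norm_nonneg _) (norm_normal_le D _))
        calc _ ≤ ‖p.1 - p.2‖ * 1 := by rwa [mul_one]
          _ ≤ ‖p.1 - p.2‖ * (((‖x - y‖ / 2) ^ (a : ℝ))⁻¹ * ‖p.1 - p.2‖ ^ (a : ℝ)) := by gcongr
          _ = _ := by rw [Real.rpow_add hpos, Real.rpow_one]; ring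
  obtain ⟨C, hC0, hC⟩ := key
  exact ⟨C, hC0, fun x hx y hy => hC (x, y) ⟨hx, hy⟩ ⟨hx, hy⟩⟩

/-- Boundary points in a ball of radius ρ have abscissas in an interval of length 2ρ, and the graph
map is Lipschitz over a bounded interval. -/
theorem IsChart.exists_measure_ball_le {C : ℝ≥0} {e : Plane ≃ᵃⁱ[ℝ] Plane} {g : ℝ → ℝ}
    {p : Plane} {r : ℝ} (h : IsChart a C D e g (Metric.ball p r)) (ha : 0 < a) (hD : IsOpen D) :
    ∃ K : ℝ≥0, ∀ (z : Plane) (ρ : ℝ≥0),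
      μH[1] (frontier D ∩ Metric.ball p r ∩ Metric.ball z ρ) ≤ K * ρ := by
  obtain ⟨L, hL⟩ := (isCompact_Icc (a := e p 0 - r) (b := e p 0 + r)).exists_bound_of_continuousOn
    (h.continuous_chartTangent ha).continuousOn
  refine ⟨L.toNNReal * 2, fun z ρ => ?_⟩
  have hsub : frontier D ∩ Metric.ball p r ∩ Metric.ball z ρ ⊆ chartCurve e g ''
      (Set.Icc (e p 0 - r) (e p 0 + r) ∩ Set.Icc (e z 0 - ρ) (e z 0 + ρ)) := by
    rintro x ⟨hx, hxz⟩
    have hxp := hx.2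
    rw [h.frontier_inter_eq hD] at hx
    obtain ⟨⟨t, rfl⟩, -⟩ := hx
    have h1 := abs_coord_sub_le e (chartCurve e g t) p 0
    have h2 := abs_coord_sub_le e (chartCurve e g t) z 0
    rw [Metric.mem_ball, dist_eq_norm] at hxp hxz
    have h3 : e (chartCurve e g t) 0 = t := by simp [coord_chartCurve]
    rw [h3] at h1 h2
    have h4 := abs_le.1 (h1.trans hxp.le)
    have h5 := abs_le.1 (h2.trans hxz.le)
    exact ⟨t, ⟨⟨by linarith, by linarith⟩, ⟨by linarith, by linarith⟩⟩, rfl⟩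
  refine (measure_mono hsub).trans ((hausdorffMeasure_image_le_of_norm_sub_le (L := L.toNNReal)
    fun x hx y hy => ?_).trans ?_)
  · have := (convex_Icc (e p 0 - r) (e p 0 + r)).norm_image_sub_le_of_norm_hasDerivWithin_le
      (f := chartCurve e g) (f' := chartTangent e g) (C := L)
      (fun t _ => (h.hasStrictDerivAt_chartCurve ha t).hasDerivAt.hasDerivWithinAt) hL hy.1 hx.1
    refine this.trans ?_
    rw [Real.norm_eq_abs]
    gcongr
    exact Real.le_coe_toNNReal L
  · rw [ENNReal.coe_mul, mul_assoc]
    gcongr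
    refine (measure_mono Set.inter_subset_right).trans ?_
    rw [Real.volume_Icc]
    have : e z 0 + (ρ : ℝ) - (e z 0 - ρ) = ((2 * ρ : ℝ≥0) : ℝ) := by push_cast; ring
    rw [this, ENNReal.ofReal_coe_nnreal, ENNReal.coe_mul]

theorem IsC1HolderDomain.exists_isUpperRegular (hD : IsC1HolderDomain a D) (ha : 0 < a) :
    ∃ K : ℝ≥0, IsUpperRegular (bdry D) K := by
  have key : ∃ K : ℝ≥0, ∀ (z : Plane) (ρ : ℝ≥0),
      μH[1] (frontier D ∩ frontier D ∩ Metric.ball z ρ) ≤ K * ρ := by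
    refine hD.isCompact_frontier.induction_on (p := fun S => ∃ K : ℝ≥0, ∀ (z : Plane) (ρ : ℝ≥0),
      μH[1] (frontier D ∩ S ∩ Metric.ball z ρ) ≤ K * ρ) ?_ ?_ ?_ ?_
    · exact ⟨0, by simp⟩
    · rintro S T hST ⟨K, hK⟩
      exact ⟨K, fun z ρ => (measure_mono (by gcongr)).trans (hK z ρ)⟩
    · rintro S T ⟨K, hK⟩ ⟨K', hK'⟩
      refine ⟨K + K', fun z ρ => ?_⟩
      rw [Set.inter_union_distrib_left, Set.union_inter_distrib_right, ENNReal.coe_add, add_mul]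
      exact (measure_union_le _ _).trans (add_le_add (hK z ρ) (hK' z ρ))
    · intro x hx
      obtain ⟨C, e, g, r, hr, h⟩ := hD.exists_isChart hx
      exact ⟨_, mem_nhdsWithin_of_mem_nhds (Metric.ball_mem_nhds x hr),
        h.exists_measure_ball_le ha hD.isOpen⟩
  obtain ⟨K, hK⟩ := key
  refine ⟨K, fun z ρ => ?_⟩
  rw [bdry, Measure.restrict_apply Metric.isOpen_ball.measurableSet, Set.inter_comm]
  simpa using hK z ρ

theorem IsC1HolderDomain.isFiniteMeasure_bdry (hD : IsC1HolderDomain a D) (ha : 0 < a) :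
    IsFiniteMeasure (bdry D) := by
  obtain ⟨K, hK⟩ := hD.exists_isUpperRegular ha
  obtain ⟨R, hR⟩ := hD.isCompact_frontier.isBounded.subset_ball 0
  refine ⟨?_⟩
  have h1 : bdry D Set.univ ≤ bdry D (Metric.ball 0 R.toNNReal) := by
    rw [bdry, Measure.restrict_apply MeasurableSet.univ,
      Measure.restrict_apply Metric.isOpen_ball.measurableSet, Set.univ_inter]
    refine measure_mono fun x hx => ⟨?_, hx⟩
    exact Metric.ball_subset_ball (Real.le_coe_toNNReal R) (hR hx)
  exact (h1.trans (hK 0 _)).trans_lt (ENNReal.mul_lt_top ENNReal.coe_lt_top ENNReal.coe_lt_top)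

theorem ae_mem_frontier (D : Set Plane) : ∀ᵐ x ∂(bdry D), x ∈ frontier D :=
  ae_restrict_mem isClosed_frontier.measurableSet

theorem IsC1HolderDomain.aestronglyMeasurable_normal (hD : IsC1HolderDomain a D) (ha : 0 < a) :
    AEStronglyMeasurable (normal D) (bdry D) :=
  (hD.continuousOn_normal ha).aestronglyMeasurable isClosed_frontier.measurableSet

end Boundary

open scoped ContDiff Manifold

/-! ### Straightening a graph -/

section GraphCoordinates

/-- The coordinates `(t, s) ↦ (t, g t + s)` straightening a graph. -/
def chartMap (e : Plane ≃ᵃⁱ[ℝ] Plane) (g : ℝ → ℝ) (p : ℝ × ℝ) : Plane :=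
  e.symm !₂[p.1, g p.1 + p.2]

variable {e : Plane ≃ᵃⁱ[ℝ] Plane} {g : ℝ → ℝ}

/-- `chartMap` as a homeomorphism. -/
def chartHomeomorph (e : Plane ≃ᵃⁱ[ℝ] Plane) (g : ℝ → ℝ) (hg : Continuous g) :
    ℝ × ℝ ≃ₜ Plane where
  toFun := chartMap e g
  invFun x := (e x 0, e x 1 - g (e x 0))
  left_inv p := by simp [chartMap]
  right_inv x := by
    have : (!₂[e x 0, e x 1] : Plane) = e x := by ext i; fin_cases i <;> rfl
    simp [chartMap, this]
  continuous_toFun := e.symm.continuous.comp (by fun_prop)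
  continuous_invFun := (continuous_coord e 0).prodMk
    ((continuous_coord e 1).sub (hg.comp (continuous_coord e 0)))

/-- A shear followed by isometries. It is treated as a skew product, so no Jacobian and no
smoothness of `g` is needed. -/
theorem measurePreserving_chartMap (hg : Continuous g) :
    MeasurePreserving (chartMap e g) := by
  have h1 : MeasurePreserving (fun p : ℝ × ℝ => (p.1, g p.1 + p.2)) := by
    refine (MeasurePreserving.id volume).skew_product (g := fun t s => g t + s) ?_ ?_
    · fun_prop
    · exact Eventually.of_forall fun t => (measurePreserving_add_left volume (g t)).map_eq
  have h2 : MeasurePreserving (fun p : ℝ × ℝ => (!₂[p.1, p.2] : Plane)) :=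
    (PiLp.volume_preserving_toLp (Fin 2)).comp (volume_preserving_finTwoArrow ℝ).symm
  have h3 : MeasurePreserving (e.symm : Plane → Plane) := by
    have h4 : (e.symm : Plane → Plane) = fun x => e.symm 0 + e.symm.linearIsometryEquiv x := by
      funext x
      have := e.symm.map_vadd 0 x
      simpa [add_comm] using this
    rw [h4]
    exact (measurePreserving_add_left volume (e.symm 0)).comp
      e.symm.linearIsometryEquiv.measurePreserving
  exact (h3.comp h2).comp h1

theorem hasDerivAt_chartMap_snd (t s : ℝ) :
    HasDerivAt (fun s => chartMap e g (t, s)) (e.linearIsometryEquiv.symm !₂[0, 1]) s := by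
  have h1 : HasDerivAt (fun s => (!₂[t, g t + s] : Plane)) !₂[0, 1] s := by
    have h2 : HasDerivAt (fun s => (![t, g t + s] : Fin 2 → ℝ)) ![0, 1] s := by
      rw [hasDerivAt_pi]
      intro i
      fin_cases i
      · exact hasDerivAt_const s t
      · exact (hasDerivAt_id s).const_add (g t)
    exact (PiLp.continuousLinearEquiv 2 ℝ fun _ : Fin 2 =>
      ℝ).symm.toContinuousLinearMap.hasFDerivAt.comp_hasDerivAt s h2
  have h3 : (fun s => chartMap e g (t, s)) =
      fun s => e.linearIsometryEquiv.symm (!₂[t, g t + s] : Plane) + e.symm 0 := by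
    funext s
    have h4 : chartMap e g (t, s) =
        e.symm.linearIsometryEquiv (!₂[t, g t + s] : Plane) + e.symm 0 := by
      have := e.symm.map_vadd 0 !₂[t, g t + s]
      simpa [chartMap] using this
    exact h4
  rw [h3]
  exact (e.linearIsometryEquiv.symm.toContinuousLinearEquiv.toContinuousLinearMap.hasFDerivAt.comp_hasDerivAt
    s h1).add_const _

theorem hasDerivAt_chartMap_fst (hg : Differentiable ℝ g) (t s : ℝ) :
    HasDerivAt (fun t => chartMap e g (t, s)) (chartTangent e g t) t := by
  have h1 : HasDerivAt (fun t => (!₂[t, g t + s] : Plane)) !₂[1, deriv g t] t := by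
    have h2 : HasDerivAt (fun t => (![t, g t + s] : Fin 2 → ℝ)) ![1, deriv g t] t := by
      rw [hasDerivAt_pi]
      intro i
      fin_cases i
      · exact hasDerivAt_id t
      · exact (hg t).hasDerivAt.add_const s
    exact (PiLp.continuousLinearEquiv 2 ℝ fun _ : Fin 2 =>
      ℝ).symm.toContinuousLinearMap.hasFDerivAt.comp_hasDerivAt t h2
  have h3 : (fun t => chartMap e g (t, s)) =
      fun t => e.linearIsometryEquiv.symm (!₂[t, g t + s] : Plane) + e.symm 0 := by
    funext t
    have h4 : chartMap e g (t, s) =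
        e.symm.linearIsometryEquiv (!₂[t, g t + s] : Plane) + e.symm 0 := by
      have := e.symm.map_vadd 0 !₂[t, g t + s]
      simpa [chartMap] using this
    exact h4
  rw [h3]
  exact (e.linearIsometryEquiv.symm.toContinuousLinearEquiv.toContinuousLinearMap.hasFDerivAt.comp_hasDerivAt
    t h1).add_const _

end GraphCoordinates

/-! ### Gauss–Green on a C^{1,a} domain -/

section Divergence

variable {a C : ℝ≥0} {D : Set Plane} {e : Plane ≃ᵃⁱ[ℝ] Plane} {g : ℝ → ℝ} {U : Set Plane}

/-- In straightened coordinates v is a constant multiple of the tangent plus a vertical vector whose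
coefficient depends on t alone. The tangential derivative integrates to 0 along whole lines, the
vertical one leaves minus the value on the graph, and the length element cancels the normalization
of the normal. -/
theorem IsChart.integral_fderiv_eq (h : IsChart a C D e g U) (ha : 0 < a) (hD : IsOpen D)
    {f : Plane → ℝ} (hf : ContDiff ℝ 1 f) (hfc : HasCompactSupport f) (hfU : tsupport f ⊆ U)
    (v : Plane) :
    ∫ x in D, fderiv ℝ f x v = ∫ x, f x * inner ℝ v (normal D x) ∂(bdry D) := by
  have hgc : Continuous g := h.diff.continuous
  have hg' : Continuous (deriv g) := h.continuous_deriv ha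
  have hfd : Differentiable ℝ f := hf.differentiable one_ne_zero
  have hf' : Continuous (fderiv ℝ f) := hf.continuous_fderiv one_ne_zero
  have hΦc : Continuous (chartMap e g) := (chartHomeomorph e g hgc).continuous
  have hΦ := measurePreserving_chartMap (e := e) hgc
  have hemb : MeasurableEmbedding (chartMap e g) := (chartHomeomorph e g hgc).measurableEmbedding
  set b : Plane := e.linearIsometryEquiv.symm !₂[0, 1] with hb
  set v0 := e.linearIsometryEquiv v 0 with hv0
  set v1 := e.linearIsometryEquiv v 1 with hv1
  have hv : ∀ t, v = v0 • chartTangent e g t + (v1 - v0 * deriv g t) • b := by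
    intro t
    apply e.linearIsometryEquiv.injective
    rw [map_add, map_smul, map_smul, chartTangent, hb, LinearIsometryEquiv.apply_symm_apply,
      LinearIsometryEquiv.apply_symm_apply]
    ext i
    fin_cases i
    · simp [hv0]
    · simp [hv1]
  -- compact support of the transported functions
  have hcs : ∀ F : ℝ × ℝ → ℝ, Continuous F →
      (∀ p, chartMap e g p ∉ tsupport f → F p = 0) → HasCompactSupport F ∧ Integrable F := by
    intro F hF hF0
    have h1 : HasCompactSupport F := by
      refine HasCompactSupport.intro ((chartHomeomorph e g hgc).isCompact_preimage.2 hfc) ?_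
      intro p hp
      exact hF0 p hp
    exact ⟨h1, hF.integrable_of_hasCompactSupport h1⟩
  have hfd0 : ∀ p, chartMap e g p ∉ tsupport f → fderiv ℝ f (chartMap e g p) = 0 := fun p hp =>
    image_eq_zero_of_notMem_tsupport fun hp' => hp (tsupport_fderiv_subset ℝ hp')
  set P : ℝ × ℝ → ℝ := fun p => fderiv ℝ f (chartMap e g p) (chartTangent e g p.1) with hPdef
  set Q : ℝ × ℝ → ℝ := fun p => (v1 - v0 * deriv g p.1) * fderiv ℝ f (chartMap e g p) b with hQdef
  have hPc : Continuous P :=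
    (hf'.comp hΦc).clm_apply ((h.continuous_chartTangent ha).comp continuous_fst)
  have hdc : Continuous fun p : ℝ × ℝ => fderiv ℝ f (chartMap e g p) b :=
    (hf'.comp hΦc).clm_apply continuous_const
  have hQc : Continuous Q := by
    have := hg'.comp (continuous_fst (X := ℝ) (Y := ℝ))
    exact (continuous_const.sub (continuous_const.mul this)).mul hdc
  obtain ⟨hPs, hPi⟩ := hcs P hPc fun p hp => by simp [hPdef, hfd0 p hp]
  obtain ⟨hQs, hQi⟩ := hcs Q hQc fun p hp => by simp [hQdef, hfd0 p hp]
  have hHc : Continuous fun p : ℝ × ℝ => f (chartMap e g p) := hf.continuous.comp hΦc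
  obtain ⟨hHs, -⟩ := hcs _ hHc fun p hp => image_eq_zero_of_notMem_tsupport hp
  obtain ⟨hds, -⟩ := hcs _ hdc fun p hp => by simp [hfd0 p hp]
  -- restriction to lines
  have hline1 : ∀ (F : ℝ × ℝ → ℝ), Continuous F → HasCompactSupport F → ∀ t,
      HasCompactSupport (fun s => F (t, s)) ∧ Integrable (fun s => F (t, s)) := by
    intro F hF hFs t
    have h1 : HasCompactSupport (fun s => F (t, s)) := by
      refine HasCompactSupport.intro (hFs.isCompact.image continuous_snd) fun s hs => ?_
      by_contra hne
      exact hs ⟨(t, s), subset_tsupport _ hne, rfl⟩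
    exact ⟨h1, Continuous.integrable_of_hasCompactSupport (by fun_prop) h1⟩
  have hline2 : ∀ (F : ℝ × ℝ → ℝ), Continuous F → HasCompactSupport F → ∀ s,
      Integrable (fun t => F (t, s)) := by
    intro F hF hFs s
    have h1 : HasCompactSupport (fun t => F (t, s)) := by
      refine HasCompactSupport.intro (hFs.isCompact.image continuous_fst) fun t ht => ?_
      by_contra hne
      exact ht ⟨(t, s), subset_tsupport _ hne, rfl⟩
    exact Continuous.integrable_of_hasCompactSupport (by fun_prop) h1
  have hP0 : ∀ s, ∫ t, P (t, s) = 0 := fun s =>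
    integral_eq_zero_of_hasDerivAt_of_integrable (f := fun t => f (chartMap e g (t, s)))
      (fun t => (hfd _).hasFDerivAt.comp_hasDerivAt t (hasDerivAt_chartMap_fst h.diff t s))
      (hline2 P hPc hPs s) (hline2 _ hHc hHs s)
  have hQ0 : ∀ t, ∫ s in Set.Ioi 0, Q (t, s) =
      (v0 * deriv g t - v1) * f (chartMap e g (t, 0)) := by
    intro t
    simp only [hQdef]
    have h1 := integral_Ioi_of_hasDerivAt_of_tendsto' (a := 0) (m := 0)
      (f := fun s => f (chartMap e g (t, s)))
      (f' := fun s => fderiv ℝ f (chartMap e g (t, s)) b)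
      (fun s _ => (hfd _).hasFDerivAt.comp_hasDerivAt s (hasDerivAt_chartMap_snd t s))
      (hline1 _ hdc hds t).2.integrableOn
      ((hline1 _ hHc hHs t).1.is_zero_at_infty.mono_left atTop_le_cocompact)
    rw [integral_const_mul, h1]
    ring
  have hDm : MeasurableSet D := hD.measurableSet
  have hSm : MeasurableSet (Set.univ ×ˢ Set.Ioi (0 : ℝ) : Set (ℝ × ℝ)) :=
    MeasurableSet.univ.prod measurableSet_Ioi
  have hlhs : ∫ x in D, fderiv ℝ f x v =
      ∫ t, (v0 * deriv g t - v1) * f (chartCurve e g t) := by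
    calc ∫ x in D, fderiv ℝ f x v
        = ∫ p, D.indicator (fun x => fderiv ℝ f x v) (chartMap e g p) := by
          rw [hΦ.integral_comp hemb, integral_indicator hDm]
      _ = ∫ p, (Set.univ ×ˢ Set.Ioi (0 : ℝ)).indicator (fun p => v0 * P p + Q p) p := by
          refine integral_congr_ae (Eventually.of_forall fun p => ?_)
          have hval : fderiv ℝ f (chartMap e g p) v = v0 * P p + Q p := by
            conv_lhs => rw [hv p.1]
            rw [map_add, map_smul, map_smul, smul_eq_mul, smul_eq_mul]
          by_cases hp : chartMap e g p ∈ tsupport f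
          · have hiff : chartMap e g p ∈ D ↔ p ∈ (Set.univ ×ˢ Set.Ioi (0 : ℝ) : Set (ℝ × ℝ)) := by
              rw [h.mem_iff _ (hfU hp)]
              simp [chartMap]
            by_cases hpD : chartMap e g p ∈ D
            · simp only [Set.indicator_of_mem hpD, Set.indicator_of_mem (hiff.1 hpD), hval]
            · simp only [Set.indicator_of_notMem hpD, Set.indicator_of_notMem (mt hiff.2 hpD)]
          · have h0 : v0 * P p + Q p = 0 := by rw [← hval, hfd0 p hp]; rfl
            have h1 : D.indicator (fun x => fderiv ℝ f x v) (chartMap e g p) = 0 := by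
              by_cases hpD : chartMap e g p ∈ D
              · rw [Set.indicator_of_mem hpD, hfd0 p hp]; rfl
              · exact Set.indicator_of_notMem hpD _
            refine h1.trans ?_
            simp only [Set.indicator_apply, h0, ite_self]
      _ = ∫ p in Set.univ ×ˢ Set.Ioi (0 : ℝ), (v0 * P p + Q p) := integral_indicator hSm
      _ = v0 * (∫ p in Set.univ ×ˢ Set.Ioi (0 : ℝ), P p) +
          ∫ p in Set.univ ×ˢ Set.Ioi (0 : ℝ), Q p := by
          rw [integral_add (hPi.integrableOn.const_mul v0) hQi.integrableOn, integral_const_mul]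
      _ = _ := by
          have hPi' : Integrable P ((volume.restrict Set.univ).prod
              (volume.restrict (Set.Ioi (0 : ℝ)))) := by
            rw [Measure.prod_restrict]; exact hPi.integrableOn
          rw [Measure.volume_eq_prod, setIntegral_prod _ hQi.integrableOn, ← Measure.prod_restrict,
            integral_prod_symm _ hPi']
          simp only [Measure.restrict_univ, hP0, integral_zero, mul_zero, zero_add, hQ0]
          simp [chartMap, chartCurve]
  rw [hlhs]
  have hsupp : ∀ x ∉ U, f x * inner ℝ v (normal D x) = 0 := fun x hx => by
    rw [image_eq_zero_of_notMem_tsupport fun hx' => hx (hfU hx'), zero_mul]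
  have hsupp' : ∀ x ∉ U, f x * inner ℝ v (chartNormal e g (e x 0)) = 0 := fun x hx => by
    rw [image_eq_zero_of_notMem_tsupport fun hx' => hx (hfU hx'), zero_mul]
  have hUm := h.isOpen.measurableSet
  symm
  calc ∫ x, f x * inner ℝ v (normal D x) ∂(bdry D)
      = ∫ x in U, f x * inner ℝ v (normal D x) ∂(bdry D) :=
        (setIntegral_eq_integral_of_forall_compl_eq_zero hsupp).symm
    _ = ∫ x in U, f x * inner ℝ v (chartNormal e g (e x 0)) ∂(bdry D) := by
        refine setIntegral_congr_ae hUm ?_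
        filter_upwards [ae_mem_frontier D] with x hx hxU
        rw [h.normal_eq hD hxU hx]
    _ = ∫ x, f x * inner ℝ v (chartNormal e g (e x 0)) ∂(Measure.map (chartCurve e g)
          (volume.withDensity fun t => ‖chartTangent e g t‖ₑ)) := by
        rw [h.restrict_bdry ha hD, setIntegral_eq_integral_of_forall_compl_eq_zero hsupp']
    _ = ∫ t, (v0 * deriv g t - v1) * f (chartCurve e g t) := by
        rw [h.measurableEmbedding_chartCurve.integral_map]
        have h1 : (fun t => ‖chartTangent e g t‖ₑ) =
            fun t => ((‖chartTangent e g t‖₊ : ℝ≥0) : ℝ≥0∞) := rfl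
        rw [h1, integral_withDensity_eq_integral_smul
          (h.continuous_chartTangent ha).nnnorm.measurable]
        refine integral_congr_ae (Eventually.of_forall fun t => ?_)
        have h3 : (!₂[t, g t] : Plane) 0 = t := rfl
        simp only [coord_chartCurve, h3, inner_chartNormal, NNReal.smul_def, coe_nnnorm,
          norm_chartTangent, smul_eq_mul]
        have h2 : √(1 + deriv g t ^ 2) ≠ 0 := by positivity
        simp only [← hv0, ← hv1]
        field_simp

/-- The Gauss–Green formula. -/
theorem IsC1HolderDomain.integral_fderiv_eq (hD : IsC1HolderDomain a D) (ha : 0 < a)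
    {f : Plane → ℝ} (hf : ContDiff ℝ 1 f) (v : Plane) :
    ∫ x in D, fderiv ℝ f x v = ∫ x, f x * inner ℝ v (normal D x) ∂(bdry D) := by
  have hfin := hD.isFiniteMeasure_bdry ha
  -- At an interior point `U` is D itself and both sides vanish; at a boundary point it is a chart
  -- ball. A smooth partition of unity on the compact closure then globalizes.
  have hloc : ∀ p ∈ closure D, ∃ U : Set Plane, IsOpen U ∧ Bornology.IsBounded U ∧ p ∈ U ∧
      ∀ f : Plane → ℝ, ContDiff ℝ 1 f → tsupport f ⊆ U →
        ∫ x in D, fderiv ℝ f x v = ∫ x, f x * inner ℝ v (normal D x) ∂(bdry D) := by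
    intro p hp
    by_cases hpD : p ∈ D
    · refine ⟨D, hD.isOpen, hD.isBounded, hpD, fun f hf hfD => ?_⟩
      have hfc : HasCompactSupport f :=
        Metric.isCompact_of_isClosed_isBounded (isClosed_tsupport f) (hD.isBounded.subset hfD)
      have h1 : ∫ x in D, fderiv ℝ f x v = ∫ x, fderiv ℝ f x v := by
        refine setIntegral_eq_integral_of_forall_compl_eq_zero fun x hx => ?_
        rw [image_eq_zero_of_notMem_tsupport (f := fderiv ℝ f) fun hx' =>
          hx (hfD (tsupport_fderiv_subset ℝ hx'))]
        rfl
      have hi : Integrable fun x => fderiv ℝ f x v :=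
        ((hf.continuous_fderiv one_ne_zero).clm_apply
          continuous_const).integrable_of_hasCompactSupport (hfc.fderiv_apply ℝ v)
      have h2 := integral_mul_fderiv_eq_neg_fderiv_mul_of_integrable (μ := (volume : Measure Plane))
        (f := fun _ => (1 : ℝ)) (g := f) (v := v) (by simp) (by simpa using hi)
        (by simpa using hf.continuous.integrable_of_hasCompactSupport hfc)
        (fun _ _ => differentiableAt_const _) (fun x _ => hf.differentiable one_ne_zero x)
      rw [h1]
      simp only [one_mul, fderiv_fun_const, Pi.zero_apply, zero_apply, zero_mul,
        integral_zero, neg_zero] at h2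
      rw [h2, eq_comm]
      refine integral_eq_zero_of_ae ?_
      filter_upwards [ae_mem_frontier D] with x hx
      rw [hD.isOpen.frontier_eq] at hx
      rw [image_eq_zero_of_notMem_tsupport fun hx' => hx.2 (hfD hx'), zero_mul]
      rfl
    · have hpf : p ∈ frontier D := by rw [hD.isOpen.frontier_eq]; exact ⟨hp, hpD⟩
      obtain ⟨C, e, g, r, hr, h⟩ := hD.exists_isChart hpf
      refine ⟨_, Metric.isOpen_ball, Metric.isBounded_ball, Metric.mem_ball_self hr,
        fun f hf hfU => h.integral_fderiv_eq ha hD.isOpen hf ?_ hfU v⟩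
      exact Metric.isCompact_of_isClosed_isBounded (isClosed_tsupport f)
        (Metric.isBounded_ball.subset hfU)
  choose! U hUo hUb hpU hU using hloc
  obtain ⟨T, hT⟩ := hD.isCompact_closure.elim_nhds_subcover' (fun p _ => U p)
    fun p hp => (hUo p hp).mem_nhds (hpU p hp)
  obtain ⟨χ, hχ⟩ := SmoothPartitionOfUnity.exists_isSubordinate 𝓘(ℝ, Plane)
    (isClosed_closure (s := D)) (fun i : T => U i) (fun i => hUo _ i.1.2) (by
      intro x hx
      obtain ⟨i, hi, hxi⟩ := Set.mem_iUnion₂.1 (hT hx)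
      exact Set.mem_iUnion.2 ⟨⟨i, hi⟩, hxi⟩)
  have hχs : ∀ i, ContDiff ℝ 1 fun x => χ i x := fun i =>
    (χ i).contMDiff.contDiff.of_le (by simp)
  have hsum : ∀ x ∈ closure D, ∑ i, χ i x = 1 := fun x hx => by
    rw [← finsum_eq_sum_of_fintype]; exact χ.sum_eq_one hx
  have hfi : ∀ i, ContDiff ℝ 1 fun x => χ i x * f x := fun i => (hχs i).mul hf
  have hloc' : ∀ i, ∫ x in D, fderiv ℝ (fun x => χ i x * f x) x v =
      ∫ x, χ i x * f x * inner ℝ v (normal D x) ∂(bdry D) := fun i =>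
    hU i i.1.2 _ (hfi i) ((closure_mono (Function.support_mul_subset_left _ _)).trans (hχ i))
  have hint1 : ∀ i, IntegrableOn (fun x => fderiv ℝ (fun x => χ i x * f x) x v) D := fun i =>
    (((hfi i).continuous_fderiv one_ne_zero).clm_apply
      continuous_const).continuousOn.integrableOn_compact hD.isCompact_closure |>.mono_set
        subset_closure
  have hint2 : ∀ i, Integrable (fun x => χ i x * f x * inner ℝ v (normal D x)) (bdry D) := by
    intro i
    have : ContinuousOn (fun x => χ i x * f x * inner ℝ v (normal D x)) (frontier D) :=
      (hfi i).continuous.continuousOn.mul (continuousOn_const.inner (hD.continuousOn_normal ha))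
    have hfin' : IsFiniteMeasure (μH[1].restrict (frontier D)) := hfin
    obtain ⟨B, hB⟩ := hD.isCompact_frontier.exists_bound_of_continuousOn this
    refine Integrable.of_bound (this.aestronglyMeasurable isClosed_frontier.measurableSet) B ?_
    filter_upwards [ae_mem_frontier D] with x hx using hB x hx
  calc ∫ x in D, fderiv ℝ f x v
      = ∫ x in D, ∑ i, fderiv ℝ (fun x => χ i x * f x) x v := by
        refine setIntegral_congr_fun hD.isOpen.measurableSet fun x hx => ?_
        have heq : f =ᶠ[𝓝 x] fun y => ∑ i, χ i y * f y := by
          filter_upwards [hD.isOpen.mem_nhds hx] with y hy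
          rw [← Finset.sum_mul, hsum y (subset_closure hy), one_mul]
        rw [heq.fderiv_eq, fderiv_fun_sum fun i _ => (hfi i).differentiable one_ne_zero x]
        simp
    _ = ∑ i, ∫ x in D, fderiv ℝ (fun x => χ i x * f x) x v :=
        integral_finsetSum _ fun i _ => hint1 i
    _ = ∑ i, ∫ x, χ i x * f x * inner ℝ v (normal D x) ∂(bdry D) :=
        Finset.sum_congr rfl fun i _ => hloc' i
    _ = ∫ x, ∑ i, χ i x * f x * inner ℝ v (normal D x) ∂(bdry D) :=
        (integral_finsetSum _ fun i _ => hint2 i).symm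
    _ = _ := by
        refine integral_congr_ae ?_
        filter_upwards [ae_mem_frontier D] with x hx
        rw [← Finset.sum_mul, ← Finset.sum_mul, hsum x (frontier_subset_closure hx), one_mul]

end Divergence

/-! ### Schur's test and compact kernel operators -/

section Schur

variable {X : Type*} [MeasurableSpace X] {μ : Measure X}

/-- The hypotheses of Schur's test, with bound `C`. -/
structure IsSchurKernel (μ : Measure X) (k : X → X → ℝ) (C : ℝ≥0) : Prop where
  meas : AEStronglyMeasurable (Function.uncurry k) (μ.prod μ)
  right : ∀ᵐ x ∂μ, ∫⁻ y, ‖k x y‖ₑ ∂μ ≤ C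
  left : ∀ᵐ y ∂μ, ∫⁻ x, ‖k x y‖ₑ ∂μ ≤ C

theorem enorm_ofReal (r : ℝ) : ‖(r : ℂ)‖ₑ = ‖r‖ₑ := by
  rw [← ofReal_norm, ← ofReal_norm, Complex.norm_real]

theorem eLpNorm_two_sq {f : X → ℂ} : eLpNorm f 2 μ ^ 2 = ∫⁻ x, ‖f x‖ₑ ^ 2 ∂μ := by
  have := eLpNorm_nnreal_pow_eq_lintegral (μ := μ) (f := f) (p := 2) two_ne_zero
  simpa using this

/-- Cauchy–Schwarz for the splitting |k||φ| = |k|^{1/2} · (|k||φ|²)^{1/2}. -/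
theorem lintegral_mul_enorm_sq_le {k : X → ℝ} {φ : X → ℂ} (hk : AEMeasurable k μ)
    (hφ : AEMeasurable φ μ) :
    (∫⁻ y, ‖k y‖ₑ * ‖φ y‖ₑ ∂μ) ^ 2 ≤ (∫⁻ y, ‖k y‖ₑ ∂μ) * ∫⁻ y, ‖k y‖ₑ * ‖φ y‖ₑ ^ 2 ∂μ := by
  have h1 := ENNReal.lintegral_mul_norm_pow_le (μ := μ) (f := fun y => ‖k y‖ₑ)
    (g := fun y => ‖k y‖ₑ * ‖φ y‖ₑ ^ 2) (p := 1 / 2) (q := 1 / 2) hk.enorm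
    (hk.enorm.mul (hφ.enorm.pow_const 2)) (by norm_num) (by norm_num) (by norm_num)
  have h2 : ∀ c d : ℝ≥0∞, c ^ (1 / 2 : ℝ) * (c * d ^ 2) ^ (1 / 2 : ℝ) = c * d := by
    intro c d
    rw [ENNReal.mul_rpow_of_nonneg _ _ (by norm_num), ← mul_assoc,
      ← ENNReal.rpow_add_of_nonneg _ _ (by norm_num) (by norm_num), ← ENNReal.rpow_natCast d 2,
      ← ENNReal.rpow_mul]
    norm_num
  simp only [h2] at h1
  calc _ ≤ ((∫⁻ y, ‖k y‖ₑ ∂μ) ^ (1 / 2 : ℝ) *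
        (∫⁻ y, ‖k y‖ₑ * ‖φ y‖ₑ ^ 2 ∂μ) ^ (1 / 2 : ℝ)) ^ 2 := by gcongr
    _ = _ := by
      rw [mul_pow, ← ENNReal.rpow_natCast, ← ENNReal.rpow_mul, ← ENNReal.rpow_natCast,
        ← ENNReal.rpow_mul]
      norm_num

namespace IsSchurKernel

variable [SFinite μ] {k : X → X → ℝ} {C : ℝ≥0}

theorem lintegral_sq_le (hk : IsSchurKernel μ k C) {φ : X → ℂ} (hφ : AEStronglyMeasurable φ μ) :
    ∫⁻ x, (∫⁻ y, ‖k x y‖ₑ * ‖φ y‖ₑ ∂μ) ^ 2 ∂μ ≤ (C : ℝ≥0∞) ^ 2 * ∫⁻ y, ‖φ y‖ₑ ^ 2 ∂μ := by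
  have hm1 : AEMeasurable (fun p : X × X => ‖k p.1 p.2‖ₑ * ‖φ p.2‖ₑ ^ 2) (μ.prod μ) :=
    hk.meas.enorm.mul (hφ.comp_snd.enorm.pow_const 2)
  calc ∫⁻ x, (∫⁻ y, ‖k x y‖ₑ * ‖φ y‖ₑ ∂μ) ^ 2 ∂μ
      ≤ ∫⁻ x, C * ∫⁻ y, ‖k x y‖ₑ * ‖φ y‖ₑ ^ 2 ∂μ ∂μ := by
        refine lintegral_mono_ae ?_
        filter_upwards [hk.right, hk.meas.prodMk_left] with x hx hxm
        exact (lintegral_mul_enorm_sq_le hxm.aemeasurable hφ.aemeasurable).trans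
          (mul_le_mul_left hx _)
    _ = C * ∫⁻ y, ∫⁻ x, ‖k x y‖ₑ * ‖φ y‖ₑ ^ 2 ∂μ ∂μ := by
        rw [lintegral_const_mul' _ _ ENNReal.coe_ne_top, lintegral_lintegral_swap hm1]
    _ ≤ C * ∫⁻ y, C * ‖φ y‖ₑ ^ 2 ∂μ := by
        gcongr 1
        refine lintegral_mono_ae ?_
        filter_upwards [hk.left] with y hy
        rw [lintegral_mul_const' _ _ (by finiteness)]
        gcongr
    _ = _ := by
        rw [lintegral_const_mul' _ _ ENNReal.coe_ne_top, ← mul_assoc, sq]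

theorem ae_integrable (hk : IsSchurKernel μ k C) {φ : X → ℂ} (hφ : MemLp φ 2 μ) :
    ∀ᵐ x ∂μ, Integrable (fun y => (k x y : ℂ) * φ y) μ := by
  have h1 := hk.lintegral_sq_le hφ.1
  have hfin : ∫⁻ x, (∫⁻ y, ‖k x y‖ₑ * ‖φ y‖ₑ ∂μ) ^ 2 ∂μ ≠ ⊤ := by
    refine (h1.trans_lt (ENNReal.mul_lt_top (by finiteness) ?_)).ne
    rw [← eLpNorm_two_sq]
    exact ENNReal.pow_lt_top hφ.2
  have hm : AEMeasurable (fun p : X × X => ‖k p.1 p.2‖ₑ * ‖φ p.2‖ₑ) (μ.prod μ) :=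
    hk.meas.enorm.mul hφ.1.comp_snd.enorm
  have h2 := ae_lt_top' (hm.lintegral_prod_right'.pow_const 2) hfin
  filter_upwards [h2, hk.meas.prodMk_left] with x hx hxm
  refine ⟨(Complex.continuous_ofReal.comp_aestronglyMeasurable hxm).mul hφ.1, ?_⟩
  have h3 : ∫⁻ y, ‖k x y‖ₑ * ‖φ y‖ₑ ∂μ < ⊤ := by
    by_contra h
    rw [not_lt, top_le_iff] at h
    rw [h] at hx
    exact absurd hx (by simp)
  simpa [HasFiniteIntegral, enorm_mul, enorm_ofReal] using h3

theorem memLp_integral (hk : IsSchurKernel μ k C) {φ : X → ℂ} (hφ : MemLp φ 2 μ) :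
    MemLp (fun x => ∫ y, (k x y : ℂ) * φ y ∂μ) 2 μ ∧
      eLpNorm (fun x => ∫ y, (k x y : ℂ) * φ y ∂μ) 2 μ ≤ C * eLpNorm φ 2 μ := by
  have hm : AEStronglyMeasurable (fun p : X × X => (k p.1 p.2 : ℂ) * φ p.2) (μ.prod μ) :=
    (Complex.continuous_ofReal.comp_aestronglyMeasurable hk.meas).mul hφ.1.comp_snd
  have hle : eLpNorm (fun x => ∫ y, (k x y : ℂ) * φ y ∂μ) 2 μ ≤ C * eLpNorm φ 2 μ := by
    refine (ENNReal.pow_le_pow_left_iff two_ne_zero).1 ?_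
    rw [mul_pow, eLpNorm_two_sq, eLpNorm_two_sq]
    refine le_trans (lintegral_mono fun x => ?_) (hk.lintegral_sq_le hφ.1)
    gcongr
    refine (enorm_integral_le_lintegral_enorm _).trans_eq ?_
    simp [enorm_mul, enorm_ofReal]
  exact ⟨⟨hm.integral_prod_right', hle.trans_lt (ENNReal.mul_lt_top ENNReal.coe_lt_top hφ.2)⟩, hle⟩

/-- The bounded operator on `L²` with a kernel satisfying Schur's test. -/
def op (hk : IsSchurKernel μ k C) : Lp ℂ 2 μ →L[ℂ] Lp ℂ 2 μ :=
  LinearMap.mkContinuous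
    { toFun := fun φ => (hk.memLp_integral (Lp.memLp φ)).1.toLp _
      map_add' := fun φ ψ => by
        rw [← MemLp.toLp_add, MemLp.toLp_eq_toLp_iff]
        filter_upwards [hk.ae_integrable (Lp.memLp φ), hk.ae_integrable (Lp.memLp ψ)] with x h1 h2
        rw [Pi.add_apply, ← integral_add h1 h2]
        refine integral_congr_ae ?_
        filter_upwards [Lp.coeFn_add φ ψ] with y hy
        rw [hy, Pi.add_apply, mul_add]
      map_smul' := fun c φ => by
        rw [RingHom.id_apply, ← MemLp.toLp_const_smul, MemLp.toLp_eq_toLp_iff]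
        refine Eventually.of_forall fun x => ?_
        simp only [Pi.smul_apply, smul_eq_mul]
        rw [← integral_const_mul]
        refine integral_congr_ae ?_
        filter_upwards [Lp.coeFn_smul c φ] with y hy
        rw [hy, Pi.smul_apply, smul_eq_mul]
        ring } C fun φ => by
    have h := (hk.memLp_integral (Lp.memLp φ)).2
    simp only [LinearMap.coe_mk, AddHom.coe_mk, Lp.norm_toLp]
    rw [Lp.norm_def, ← ENNReal.coe_toReal, ← ENNReal.toReal_mul]
    exact ENNReal.toReal_mono (ENNReal.mul_ne_top ENNReal.coe_ne_top (Lp.eLpNorm_ne_top φ)) h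

theorem op_ae (hk : IsSchurKernel μ k C) (φ : Lp ℂ 2 μ) :
    hk.op φ =ᵐ[μ] fun x => ∫ y, (k x y : ℂ) * φ y ∂μ :=
  MemLp.coeFn_toLp (hk.memLp_integral (Lp.memLp φ)).1

theorem norm_op_le (hk : IsSchurKernel μ k C) : ‖hk.op‖ ≤ C :=
  LinearMap.mkContinuous_norm_le _ C.2 _

/-- From |ψ||φ| ≤ |ψ|² + |φ|², after which each term needs only one of the two marginal bounds. This
justifies Fubini for the bilinear forms of the kernels. -/
theorem integrable_prod (hk : IsSchurKernel μ k C) {φ ψ : X → ℂ} (hφ : MemLp φ 2 μ)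
    (hψ : MemLp ψ 2 μ) :
    Integrable (fun p : X × X => ψ p.1 * ((k p.1 p.2 : ℂ) * φ p.2)) (μ.prod μ) := by
  have hm : AEStronglyMeasurable (fun p : X × X => ψ p.1 * ((k p.1 p.2 : ℂ) * φ p.2))
      (μ.prod μ) := hψ.1.comp_fst.mul
    ((Complex.continuous_ofReal.comp_aestronglyMeasurable hk.meas).mul hφ.1.comp_snd)
  refine ⟨hm, ?_⟩
  have hN : ∀ {χ : X → ℂ}, MemLp χ 2 μ → ∫⁻ x, ‖χ x‖ₑ ^ 2 ∂μ < ⊤ := fun hχ => by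
    rw [← eLpNorm_two_sq]; exact ENNReal.pow_lt_top hχ.2
  have key : ∀ x y z : ℝ≥0∞, x * (y * z) ≤ y * x ^ 2 + y * z ^ 2 := by
    intro x y z
    have h1 : x * z ≤ x ^ 2 + z ^ 2 := by
      rcases le_total x z with h | h
      · exact (mul_le_mul_left h z).trans (by rw [← sq]; exact le_add_self)
      · exact (mul_le_mul_right h x).trans (by rw [← sq]; exact le_self_add)
    calc x * (y * z) = y * (x * z) := by ring
      _ ≤ y * (x ^ 2 + z ^ 2) := by gcongr
      _ = _ := mul_add _ _ _
  have hm1 : AEMeasurable (fun p : X × X => ‖k p.1 p.2‖ₑ * ‖ψ p.1‖ₑ ^ 2) (μ.prod μ) :=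
    hk.meas.enorm.mul (hψ.1.comp_fst.enorm.pow_const 2)
  have hm2 : AEMeasurable (fun p : X × X => ‖k p.1 p.2‖ₑ * ‖φ p.2‖ₑ ^ 2) (μ.prod μ) :=
    hk.meas.enorm.mul (hφ.1.comp_snd.enorm.pow_const 2)
  calc ∫⁻ p : X × X, ‖ψ p.1 * ((k p.1 p.2 : ℂ) * φ p.2)‖ₑ ∂(μ.prod μ)
      ≤ ∫⁻ p : X × X, (‖k p.1 p.2‖ₑ * ‖ψ p.1‖ₑ ^ 2 + ‖k p.1 p.2‖ₑ * ‖φ p.2‖ₑ ^ 2)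
          ∂(μ.prod μ) := by
        refine lintegral_mono fun p => ?_
        rw [enorm_mul, enorm_mul, enorm_ofReal]
        exact key _ _ _
    _ = (∫⁻ x, ∫⁻ y, ‖k x y‖ₑ * ‖ψ x‖ₑ ^ 2 ∂μ ∂μ) +
          ∫⁻ y, ∫⁻ x, ‖k x y‖ₑ * ‖φ y‖ₑ ^ 2 ∂μ ∂μ := by
        rw [lintegral_add_left' hm1, lintegral_prod _ hm1, lintegral_prod_symm _ hm2]
    _ ≤ (∫⁻ x, C * ‖ψ x‖ₑ ^ 2 ∂μ) + ∫⁻ y, C * ‖φ y‖ₑ ^ 2 ∂μ := by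
        refine add_le_add (lintegral_mono_ae ?_) (lintegral_mono_ae ?_)
        · filter_upwards [hk.right] with x hx
          rw [lintegral_mul_const' _ _ (by finiteness)]
          gcongr
        · filter_upwards [hk.left] with y hy
          rw [lintegral_mul_const' _ _ (by finiteness)]
          gcongr
    _ < ⊤ := by
        rw [lintegral_const_mul' _ _ ENNReal.coe_ne_top, lintegral_const_mul' _ _ ENNReal.coe_ne_top]
        exact ENNReal.add_lt_top.2 ⟨ENNReal.mul_lt_top ENNReal.coe_lt_top (hN hψ),
          ENNReal.mul_lt_top ENNReal.coe_lt_top (hN hφ)⟩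

end IsSchurKernel

/-- An operator whose kernel is approximated, in the sense of Schur's test, by kernels that depend
on `y` only through a simple function is compact. -/
theorem isCompactOperator_of_kernel_approx [IsFiniteMeasure μ]
    [MeasurableSpace.CountablyGenerated X]
    {T : Lp ℂ 2 μ →L[ℂ] Lp ℂ 2 μ} {k : X → X → ℝ} {C : ℝ≥0} (hk : IsSchurKernel μ k C)
    (hT : ∀ φ, T φ =ᵐ[μ] fun x => ∫ y, (k x y : ℂ) * φ y ∂μ)
    (happ : ∀ η : ℝ≥0, 0 < η → ∃ (q : SimpleFunc X X) (k' : X → X → ℝ),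
      (∀ z, AEStronglyMeasurable (fun x => k' x z) μ) ∧
      (∀ z, ∃ B, ∀ᵐ x ∂μ, ‖k' x z‖ ≤ B) ∧
      IsSchurKernel μ (fun x y => k x y - k' x (q y)) η) :
    IsCompactOperator T := by
  have hcl : IsClosed {S : Lp ℂ 2 μ →L[ℂ] Lp ℂ 2 μ | IsCompactOperator S} :=
    isClosed_setOfPred_isCompactOperator
  suffices h : T ∈ closure {S : Lp ℂ 2 μ →L[ℂ] Lp ℂ 2 μ | IsCompactOperator S} by
    rwa [hcl.closure_eq] at h
  rw [Metric.mem_closure_iff]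
  intro ε hε
  obtain ⟨q, k', hk'm, hk'b, hdiff⟩ := happ (ε / 2).toNNReal
    (Real.toNNReal_pos.2 (half_pos hε))
  have hmem : ∀ z, MemLp (fun x => (k' x z : ℂ)) 2 μ := fun z => by
    obtain ⟨B, hB⟩ := hk'b z
    refine MemLp.of_bound (Complex.continuous_ofReal.comp_aestronglyMeasurable (hk'm z)) B ?_
    simpa using hB
  let ℓ : X → Lp ℂ 2 μ →L[ℂ] ℂ := fun z =>
    innerSL ℂ (indicatorConstLp 2 (q.measurableSet_fiber z) (measure_ne_top μ _) (1 : ℂ))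
  have hℓ : ∀ z φ, ℓ z φ = ∫ y in q ⁻¹' {z}, φ y ∂μ := fun z φ =>
    L2.inner_indicatorConstLp_one (q.measurableSet_fiber z) (measure_ne_top μ _) φ
  -- A kernel depending on y only through the finitely many values of `q` defines a finite-rank
  -- operator: φ enters only through its integrals over the fibres.
  let S : Lp ℂ 2 μ →L[ℂ] Lp ℂ 2 μ := ∑ z ∈ q.range, (ℓ z).smulRight ((hmem z).toLp _)
  have hS : IsCompactOperator S := by
    refine Finset.sum_induction _ (fun S : Lp ℂ 2 μ →L[ℂ] Lp ℂ 2 μ => IsCompactOperator S)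
      (fun _ _ h1 h2 => h1.add h2) isCompactOperator_zero fun z _ => ?_
    exact isCompactOperator_smulRight _ _
  refine ⟨S, hS, ?_⟩
  have hSapp : ∀ φ, S φ =ᵐ[μ] fun x => ∫ y, (k' x (q y) : ℂ) * φ y ∂μ := by
    intro φ
    have h1 : S φ = ∑ z ∈ q.range, ℓ z φ • (hmem z).toLp _ := by simp [S]
    have h2 : ∀ z, ((ℓ z φ • (hmem z).toLp _ : Lp ℂ 2 μ) : X → ℂ) =ᵐ[μ]
        fun x => ∫ y in q ⁻¹' {z}, (k' x (q y) : ℂ) * φ y ∂μ := by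
      intro z
      filter_upwards [Lp.coeFn_smul (ℓ z φ) ((hmem z).toLp _), (hmem z).coeFn_toLp] with x h3 h4
      rw [h3, Pi.smul_apply, h4, smul_eq_mul, hℓ, mul_comm, ← integral_const_mul]
      refine setIntegral_congr_fun (q.measurableSet_fiber z) fun y hy => ?_
      have : q y = z := hy
      rw [this]
    have hφi : Integrable φ μ := (Lp.memLp φ).integrable one_le_two
    have h5 : ∀ᵐ x ∂μ, ∀ z ∈ q.range,
        ((ℓ z φ • (hmem z).toLp _ : Lp ℂ 2 μ) : X → ℂ) x =
          ∫ y in q ⁻¹' {z}, (k' x (q y) : ℂ) * φ y ∂μ :=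
      (ae_ball_iff q.range.countable_toSet).2 fun z _ => h2 z
    rw [h1]
    filter_upwards [Lp.coeFn_finsetSum q.range fun z => ℓ z φ • (hmem z).toLp _, h5] with x h6 h7
    rw [h6, Finset.sum_apply, Finset.sum_congr rfl h7]
    have hcover : (⋃ z ∈ q.range, q ⁻¹' {z}) = Set.univ := by
      ext y; simp
    rw [← integral_biUnion_finset, hcover, Measure.restrict_univ]
    · exact fun z _ => q.measurableSet_fiber z
    · intro z _ w _ hzw
      exact Disjoint.preimage _ (Set.disjoint_singleton.2 hzw)
    · intro z _
      refine IntegrableOn.congr_fun (f := fun y => (k' x z : ℂ) * φ y)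
        (hφi.const_mul _).integrableOn (fun y hy => ?_) (q.measurableSet_fiber z)
      have : q y = z := hy
      simp only [this]
  have hsub : T - S = hdiff.op := by
    ext1 φ
    refine Lp.ext ?_
    have hint : ∀ᵐ x ∂μ, Integrable (fun y => (k' x (q y) : ℂ) * φ y) μ := by
      filter_upwards [hk.ae_integrable (Lp.memLp φ), hdiff.ae_integrable (Lp.memLp φ)] with x h1 h2
      refine (h1.sub h2).congr (Eventually.of_forall fun y => ?_)
      simp
      ring
    filter_upwards [Lp.coeFn_sub (T φ) (S φ), hT φ, hSapp φ, hdiff.op_ae φ,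
      hk.ae_integrable (Lp.memLp φ), hint] with x h1 h2 h3 h4 h5 h6
    rw [sub_apply, h1, Pi.sub_apply, h2, h3, h4, ← integral_sub h5 h6]
    refine integral_congr_ae (Eventually.of_forall fun y => ?_)
    simp
    ring
  rw [dist_eq_norm, hsub]
  refine hdiff.norm_op_le.trans_lt ?_
  rw [Real.coe_toNNReal _ (half_pos hε).le]
  linarith

end Schur

/-! ### The Neumann–Poincaré and logarithmic kernels -/

section Kernels

variable {a : ℝ≥0} {D : Set Plane}

instance (D : Set Plane) : NullSingletonClass (bdry D) :=
  have := Measure.nullSingletonClass_hausdorff Plane one_pos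
  inferInstanceAs (NullSingletonClass ((μH[1] : Measure Plane).restrict (frontier D)))

theorem ae_ne (D : Set Plane) (x : Plane) : ∀ᵐ y ∂(bdry D), y ≠ x := by
  rw [ae_iff]
  simp

theorem IsC1HolderDomain.exists_lintegral_rpow_le (hD : IsC1HolderDomain a D) (ha : 0 < a)
    {s : ℝ} (hs0 : 0 < s) (hs1 : s < 1) :
    ∃ M : ℝ≥0, 0 < M ∧ bdry D Set.univ ≤ M ∧
      ∀ z, ∫⁻ y, ENNReal.ofReal (‖z - y‖ ^ (-s)) ∂(bdry D) ≤ M := by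
  have := hD.isFiniteMeasure_bdry ha
  obtain ⟨K, hK⟩ := hD.exists_isUpperRegular ha
  obtain ⟨M, hM⟩ := hK.exists_lintegral_rpow_le hs0 hs1
  refine ⟨M + (bdry D Set.univ).toNNReal + 1, by positivity, ?_, fun z => (hM z).trans ?_⟩
  · calc bdry D Set.univ = ((bdry D Set.univ).toNNReal : ℝ≥0∞) :=
          (ENNReal.coe_toNNReal (measure_ne_top _ _)).symm
      _ ≤ _ := by
          rw [ENNReal.coe_le_coe, add_right_comm]
          exact le_add_self
  · rw [ENNReal.coe_le_coe, add_assoc]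
    exact le_self_add

theorem lintegral_enorm_le_of_rpow_bound {M : ℝ≥0} {s c d : ℝ} (hc : 0 ≤ c)
    {μ : Measure Plane} {z : Plane} (hM : ∫⁻ y, ENNReal.ofReal (‖z - y‖ ^ (-s)) ∂μ ≤ M)
    (hμ : μ Set.univ ≤ M) {f : Plane → ℝ} (hf : ∀ᵐ y ∂μ, |f y| ≤ c * ‖z - y‖ ^ (-s) + d) :
    ∫⁻ y, ‖f y‖ₑ ∂μ ≤ ((c.toNNReal + d.toNNReal) * M : ℝ≥0) := by
  calc ∫⁻ y, ‖f y‖ₑ ∂μ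
      ≤ ∫⁻ y, (ENNReal.ofReal c * ENNReal.ofReal (‖z - y‖ ^ (-s)) + ENNReal.ofReal d) ∂μ := by
        refine lintegral_mono_ae (hf.mono fun y hy => ?_)
        rw [← ENNReal.ofReal_mul hc]
        refine le_trans ?_ ENNReal.ofReal_add_le
        rw [← ofReal_norm]
        exact ENNReal.ofReal_le_ofReal hy
    _ = ENNReal.ofReal c * ∫⁻ y, ENNReal.ofReal (‖z - y‖ ^ (-s)) ∂μ +
          ENNReal.ofReal d * μ Set.univ := by
        rw [lintegral_add_right _ measurable_const, lintegral_const_mul' _ _ ENNReal.ofReal_ne_top,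
          lintegral_const]
    _ ≤ ENNReal.ofReal c * M + ENNReal.ofReal d * M := by gcongr
    _ = _ := by rw [← add_mul, ENNReal.coe_mul, ENNReal.coe_add]; rfl

/-- The bound is symmetric in x and y, so it controls both marginals; the diagonal may be ignored
because points carry no arc length. -/
theorem isSchurKernel_of_rpow_bound {M : ℝ≥0} {s c d : ℝ} (hc : 0 ≤ c) (hM0 : bdry D Set.univ ≤ M)
    (hM : ∀ z, ∫⁻ y, ENNReal.ofReal (‖z - y‖ ^ (-s)) ∂(bdry D) ≤ M) {k : Plane → Plane → ℝ}
    (hk : AEStronglyMeasurable (Function.uncurry k) ((bdry D).prod (bdry D)))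
    (hb : ∀ x ∈ frontier D, ∀ y ∈ frontier D, x ≠ y → |k x y| ≤ c * ‖x - y‖ ^ (-s) + d) :
    IsSchurKernel (bdry D) k ((c.toNNReal + d.toNNReal) * M) where
  meas := hk
  right := by
    filter_upwards [ae_mem_frontier D] with x hx
    refine lintegral_enorm_le_of_rpow_bound hc (hM x) hM0 ?_
    filter_upwards [ae_mem_frontier D, ae_ne D x] with y hy hyx
    exact hb x hx y hy hyx.symm
  left := by
    filter_upwards [ae_mem_frontier D] with y hy
    refine lintegral_enorm_le_of_rpow_bound hc (hM y) hM0 ?_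
    filter_upwards [ae_mem_frontier D, ae_ne D y] with x hx hxy
    rw [norm_sub_rev]
    exact hb x hx y hy hxy

/-- The regularized Neumann–Poincaré kernel. -/
def npReg (D : Set Plane) (ε : ℝ) (x y : Plane) : ℝ :=
  1 / (2 * Real.pi) * (inner ℝ (x - y) (normal D x) / (‖x - y‖ ^ 2 + ε ^ 2))

theorem npReg_zero (D : Set Plane) : npReg D 0 = npKernel D := by
  funext x y
  simp [npReg, npKernel]

theorem IsC1HolderDomain.aestronglyMeasurable_npReg_comp (hD : IsC1HolderDomain a D) (ha : 0 < a)
    (ε : ℝ) {q : Plane → Plane} (hq : Measurable q) :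
    AEStronglyMeasurable (Function.uncurry fun x y => npReg D ε x (q y))
      ((bdry D).prod (bdry D)) := by
  have := hD.isFiniteMeasure_bdry ha
  have h1 : AEStronglyMeasurable (fun p : Plane × Plane => normal D p.1)
      ((bdry D).prod (bdry D)) := (hD.aestronglyMeasurable_normal ha).comp_fst
  have h2 : Measurable fun p : Plane × Plane => p.1 - q p.2 :=
    measurable_fst.sub (hq.comp measurable_snd)
  have h3 := (h2.aestronglyMeasurable (μ := (bdry D).prod (bdry D))).inner (𝕜 := ℝ) h1
  have h4 : Measurable fun p : Plane × Plane => ‖p.1 - q p.2‖ ^ 2 + ε ^ 2 :=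
    (h2.norm.pow_const 2).add_const _
  exact ((h3.aemeasurable.div h4.aemeasurable).const_mul _).aestronglyMeasurable

theorem IsC1HolderDomain.aestronglyMeasurable_npReg_left (hD : IsC1HolderDomain a D) (ha : 0 < a)
    (ε : ℝ) (z : Plane) : AEStronglyMeasurable (fun x => npReg D ε x z) (bdry D) := by
  have h2 : Measurable fun x : Plane => x - z := measurable_id.sub_const z
  have h3 := (h2.aestronglyMeasurable (μ := bdry D)).inner (𝕜 := ℝ)
    (hD.aestronglyMeasurable_normal ha)
  have h4 : Measurable fun x : Plane => ‖x - z‖ ^ 2 + ε ^ 2 :=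
    (h2.norm.pow_const 2).add_const _
  exact ((h3.aemeasurable.div h4.aemeasurable).const_mul _).aestronglyMeasurable

theorem abs_npReg_le (D : Set Plane) (ε : ℝ) (x y : Plane) :
    |npReg D ε x y| ≤ |npKernel D x y| := by
  rcases eq_or_ne x y with rfl | hxy
  · simp [npReg, npKernel]
  have hpos : 0 < ‖x - y‖ := norm_pos_iff.2 (sub_ne_zero.2 hxy)
  rw [npReg, npKernel, abs_mul, abs_mul]
  refine mul_le_mul_of_nonneg_left ?_ (abs_nonneg _)
  rw [abs_div, abs_div, abs_of_pos (by positivity : 0 < ‖x - y‖ ^ 2 + ε ^ 2),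
    abs_of_pos (by positivity : 0 < ‖x - y‖ ^ 2)]
  gcongr
  linarith [sq_nonneg ε]

theorem abs_npReg_le_inv (D : Set Plane) {ε : ℝ} (hε : 0 < ε) (x z : Plane) :
    ‖npReg D ε x z‖ ≤ 1 / (2 * Real.pi) * (1 / ε) := by
  rw [npReg, norm_mul, Real.norm_of_nonneg (by positivity : 0 ≤ 1 / (2 * Real.pi)), norm_div,
    Real.norm_of_nonneg (by positivity : 0 ≤ ‖x - z‖ ^ 2 + ε ^ 2)]
  gcongr ?_ * ?_
  rw [div_le_div_iff₀ (by positivity) hε]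
  have h1 : ‖(inner ℝ (x - z) (normal D x) : ℝ)‖ ≤ ‖x - z‖ :=
    (norm_inner_le_norm _ _).trans
      (mul_le_of_le_one_right (norm_nonneg _) (norm_normal_le D _))
  nlinarith [sq_nonneg (‖x - z‖ - ε), norm_nonneg (x - z)]

/-- A cutoff factor of order two is bounded by every power of order at most two. -/
theorem sq_div_le_rpow {ε r θ : ℝ} (hε : 0 < ε) (hr : 0 < r) (hθ0 : 0 ≤ θ) (hθ : θ ≤ 2) :
    ε ^ 2 / (r ^ 2 + ε ^ 2) ≤ ε ^ θ * r ^ (-θ) := by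
  have h1 : ε ^ θ * r ^ (-θ) = (ε / r) ^ θ := by
    rw [Real.div_rpow hε.le hr.le, Real.rpow_neg hr.le]; rfl
  rw [h1]
  rcases le_total (ε / r) 1 with h | h
  · calc ε ^ 2 / (r ^ 2 + ε ^ 2) ≤ ε ^ 2 / r ^ 2 := by
          gcongr
          nlinarith [sq_nonneg ε]
      _ = (ε / r) ^ (2 : ℝ) := by rw [← div_pow]; exact (Real.rpow_natCast _ 2).symm
      _ ≤ _ := Real.rpow_le_rpow_of_exponent_ge (by positivity) h hθ
  · calc ε ^ 2 / (r ^ 2 + ε ^ 2) ≤ 1 := by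
          rw [div_le_one (by positivity)]
          nlinarith [sq_nonneg r]
      _ ≤ _ := Real.one_le_rpow h hθ0

/-- The kernel is of order a - 1. Giving up a/2 of the exponent pays for the factor ε^{a/2} in the
regularization error, and it leaves an exponent strictly between -1 and 0 even for a = 1. -/
theorem IsC1HolderDomain.exists_npKernel_bound (hD : IsC1HolderDomain a D) (ha1 : a ≤ 1) :
    ∃ C : ℝ, 0 ≤ C ∧
      (∀ x ∈ frontier D, ∀ y ∈ frontier D, x ≠ y →
        |npKernel D x y| ≤ C * ‖x - y‖ ^ (-(1 - (a : ℝ) / 2))) ∧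
      ∀ ε : ℝ, 0 < ε → ∀ x ∈ frontier D, ∀ y ∈ frontier D, x ≠ y →
        |npKernel D x y - npReg D ε x y| ≤
          C * ε ^ ((a : ℝ) / 2) * ‖x - y‖ ^ (-(1 - (a : ℝ) / 2)) := by
  obtain ⟨C, hC0, hC⟩ := hD.exists_abs_inner_normal_le
  obtain ⟨R, hR⟩ := hD.isCompact_frontier.isBounded.exists_norm_le
  have ha1' : (a : ℝ) ≤ 1 := by exact_mod_cast ha1
  have hnp : ∀ x ∈ frontier D, ∀ y ∈ frontier D, x ≠ y →
      |npKernel D x y| ≤ C * ‖x - y‖ ^ ((a : ℝ) - 1) := by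
    intro x hx y hy hxy
    have hpos : 0 < ‖x - y‖ := norm_pos_iff.2 (sub_ne_zero.2 hxy)
    have h1 : 1 / (2 * Real.pi) ≤ 1 := by
      rw [div_le_one (by positivity)]
      linarith [Real.pi_gt_three]
    rw [npKernel, abs_mul, abs_of_pos (by positivity : 0 < 1 / (2 * Real.pi)), abs_div,
      abs_of_pos (by positivity : 0 < ‖x - y‖ ^ 2)]
    calc _ ≤ 1 * (C * ‖x - y‖ ^ (1 + a : ℝ) / ‖x - y‖ ^ 2) := by
          gcongr
          exact hC x hx y hy
      _ = _ := by
          rw [one_mul, mul_div_assoc, ← Real.rpow_natCast ‖x - y‖ 2, ← Real.rpow_sub hpos]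
          congr 2
          push_cast
          ring
  have hR0 : 0 ≤ 2 * |R| := by positivity
  refine ⟨C * max 1 ((2 * |R|) ^ ((a : ℝ) / 2)), by positivity, ?_, ?_⟩
  · intro x hx y hy hxy
    have hpos : 0 < ‖x - y‖ := norm_pos_iff.2 (sub_ne_zero.2 hxy)
    have hle : ‖x - y‖ ≤ 2 * |R| := by
      calc ‖x - y‖ ≤ ‖x‖ + ‖y‖ := norm_sub_le _ _
        _ ≤ 2 * |R| := by linarith [hR x hx, hR y hy, le_abs_self R]
    calc |npKernel D x y| ≤ C * ‖x - y‖ ^ ((a : ℝ) - 1) := hnp x hx y hy hxy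
      _ = C * ‖x - y‖ ^ ((a : ℝ) / 2) * ‖x - y‖ ^ (-(1 - (a : ℝ) / 2)) := by
          rw [mul_assoc, ← Real.rpow_add hpos]
          congr 2
          ring
      _ ≤ _ := by
          gcongr
          refine le_trans ?_ (le_max_right _ _)
          gcongr
  · intro ε hε x hx y hy hxy
    have hpos : 0 < ‖x - y‖ := norm_pos_iff.2 (sub_ne_zero.2 hxy)
    have heq : npKernel D x y - npReg D ε x y =
        npKernel D x y * (ε ^ 2 / (‖x - y‖ ^ 2 + ε ^ 2)) := by
      rw [npKernel, npReg]
      field_simp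
      ring
    rw [heq, abs_mul, abs_of_nonneg (by positivity : 0 ≤ ε ^ 2 / (‖x - y‖ ^ 2 + ε ^ 2))]
    calc _ ≤ (C * ‖x - y‖ ^ ((a : ℝ) - 1)) * (ε ^ ((a : ℝ) / 2) * ‖x - y‖ ^ (-((a : ℝ) / 2))) := by
          gcongr
          · exact hnp x hx y hy hxy
          · exact sq_div_le_rpow hε hpos (by positivity) (by linarith)
      _ = C * 1 * ε ^ ((a : ℝ) / 2) * ‖x - y‖ ^ (-(1 - (a : ℝ) / 2)) := by
          rw [show -(1 - (a : ℝ) / 2) = ((a : ℝ) - 1) + -((a : ℝ) / 2) by ring,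
            Real.rpow_add hpos]
          ring
      _ ≤ _ := by
          gcongr
          exact le_max_left _ _

theorem half_exponent_pos (ha1 : a ≤ 1) : (0 : ℝ) < 1 - (a : ℝ) / 2 := by
  have : (a : ℝ) ≤ 1 := by exact_mod_cast ha1
  linarith

theorem half_exponent_lt_one (ha : 0 < a) : 1 - (a : ℝ) / 2 < 1 := by
  have : (0 : ℝ) < a := by exact_mod_cast ha
  linarith

theorem IsC1HolderDomain.exists_isSchurKernel_npKernel (hD : IsC1HolderDomain a D) (ha : 0 < a)
    (ha1 : a ≤ 1) : ∃ C, IsSchurKernel (bdry D) (npKernel D) C := by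
  obtain ⟨M, -, hM0, hM⟩ := hD.exists_lintegral_rpow_le ha (half_exponent_pos ha1)
    (half_exponent_lt_one ha)
  obtain ⟨C, hC0, hC, -⟩ := hD.exists_npKernel_bound ha1
  refine ⟨_, isSchurKernel_of_rpow_bound (d := 0) hC0 hM0 hM ?_ fun x hx y hy hxy => ?_⟩
  · simpa [npReg_zero] using hD.aestronglyMeasurable_npReg_comp ha 0 measurable_id
  · rw [add_zero]; exact hC x hx y hy hxy

theorem exists_simpleFunc_dist_lt {K : Set Plane} (hK : IsCompact K) {δ : ℝ} (hδ : 0 < δ) :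
    ∃ q : SimpleFunc Plane Plane, ∀ y ∈ K, dist (q y) y < δ := by
  obtain ⟨t, ht⟩ := hK.elim_finite_subcover
    (fun n : ℕ => Metric.ball (TopologicalSpace.denseSeq Plane n) δ)
    (fun n => Metric.isOpen_ball) fun y _ => by
      obtain ⟨n, hn⟩ := (TopologicalSpace.denseRange_denseSeq Plane).exists_dist_lt y hδ
      exact Set.mem_iUnion.2 ⟨n, hn⟩
  refine ⟨SimpleFunc.nearestPt (TopologicalSpace.denseSeq Plane) (t.sup id), fun y hy => ?_⟩
  obtain ⟨n, hn, hyn⟩ := Set.mem_iUnion₂.1 (ht hy)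
  have h1 := SimpleFunc.edist_nearestPt_le (TopologicalSpace.denseSeq Plane) y
    (Finset.le_sup (f := id) hn)
  rw [edist_dist, edist_dist, ENNReal.ofReal_le_ofReal_iff dist_nonneg] at h1
  refine h1.trans_lt ?_
  rw [dist_comm]
  exact hyn

/-- The regularized kernel is uniformly continuous in the second variable. -/
theorem exists_abs_npReg_sub_le {K : Set Plane} (hK : Bornology.IsBounded K) {ε η : ℝ}
    (hε : 0 < ε) (hη : 0 < η) :
    ∃ δ : ℝ, 0 < δ ∧ ∀ x ∈ K, ∀ y ∈ K, ∀ z, dist z y < δ →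
      |npReg D ε x y - npReg D ε x z| ≤ η := by
  obtain ⟨R, hR⟩ := hK.exists_norm_le
  have hG : Continuous fun w : Plane => (‖w‖ ^ 2 + ε ^ 2)⁻¹ • w := by
    have h0 : Continuous fun w : Plane => ‖w‖ ^ 2 + ε ^ 2 := by fun_prop
    exact (h0.inv₀ fun w => by positivity).smul continuous_id
  have huc := (isCompact_closedBall (0 : Plane) (2 * |R| + 1)).uniformContinuousOn_of_continuous
    hG.continuousOn
  obtain ⟨δ, hδ, h⟩ := Metric.uniformContinuousOn_iff.1 huc η hη
  refine ⟨min δ 1, by positivity, fun x hx y hy z hz => ?_⟩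
  have h1 : x - y ∈ Metric.closedBall (0 : Plane) (2 * |R| + 1) := by
    rw [mem_closedBall_zero_iff]
    linarith [norm_sub_le x y, hR x hx, hR y hy, le_abs_self R]
  have hzy : ‖z - y‖ < 1 := by rw [← dist_eq_norm]; exact hz.trans_le (min_le_right _ _)
  have h2 : x - z ∈ Metric.closedBall (0 : Plane) (2 * |R| + 1) := by
    rw [mem_closedBall_zero_iff]
    have : x - z = (x - y) - (z - y) := by abel
    rw [this]
    linarith [norm_sub_le (x - y) (z - y), norm_sub_le x y, hR x hx, hR y hy, le_abs_self R]
  have h3 := h _ h1 _ h2 (by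
    rw [dist_sub_left, dist_comm]
    exact hz.trans_le (min_le_left _ _))
  have heq : npReg D ε x y - npReg D ε x z = 1 / (2 * Real.pi) *
      inner ℝ ((‖x - y‖ ^ 2 + ε ^ 2)⁻¹ • (x - y) - (‖x - z‖ ^ 2 + ε ^ 2)⁻¹ • (x - z))
        (normal D x) := by
    rw [npReg, npReg, inner_sub_left (_ • _), real_inner_smul_left, real_inner_smul_left]
    ring
  have hpi : 1 / (2 * Real.pi) ≤ 1 := by
    rw [div_le_one (by positivity)]
    linarith [Real.pi_gt_three]
  rw [heq, abs_mul, abs_of_pos (by positivity : 0 < 1 / (2 * Real.pi))]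
  rw [dist_eq_norm] at h3
  calc _ ≤ 1 * (‖(‖x - y‖ ^ 2 + ε ^ 2)⁻¹ • (x - y) - (‖x - z‖ ^ 2 + ε ^ 2)⁻¹ • (x - z)‖ *
        ‖normal D x‖) := by
        gcongr
        exact abs_real_inner_le_norm _ _
    _ ≤ 1 * (η * 1) := by
        gcongr
        exact norm_normal_le D x
    _ = η := by ring

/-- The approximating kernel is the regularized one with y rounded by a simple function `q`.
Regularizing costs a small multiple of the weakly singular power; rounding costs a small constant,
by uniform continuity. -/
theorem IsC1HolderDomain.isCompactOperator_of_isNPOperator (hD : IsC1HolderDomain a D)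
    (ha : 0 < a) (ha1 : a ≤ 1) {T : L2 D →L[ℂ] L2 D} (hT : IsNPOperator D T) :
    IsCompactOperator T := by
  have := hD.isFiniteMeasure_bdry ha
  have ha' : (0 : ℝ) < a := by exact_mod_cast ha
  obtain ⟨M, hMpos, hM0, hM⟩ := hD.exists_lintegral_rpow_le ha (half_exponent_pos ha1)
    (half_exponent_lt_one ha)
  obtain ⟨C, hC0, -, hC⟩ := hD.exists_npKernel_bound ha1
  obtain ⟨C₁, hk⟩ := hD.exists_isSchurKernel_npKernel ha ha1
  refine isCompactOperator_of_kernel_approx hk hT fun η hη => ?_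
  -- The Schur constant is (c + d)M, so the singular and the constant part of the error each get
  -- η/(2M).
  have hη' : (0 : ℝ) < η / (2 * M) := by positivity
  obtain ⟨ε, hε, hεC⟩ : ∃ ε : ℝ, 0 < ε ∧ C * ε ^ ((a : ℝ) / 2) ≤ η / (2 * M) := by
    have hlim : Tendsto (fun ε : ℝ => C * ε ^ ((a : ℝ) / 2)) (𝓝[>] 0) (𝓝 0) := by
      have h1 : Tendsto (fun ε : ℝ => ε ^ ((a : ℝ) / 2)) (𝓝 0) (𝓝 0) := by
        have := (Real.continuousAt_rpow_const 0 ((a : ℝ) / 2) (Or.inr (by positivity))).tendsto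
        rwa [Real.zero_rpow (by positivity)] at this
      simpa using (h1.mono_left nhdsWithin_le_nhds).const_mul C
    obtain ⟨ε, h1, h2⟩ := ((hlim.eventually (ge_mem_nhds hη')).and self_mem_nhdsWithin).exists
    exact ⟨ε, h2, h1⟩
  obtain ⟨δ, hδ, hδ'⟩ := exists_abs_npReg_sub_le (D := D) hD.isCompact_frontier.isBounded hε hη'
  obtain ⟨q, hq⟩ := exists_simpleFunc_dist_lt hD.isCompact_frontier hδ
  refine ⟨q, npReg D ε, hD.aestronglyMeasurable_npReg_left ha ε, fun z => ?_, ?_⟩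
  · exact ⟨1 / (2 * Real.pi) * (1 / ε), Eventually.of_forall fun x => abs_npReg_le_inv D hε x z⟩
  · have hS := isSchurKernel_of_rpow_bound (D := D) (M := M) (c := η / (2 * M)) (d := η / (2 * M))
      (s := 1 - (a : ℝ) / 2) (k := fun x y => npKernel D x y - npReg D ε x (q y)) hη'.le
      hM0 hM ?_ ?_
    · have hval : ((η / (2 * M) : ℝ).toNNReal + (η / (2 * M) : ℝ).toNNReal) * M = η := by
        rw [← NNReal.coe_inj]
        push_cast
        rw [Real.coe_toNNReal _ hη'.le]
        have : (M : ℝ) ≠ 0 := by positivity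
        field_simp
        ring
      rwa [hval] at hS
    · exact hk.meas.sub (hD.aestronglyMeasurable_npReg_comp ha ε q.measurable)
    · intro x hx y hy hxy
      have h1 := hC ε hε x hx y hy hxy
      have h2 := hδ' x hx y hy (q y) (hq y hy)
      calc |npKernel D x y - npReg D ε x (q y)|
          = |(npKernel D x y - npReg D ε x y) + (npReg D ε x y - npReg D ε x (q y))| := by
            congr 1; ring
        _ ≤ _ := abs_add_le _ _
        _ ≤ _ := add_le_add (h1.trans (by gcongr)) h2

/-- The kernel of the single layer potential. -/
def logKernel (x y : Plane) : ℝ := 1 / (2 * Real.pi) * Real.log ‖x - y‖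

theorem measurable_logKernel : Measurable (Function.uncurry logKernel) := by
  unfold logKernel Function.uncurry
  fun_prop

theorem abs_log_le {r R s : ℝ} (hr : 0 < r) (hrR : r ≤ R) (hs : 0 < s) :
    |Real.log r| ≤ s⁻¹ * r ^ (-s) + R := by
  have hR : 0 < R := hr.trans_le hrR
  rcases le_total r 1 with h | h
  · rw [abs_of_nonpos (Real.log_nonpos hr.le h), ← Real.log_inv]
    have := Real.log_le_rpow_div (inv_nonneg.2 hr.le) hs
    rw [Real.inv_rpow hr.le, ← Real.rpow_neg hr.le, div_eq_inv_mul] at this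
    linarith
  · rw [abs_of_nonneg (Real.log_nonneg h)]
    have := Real.log_le_sub_one_of_pos hr
    have h2 : 0 ≤ s⁻¹ * r ^ (-s) := by positivity
    linarith

theorem IsC1HolderDomain.exists_isSchurKernel_logKernel (hD : IsC1HolderDomain a D) (ha : 0 < a) :
    ∃ C, IsSchurKernel (bdry D) logKernel C := by
  have := hD.isFiniteMeasure_bdry ha
  obtain ⟨M, hMpos, hM0, hM⟩ := hD.exists_lintegral_rpow_le ha (s := 1 / 2) (by norm_num)
    (by norm_num)
  obtain ⟨R, hR⟩ := hD.isCompact_frontier.isBounded.exists_norm_le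
  refine ⟨_, isSchurKernel_of_rpow_bound (c := (1 / 2)⁻¹) (d := 2 * R) (by norm_num) hM0 hM
    measurable_logKernel.aestronglyMeasurable fun x hx y hy hxy => ?_⟩
  have hpos : 0 < ‖x - y‖ := norm_pos_iff.2 (sub_ne_zero.2 hxy)
  have hpi : 1 / (2 * Real.pi) ≤ 1 := by
    rw [div_le_one (by positivity)]
    linarith [Real.pi_gt_three]
  rw [logKernel, abs_mul, abs_of_pos (by positivity : 0 < 1 / (2 * Real.pi))]
  refine (mul_le_of_le_one_left (abs_nonneg _) hpi).trans (abs_log_le hpos ?_ (by norm_num))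
  linarith [norm_sub_le x y, hR x hx, hR y hy]

end Kernels

/-! ### An approximate identity at a boundary point -/

section HalfDensity

variable {D : Set Plane}

/-- The Laplacian of `(1 / 4π) log (‖w‖² + ε²)`, an approximate identity. -/
def regDelta (ε : ℝ) (w : Plane) : ℝ := ε ^ 2 / (Real.pi * (‖w‖ ^ 2 + ε ^ 2) ^ 2)

theorem regDelta_nonneg (ε : ℝ) (w : Plane) : 0 ≤ regDelta ε w := by
  have := Real.pi_pos
  unfold regDelta
  positivity

theorem regDelta_neg (ε : ℝ) (w : Plane) : regDelta ε (-w) = regDelta ε w := by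
  simp [regDelta]

theorem continuous_regDelta {ε : ℝ} (hε : 0 < ε) : Continuous (regDelta ε) := by
  have h : Continuous fun w : Plane => Real.pi * (‖w‖ ^ 2 + ε ^ 2) ^ 2 := by fun_prop
  exact continuous_const.div h fun w => by have := Real.pi_pos; positivity

theorem regDelta_smul {ε : ℝ} (hε : 0 < ε) (w : Plane) :
    regDelta ε (ε • w) = (ε ^ 2)⁻¹ * regDelta 1 w := by
  have := Real.pi_pos
  rw [regDelta, regDelta, norm_smul, Real.norm_of_nonneg hε.le]
  field_simp

theorem integrable_regDelta_one : Integrable (regDelta 1) := by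
  have h := integrable_rpow_neg_one_add_norm_sq (E := Plane) (μ := volume) (r := 4)
    (by rw [finrank_euclideanSpace_fin]; norm_num)
  refine (h.const_mul Real.pi⁻¹).congr (Eventually.of_forall fun w => ?_)
  have h1 : (0 : ℝ) ≤ 1 + ‖w‖ ^ 2 := by positivity
  simp only [regDelta]
  rw [show (-4 / 2 : ℝ) = -((2 : ℕ) : ℝ) by norm_num, Real.rpow_neg h1, Real.rpow_natCast]
  rw [one_pow, one_div, mul_inv, add_comm]

/-- In polar coordinates the radial integrand has the primitive -1/(2π(r² + 1)). -/
theorem integral_regDelta_one : ∫ w : Plane, regDelta 1 w = 1 := by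
  have h := integral_fun_norm_addHaar (volume : Measure Plane)
    (fun r : ℝ => 1 / (Real.pi * (r ^ 2 + 1) ^ 2))
  have hv : (volume : Measure Plane).real (Metric.ball 0 1) = Real.pi := by
    rw [measureReal_def, EuclideanSpace.volume_ball_fin_two]
    simp [Real.pi_pos.le]
  have hd : ∀ x ∈ Set.Ici (0 : ℝ), HasDerivAt (fun r : ℝ => -(2 * Real.pi * (r ^ 2 + 1))⁻¹)
      (x * (1 / (Real.pi * (x ^ 2 + 1) ^ 2))) x := by
    intro x _
    have h0 : HasDerivAt (fun r : ℝ => 2 * Real.pi * (r ^ 2 + 1)) (2 * Real.pi * (2 * x)) x := by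
      simpa using (((hasDerivAt_id x).pow 2).add_const 1).const_mul (2 * Real.pi)
    have hpi := Real.pi_pos
    refine ((h0.inv (by positivity)).neg).congr_deriv ?_
    field_simp
  have hlim : Tendsto (fun r : ℝ => -(2 * Real.pi * (r ^ 2 + 1))⁻¹) atTop (𝓝 (-0)) := by
    refine (tendsto_inv_atTop_zero.comp ?_).neg
    refine Tendsto.const_mul_atTop (by positivity) ?_
    exact tendsto_atTop_add_const_right _ _ (tendsto_pow_atTop two_ne_zero)
  have hint := integrableOn_Ioi_deriv_of_nonneg' hd
    (fun x hx => by have := Real.pi_pos; have : (0 : ℝ) < x := hx; positivity) hlim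
  have hI := integral_Ioi_of_hasDerivAt_of_tendsto' hd hint hlim
  have hI' : ∫ y in Set.Ioi (0 : ℝ), y ^ (Module.finrank ℝ Plane - 1) •
      (1 / (Real.pi * (y ^ 2 + 1) ^ 2)) = (2 * Real.pi)⁻¹ := by
    rw [finrank_euclideanSpace_fin]
    simpa using hI
  rw [hI', hv, finrank_euclideanSpace_fin] at h
  calc ∫ w : Plane, regDelta 1 w = ∫ w : Plane, 1 / (Real.pi * (‖w‖ ^ 2 + 1) ^ 2) := by
        simp [regDelta]
    _ = 1 := by
        rw [h]
        have := Real.pi_pos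
        simp

theorem setIntegral_regDelta_mul (hD : MeasurableSet D) {ε : ℝ} (hε : 0 < ε) (p : Plane)
    (h : Plane → ℂ) :
    ∫ z in D, (regDelta ε (z - p) : ℂ) * h z =
      ∫ w, (regDelta 1 w : ℂ) * D.indicator h (p + ε • w) := by
  have h1 := Measure.integral_comp_smul (volume : Measure Plane)
    (fun w => (regDelta ε w : ℂ) * D.indicator h (p + w)) ε
  rw [finrank_euclideanSpace_fin, abs_of_pos (by positivity)] at h1
  have h2 : ∫ w, (regDelta ε w : ℂ) * D.indicator h (p + w) =
      ∫ z in D, (regDelta ε (z - p) : ℂ) * h z := by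
    rw [← integral_sub_right_eq_self _ p, ← integral_indicator hD]
    refine integral_congr_ae (Eventually.of_forall fun z => ?_)
    by_cases hz : z ∈ D <;> simp [hz]
  rw [h2] at h1
  have h3 : ∫ w, (regDelta ε (ε • w) : ℂ) * D.indicator h (p + ε • w) =
      ((ε ^ 2)⁻¹ : ℝ) • ∫ w, (regDelta 1 w : ℂ) * D.indicator h (p + ε • w) := by
    rw [← integral_smul]
    refine integral_congr_ae (Eventually.of_forall fun w => ?_)
    simp only [regDelta_smul hε, Complex.real_smul]
    push_cast
    ring
  rw [h3] at h1
  exact (smul_right_injective ℂ (by positivity : ((ε ^ 2)⁻¹ : ℝ) ≠ 0) h1).symm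

theorem norm_setIntegral_regDelta_mul_le (hD : MeasurableSet D) {ε : ℝ} (hε : 0 < ε) (p : Plane)
    {h : Plane → ℂ} {C : ℝ} (hC0 : 0 ≤ C) (hC : ∀ z ∈ D, ‖h z‖ ≤ C) :
    ‖∫ z in D, (regDelta ε (z - p) : ℂ) * h z‖ ≤ C := by
  rw [setIntegral_regDelta_mul hD hε]
  calc _ ≤ ∫ w : Plane, regDelta 1 w * C := by
        refine norm_integral_le_of_norm_le (integrable_regDelta_one.mul_const C)
          (Eventually.of_forall fun w => ?_)
        rw [norm_mul, Complex.norm_real, Real.norm_of_nonneg (regDelta_nonneg _ _)]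
        refine mul_le_mul_of_nonneg_left ?_ (regDelta_nonneg _ _)
        by_cases hz : p + ε • w ∈ D
        · simpa [hz] using hC _ hz
        · simpa [hz] using hC0
    _ = C := by rw [integral_mul_const, integral_regDelta_one, one_mul]

theorem ae_inner_ne_zero {v : Plane} (hv : v ≠ 0) : ∀ᵐ w : Plane, inner ℝ w v ≠ 0 := by
  have h : volume ((ℝ ∙ v)ᗮ : Set Plane) = 0 := by
    refine Measure.addHaar_submodule _ _ fun htop => hv ?_
    have : v ∈ (ℝ ∙ v)ᗮ := by rw [htop]; trivial
    rw [Submodule.mem_orthogonal_singleton_iff_inner_right] at this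
    exact inner_self_eq_zero.1 this
  rw [ae_iff]
  refine measure_mono_null (fun w hw => ?_) h
  simp only [ne_eq, not_not, Set.mem_ofPred_eq] at hw
  exact (Submodule.mem_orthogonal_singleton_iff_inner_left).2 hw

/-- The reflection w ↦ -w preserves the radial weight and exchanges the two half planes; the line
between them is null. -/
theorem integral_regDelta_half {v : Plane} (hv : v ≠ 0) (c : ℂ) :
    ∫ w : Plane, (regDelta 1 w : ℂ) * (if inner ℝ w v < 0 then c else 0) = c / 2 := by
  have hint : Integrable fun w : Plane => (regDelta 1 w : ℂ) * (if inner ℝ w v < 0 then c else 0) := by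
    refine (integrable_regDelta_one.ofReal).mul_bdd (c := ‖c‖) ?_ (Eventually.of_forall fun w => ?_)
    · refine (Measurable.ite ?_ measurable_const measurable_const).aestronglyMeasurable
      exact measurableSet_lt (by fun_prop) measurable_const
    · split_ifs <;> simp
  have h1 : ∫ w : Plane, (regDelta 1 w : ℂ) * (if inner ℝ w v < 0 then c else 0) =
      ∫ w : Plane, (regDelta 1 w : ℂ) * (if inner ℝ (-w) v < 0 then c else 0) := by
    rw [← integral_neg_eq_self]
    simp only [regDelta_neg]
  have hint' : Integrable fun w : Plane =>
      (regDelta 1 w : ℂ) * (if inner ℝ (-w) v < 0 then c else 0) := by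
    simpa only [regDelta_neg] using hint.comp_neg
  have h2 : (∫ w : Plane, (regDelta 1 w : ℂ) * (if inner ℝ w v < 0 then c else 0)) +
      ∫ w : Plane, (regDelta 1 w : ℂ) * (if inner ℝ (-w) v < 0 then c else 0) = c := by
    rw [← integral_add hint hint']
    calc _ = ∫ w : Plane, (regDelta 1 w : ℂ) * c := by
          refine integral_congr_ae ?_
          filter_upwards [ae_inner_ne_zero hv] with w hw
          rcases lt_or_gt_of_ne hw with h | h
          · simp [h, not_lt.2 h.le]
          · simp [h, not_lt.2 h.le]
      _ = c := by
          rw [integral_mul_const, integral_complex_ofReal, integral_regDelta_one]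
          simp
  rw [← h1] at h2
  linear_combination h2 / 2

/-- Blowing up at p turns D into the half plane ⟨w, v⟩ < 0. Off its edge, the point p + εw is
eventually on the side given by the sign of ⟨w, v⟩. -/
theorem IsOutwardNormal.tendsto_indicator {p v w : Plane} (hv : IsOutwardNormal D p v)
    (hw : inner ℝ w v ≠ 0) {h : ℝ → Plane → ℂ} {c : ℂ}
    (hc : Tendsto (fun ε => h ε (p + ε • w)) (𝓝[>] 0) (𝓝 c)) :
    Tendsto (fun ε : ℝ => D.indicator (h ε) (p + ε • w)) (𝓝[>] 0)
      (𝓝 (if inner ℝ w v < 0 then c else 0)) := by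
  have hlim : Tendsto (fun ε : ℝ => p + ε • w) (𝓝[>] 0) (𝓝 p) := by
    have : Continuous fun ε : ℝ => p + ε • w := by fun_prop
    simpa using (this.tendsto 0).mono_left nhdsWithin_le_nhds
  -- Chosen so that the error η‖w‖ in the definition of the normal stays below |⟨w, v⟩|.
  have hη : 0 < |(inner ℝ w v : ℝ)| / (2 * (‖w‖ + 1)) := by positivity
  have key : |(inner ℝ w v : ℝ)| / (2 * (‖w‖ + 1)) * ‖w‖ < |(inner ℝ w v : ℝ)| := by
    have h0 : 0 < |(inner ℝ w v : ℝ)| := abs_pos.2 hw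
    rw [div_mul_eq_mul_div, div_lt_iff₀ (by positivity)]
    nlinarith [norm_nonneg w]
  have hev := (hlim.eventually (hv.2 _ hη)).and self_mem_nhdsWithin
  split_ifs with hs
  · refine hc.congr' ?_
    filter_upwards [hev] with ε hε
    obtain ⟨⟨-, h2⟩, hε0⟩ := hε
    have hε0 : 0 < ε := hε0
    rw [Set.indicator_of_mem]
    by_contra hmem
    have h3 := h2 hmem
    rw [add_sub_cancel_left, real_inner_smul_left, norm_smul, Real.norm_of_nonneg hε0.le] at h3
    rw [abs_of_neg hs] at h3 key
    nlinarith
  · have hs' : 0 < (inner ℝ w v : ℝ) := lt_of_le_of_ne (not_lt.1 hs) (Ne.symm hw)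
    refine tendsto_const_nhds.congr' ?_
    filter_upwards [hev] with ε hε
    obtain ⟨⟨h2, -⟩, hε0⟩ := hε
    have hε0 : 0 < ε := hε0
    rw [Set.indicator_of_notMem]
    intro hmem
    have h3 := h2 hmem
    rw [add_sub_cancel_left, real_inner_smul_left, norm_smul, Real.norm_of_nonneg hε0.le] at h3
    rw [abs_of_pos hs'] at h3 key
    nlinarith

/-- At a boundary point with a normal, half of the mass of the approximate identity lies in `D`. -/
theorem IsOutwardNormal.tendsto_setIntegral_regDelta {p v : Plane} (hv : IsOutwardNormal D p v)
    (hD : MeasurableSet D) {h : ℝ → Plane → ℂ} {c : ℂ} {C : ℝ} (hC0 : 0 ≤ C)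
    (hm : ∀ᶠ ε in 𝓝[>] (0 : ℝ), Measurable (h ε))
    (hC : ∀ᶠ ε in 𝓝[>] (0 : ℝ), ∀ z ∈ D, ‖h ε z‖ ≤ C)
    (hc : ∀ w, Tendsto (fun ε => h ε (p + ε • w)) (𝓝[>] 0) (𝓝 c)) :
    Tendsto (fun ε : ℝ => ∫ z in D, (regDelta ε (z - p) : ℂ) * h ε z) (𝓝[>] 0) (𝓝 (c / 2)) := by
  have hv0 : v ≠ 0 := by
    rintro rfl
    simpa using hv.1
  rw [← integral_regDelta_half hv0 c]
  have hcongr : (fun ε : ℝ => ∫ w, (regDelta 1 w : ℂ) * D.indicator (h ε) (p + ε • w)) =ᶠ[𝓝[>] 0]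
      fun ε : ℝ => ∫ z in D, (regDelta ε (z - p) : ℂ) * h ε z := by
    filter_upwards [self_mem_nhdsWithin] with ε hε
    exact (setIntegral_regDelta_mul hD hε p (h ε)).symm
  refine Tendsto.congr' hcongr ?_
  refine tendsto_integral_filter_of_dominated_convergence (fun w => regDelta 1 w * C) ?_ ?_
    (integrable_regDelta_one.mul_const C) ?_
  · filter_upwards [hm] with ε hε
    have h1 : Measurable fun w : Plane => D.indicator (h ε) (p + ε • w) :=
      (hε.indicator hD).comp (by fun_prop)
    have h2 : Measurable fun w : Plane => (regDelta 1 w : ℂ) :=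
      (Complex.continuous_ofReal.comp (continuous_regDelta one_pos)).measurable
    exact (h2.mul h1).aestronglyMeasurable
  · filter_upwards [hC] with ε hε
    refine Eventually.of_forall fun w => ?_
    rw [norm_mul, Complex.norm_real, Real.norm_of_nonneg (regDelta_nonneg _ _)]
    refine mul_le_mul_of_nonneg_left ?_ (regDelta_nonneg _ _)
    by_cases hz : p + ε • w ∈ D
    · simpa [hz] using hε _ hz
    · simpa [hz] using hC0
  · filter_upwards [ae_inner_ne_zero hv0] with w hw
    exact (hv.tendsto_indicator hw (hc w)).const_mul _

end HalfDensity

/-! ### Green's identities for regularized kernels; Gauss' lemma -/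

section Green

variable {a : ℝ≥0} {D : Set Plane}

/-- The regularized fundamental solution of the Laplacian. -/
def logReg (ε : ℝ) (w : Plane) : ℝ := 1 / (4 * Real.pi) * Real.log (‖w‖ ^ 2 + ε ^ 2)

theorem contDiff_logReg {ε : ℝ} (hε : 0 < ε) : ContDiff ℝ 1 (logReg ε) := by
  have h : ContDiff ℝ 1 fun w : Plane => ‖w‖ ^ 2 + ε ^ 2 :=
    (contDiff_norm_sq ℝ).add contDiff_const
  exact contDiff_const.mul (h.log fun w => by positivity)

theorem hasFDerivAt_norm_sub_sq_add (ε : ℝ) (y z : Plane) :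
    HasFDerivAt (fun z : Plane => ‖z - y‖ ^ 2 + ε ^ 2) (2 • innerSL ℝ (z - y)) z := by
  have h1 : HasFDerivAt (fun z : Plane => z - y) (ContinuousLinearMap.id ℝ Plane) z :=
    (hasFDerivAt_id z).sub_const y
  exact (h1.norm_sq.add_const _).congr_fderiv (by ext; simp)

theorem hasFDerivAt_logReg_sub {ε : ℝ} (hε : 0 < ε) (x z : Plane) :
    HasFDerivAt (fun z => logReg ε (z - x))
      ((1 / (2 * Real.pi * (‖z - x‖ ^ 2 + ε ^ 2))) • innerSL ℝ (z - x)) z := by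
  have hpi := Real.pi_pos
  refine (((hasFDerivAt_norm_sub_sq_add ε x z).log
    (by positivity)).const_mul (1 / (4 * Real.pi))).congr_fderiv ?_
  ext v
  simp
  field_simp
  ring

theorem fderiv_logReg_sub {ε : ℝ} (hε : 0 < ε) (x z v : Plane) :
    fderiv ℝ (fun z => logReg ε (z - x)) z v =
      inner ℝ (z - x) v / (2 * Real.pi * (‖z - x‖ ^ 2 + ε ^ 2)) := by
  rw [(hasFDerivAt_logReg_sub hε x z).fderiv, _root_.smul_apply, innerSL_apply_apply,
    smul_eq_mul]
  ring

theorem inner_plane (v w : Plane) : inner ℝ v w = v 0 * w 0 + v 1 * w 1 := by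
  simp [PiLp.inner_apply, Fin.sum_univ_two, mul_comm]

theorem norm_plane_sq (v : Plane) : ‖v‖ ^ 2 = v 0 ^ 2 + v 1 ^ 2 := by
  rw [← real_inner_self_eq_norm_sq, inner_plane]
  ring

/-- Green's first identity for the regularized fundamental solution. -/
theorem IsC1HolderDomain.integral_mul_npReg (hD : IsC1HolderDomain a D) (ha : 0 < a)
    {ε : ℝ} (hε : 0 < ε) {f : Plane → ℝ} (hf : ContDiff ℝ 1 f) (y : Plane) :
    ∫ z, f z * npReg D ε z y ∂(bdry D) =
      ∫ z in D, (fderiv ℝ f z (z - y) / (2 * Real.pi * (‖z - y‖ ^ 2 + ε ^ 2)) +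
        f z * regDelta ε (z - y)) := by
  have hpi := Real.pi_pos
  have hfin := hD.isFiniteMeasure_bdry ha
  set e : Fin 2 → Plane := fun k => EuclideanSpace.single k 1 with he
  -- The components of f times the gradient of the regularized logarithm at y; Gauss–Green is
  -- applied to each.
  set F : Fin 2 → Plane → ℝ := fun k z =>
    f z * ((z - y) k / (2 * Real.pi * (‖z - y‖ ^ 2 + ε ^ 2))) with hF
  have hFc : ∀ k, ContDiff ℝ 1 (F k) := by
    intro k
    have h1 : ContDiff ℝ 1 fun z : Plane => (z - y) k := by
      have : ContDiff ℝ 1 fun z : Plane => (EuclideanSpace.proj k : Plane →L[ℝ] ℝ) (z - y) := by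
        fun_prop
      exact this
    have h2 : ContDiff ℝ 1 fun z : Plane => 2 * Real.pi * (‖z - y‖ ^ 2 + ε ^ 2) :=
      contDiff_const.mul (((contDiff_id.sub contDiff_const).norm_sq ℝ).add contDiff_const)
    exact hf.mul (h1.div h2 fun z => by positivity)
  have hFd : ∀ k z, fderiv ℝ (F k) z (e k) =
      fderiv ℝ f z (e k) * ((z - y) k / (2 * Real.pi * (‖z - y‖ ^ 2 + ε ^ 2))) +
      f z * (1 / (2 * Real.pi * (‖z - y‖ ^ 2 + ε ^ 2)) -
        (z - y) k * (z - y) k / (Real.pi * (‖z - y‖ ^ 2 + ε ^ 2) ^ 2)) := by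
    intro k z
    have h1 : HasFDerivAt (fun z : Plane => (z - y) k) (EuclideanSpace.proj k : Plane →L[ℝ] ℝ) z :=
      ((EuclideanSpace.proj k : Plane →L[ℝ] ℝ).hasFDerivAt.comp z
        ((hasFDerivAt_id z).sub_const y) :)
    have h2 := (hasFDerivAt_norm_sub_sq_add ε y z).const_mul (2 * Real.pi)
    have h2' := h1.mul ((hasDerivAt_inv (by positivity)).comp_hasFDerivAt z h2)
    have h3 := ((hf.differentiable one_ne_zero z).hasFDerivAt.mul h2').fderiv
    have h4 : fderiv ℝ (F k) z = _ := h3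
    have hin : ∀ v : Plane, inner ℝ v (EuclideanSpace.single k (1 : ℝ)) = v k := by
      simp [EuclideanSpace.inner_single_right]
    rw [h4]
    simp [he, hin]
    field_simp
    ring
  have hGG := fun k => hD.integral_fderiv_eq ha (hFc k) (e k)
  have hint1 : ∀ k, IntegrableOn (fun z => fderiv ℝ (F k) z (e k)) D := fun k =>
    (((hFc k).continuous_fderiv one_ne_zero).clm_apply
      continuous_const).continuousOn.integrableOn_compact hD.isCompact_closure |>.mono_set
        subset_closure
  have hint2 : ∀ k, Integrable (fun z => F k z * inner ℝ (e k) (normal D z)) (bdry D) := by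
    intro k
    obtain ⟨B, hB⟩ := hD.isCompact_frontier.exists_bound_of_continuousOn
      (hFc k).continuous.continuousOn
    refine Integrable.of_bound ((hFc k).continuous.aestronglyMeasurable.mul
      (aestronglyMeasurable_const.inner (hD.aestronglyMeasurable_normal ha))) (B * 1) ?_
    filter_upwards [ae_mem_frontier D] with z hz
    rw [norm_mul]
    have : ‖(inner ℝ (e k) (normal D z) : ℝ)‖ ≤ 1 :=
      (norm_inner_le_norm _ _).trans (by simpa [he] using norm_normal_le D z)
    exact mul_le_mul (hB z hz) this (norm_nonneg _) ((norm_nonneg _).trans (hB z hz))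
  calc ∫ z, f z * npReg D ε z y ∂(bdry D)
      = ∫ z, (F 0 z * inner ℝ (e 0) (normal D z) + F 1 z * inner ℝ (e 1) (normal D z))
          ∂(bdry D) := by
        congr 1
        funext z
        simp only [hF, he, npReg, inner_plane]
        simp
        field_simp
    _ = ∫ z in D, (fderiv ℝ (F 0) z (e 0) + fderiv ℝ (F 1) z (e 1)) := by
        rw [integral_add (hint2 0) (hint2 1), integral_add (hint1 0) (hint1 1), hGG, hGG]
    _ = _ := by
        congr 1
        funext z
        have hdec : z - y = (z - y) 0 • e 0 + (z - y) 1 • e 1 := by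
          ext i
          fin_cases i <;> simp [he]
        have hlin : fderiv ℝ f z (z - y) =
            (z - y) 0 * fderiv ℝ f z (e 0) + (z - y) 1 * fderiv ℝ f z (e 1) := by
          conv_lhs => rw [hdec]
          rw [map_add, map_smul, map_smul, smul_eq_mul, smul_eq_mul]
        -- With q = ‖z - y‖² + ε², the divergence of the gradient field is 1/(πq) - ‖z - y‖²/(πq²) =
        -- ε²/(πq²), which is `regDelta`.
        have hq : 0 < ‖z - y‖ ^ 2 + ε ^ 2 := by positivity
        rw [hFd, hFd, hlin, regDelta]
        have hn := norm_plane_sq (z - y)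
        generalize (z - y) 0 = u at *
        generalize (z - y) 1 = v at *
        field_simp
        rw [show u ^ 2 = ‖z - y‖ ^ 2 - v ^ 2 by linarith]
        ring

theorem continuous_logReg {ε : ℝ} (hε : 0 < ε) : Continuous (logReg ε) :=
  (contDiff_logReg hε).continuous

theorem contDiff_logReg_sub {ε : ℝ} (hε : 0 < ε) (x : Plane) :
    ContDiff ℝ 1 fun z => logReg ε (z - x) :=
  (contDiff_logReg hε).comp (contDiff_id.sub contDiff_const)

/-- Green's second identity for the regularized fundamental solution, in symmetric form. -/
theorem IsC1HolderDomain.integral_logReg_mul_npReg_sub (hD : IsC1HolderDomain a D) (ha : 0 < a)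
    {ε : ℝ} (hε : 0 < ε) (x y : Plane) :
    (∫ z, logReg ε (z - x) * npReg D ε z y ∂(bdry D)) -
        ∫ z in D, logReg ε (z - x) * regDelta ε (z - y) =
      (∫ z, logReg ε (z - y) * npReg D ε z x ∂(bdry D)) -
        ∫ z in D, logReg ε (z - y) * regDelta ε (z - x) := by
  have hpi := Real.pi_pos
  have hcD : ∀ {f : Plane → ℝ}, Continuous f → IntegrableOn f D := fun hf =>
    (hf.continuousOn.integrableOn_compact hD.isCompact_closure).mono_set subset_closure
  -- Each side is the Dirichlet integral over D of two regularized logarithms, which is symmetric in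
  -- x and y.
  have key : ∀ x y : Plane, (∫ z, logReg ε (z - x) * npReg D ε z y ∂(bdry D)) -
      ∫ z in D, logReg ε (z - x) * regDelta ε (z - y) =
      ∫ z in D, inner ℝ (z - x) (z - y) / (2 * Real.pi * (‖z - x‖ ^ 2 + ε ^ 2)) /
        (2 * Real.pi * (‖z - y‖ ^ 2 + ε ^ 2)) := by
    intro x y
    have hc : ∀ w : Plane, Continuous fun z : Plane => 2 * Real.pi * (‖z - w‖ ^ 2 + ε ^ 2) := by
      intro w; fun_prop
    have h1 : Continuous fun z : Plane => inner ℝ (z - x) (z - y) /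
        (2 * Real.pi * (‖z - x‖ ^ 2 + ε ^ 2)) / (2 * Real.pi * (‖z - y‖ ^ 2 + ε ^ 2)) :=
      (Continuous.div (by fun_prop) (hc x) fun z => by positivity).div (hc y)
        fun z => by positivity
    have h2 : Continuous fun z : Plane => logReg ε (z - x) * regDelta ε (z - y) :=
      ((continuous_logReg hε).comp (continuous_id.sub continuous_const)).mul
        ((continuous_regDelta hε).comp (continuous_id.sub continuous_const))
    rw [hD.integral_mul_npReg ha hε (contDiff_logReg_sub hε x)]
    simp only [fderiv_logReg_sub hε]
    rw [integral_add (hcD h1) (hcD h2), add_sub_cancel_right]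
  rw [key, key]
  congr 1
  funext z
  rw [real_inner_comm]
  ring

theorem IsC1HolderDomain.integral_npReg (hD : IsC1HolderDomain a D) (ha : 0 < a)
    {ε : ℝ} (hε : 0 < ε) (y : Plane) :
    ∫ z, npReg D ε z y ∂(bdry D) = ∫ z in D, regDelta ε (z - y) := by
  simpa using hD.integral_mul_npReg ha hε (f := fun _ => 1) contDiff_const y

theorem tendsto_npReg (D : Set Plane) (x y : Plane) :
    Tendsto (fun ε => npReg D ε x y) (𝓝[>] 0) (𝓝 (npKernel D x y)) := by
  rcases eq_or_ne x y with rfl | hxy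
  · simp [npReg, npKernel]
  have hpos : 0 < ‖x - y‖ := norm_pos_iff.2 (sub_ne_zero.2 hxy)
  rw [← npReg_zero]
  refine Tendsto.mono_left (ContinuousAt.tendsto ?_) nhdsWithin_le_nhds
  unfold npReg
  refine continuousAt_const.mul (continuousAt_const.div (by fun_prop) ?_)
  positivity

theorem IsC1HolderDomain.aestronglyMeasurable_npKernel_left (hD : IsC1HolderDomain a D)
    (ha : 0 < a) (z : Plane) : AEStronglyMeasurable (fun x => npKernel D x z) (bdry D) := by
  simpa [npReg_zero] using hD.aestronglyMeasurable_npReg_left ha 0 z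

theorem IsC1HolderDomain.integrable_npKernel_left (hD : IsC1HolderDomain a D) (ha : 0 < a)
    (ha1 : a ≤ 1) {y : Plane} (hy : y ∈ frontier D) :
    Integrable (fun x => npKernel D x y) (bdry D) := by
  obtain ⟨M, -, hM0, hM⟩ := hD.exists_lintegral_rpow_le ha (half_exponent_pos ha1)
    (half_exponent_lt_one ha)
  obtain ⟨C, hC0, hC, -⟩ := hD.exists_npKernel_bound ha1
  refine ⟨hD.aestronglyMeasurable_npKernel_left ha y, ?_⟩
  refine (lintegral_enorm_le_of_rpow_bound (d := 0) hC0 (hM y) hM0 ?_).trans_lt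
    ENNReal.coe_lt_top
  filter_upwards [ae_mem_frontier D, ae_ne D y] with x hx hxy
  rw [norm_sub_rev, add_zero]
  exact hC x hx y hy hxy

/-- Gauss' lemma: the constant function `1` is an eigenfunction of the adjoint. -/
theorem IsC1HolderDomain.integral_npKernel (hD : IsC1HolderDomain a D) (ha : 0 < a)
    (ha1 : a ≤ 1) {y : Plane} (hy : y ∈ frontier D) :
    ∫ x, npKernel D x y ∂(bdry D) = 1 / 2 := by
  have h1 : Tendsto (fun ε => ∫ x, npReg D ε x y ∂(bdry D)) (𝓝[>] 0)
      (𝓝 (∫ x, npKernel D x y ∂(bdry D))) := by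
    refine tendsto_integral_filter_of_dominated_convergence (fun x => ‖npKernel D x y‖) ?_ ?_
      (hD.integrable_npKernel_left ha ha1 hy).norm (Eventually.of_forall fun x => tendsto_npReg D x y)
    · exact Eventually.of_forall fun ε => hD.aestronglyMeasurable_npReg_left ha ε y
    · exact Eventually.of_forall fun ε => Eventually.of_forall fun x => abs_npReg_le D ε x y
  -- The value 1/2 is the share of the approximate identity lying in D.
  have h2 : Tendsto (fun ε : ℝ => ∫ z in D, (regDelta ε (z - y) : ℂ) * (1 : ℂ)) (𝓝[>] 0)
      (𝓝 (1 / 2)) :=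
    (hD.exists_isOutwardNormal hy).tendsto_setIntegral_regDelta (h := fun _ _ => 1)
      hD.isOpen.measurableSet (C := 1)
      zero_le_one (Eventually.of_forall fun _ => measurable_const)
      (Eventually.of_forall fun _ _ _ => by simp) fun _ => tendsto_const_nhds
  have h3 := (Complex.continuous_ofReal.tendsto _).comp h1
  refine Complex.ofReal_injective ?_
  push_cast
  refine tendsto_nhds_unique h3 (h2.congr' ?_)
  filter_upwards [self_mem_nhdsWithin] with ε hε
  simp only [mul_one, Function.comp_apply]
  rw [hD.integral_npReg ha hε, integral_complex_ofReal]

theorem IsC1HolderDomain.memLp_one (hD : IsC1HolderDomain a D) (ha : 0 < a) :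
    MemLp (fun _ : Plane => (1 : ℂ)) 2 (bdry D) := by
  have := hD.isFiniteMeasure_bdry ha
  exact memLp_const 1

/-- Fubini and Gauss' lemma. This makes the mean a left eigenvector for 1/2. -/
theorem IsC1HolderDomain.integral_npOp (hD : IsC1HolderDomain a D) (ha : 0 < a)
    (ha1 : a ≤ 1) {T : L2 D →L[ℂ] L2 D} (hT : IsNPOperator D T) (φ : L2 D) :
    ∫ x, T φ x ∂(bdry D) = 1 / 2 * ∫ x, φ x ∂(bdry D) := by
  have := hD.isFiniteMeasure_bdry ha
  obtain ⟨C, hk⟩ := hD.exists_isSchurKernel_npKernel ha ha1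
  have hint := hk.integrable_prod (Lp.memLp φ) (hD.memLp_one ha)
  simp only [one_mul] at hint
  rw [integral_congr_ae (hT φ), integral_integral_swap hint, ← integral_const_mul]
  refine integral_congr_ae ?_
  filter_upwards [ae_mem_frontier D] with y hy
  rw [integral_mul_const, integral_complex_ofReal, hD.integral_npKernel ha ha1 hy]
  push_cast
  rfl

theorem IsC1HolderDomain.memLp_normal (hD : IsC1HolderDomain a D) (ha : 0 < a) (l : Fin 2) :
    MemLp (fun x => (normal D x l : ℂ)) 2 (bdry D) := by
  have := hD.isFiniteMeasure_bdry ha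
  refine MemLp.of_bound ?_ 1 (Eventually.of_forall fun x => ?_)
  · exact Complex.continuous_ofReal.comp_aestronglyMeasurable
      ((EuclideanSpace.proj l : Plane →L[ℝ] ℝ).continuous.comp_aestronglyMeasurable
        (hD.aestronglyMeasurable_normal ha))
  · rw [Complex.norm_real]
    exact (PiLp.norm_apply_le _ l).trans (norm_normal_le D x)

theorem IsC1HolderDomain.normalL2_ae (hD : IsC1HolderDomain a D) (ha : 0 < a) (l : Fin 2) :
    normalL2 D l =ᵐ[bdry D] fun x => (normal D x l : ℂ) := by
  rw [normalL2, toL2, dif_pos (hD.memLp_normal ha l)]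
  exact MemLp.coeFn_toLp _

/-- Gauss–Green for the constant function 1. -/
theorem IsC1HolderDomain.integral_normalL2 (hD : IsC1HolderDomain a D) (ha : 0 < a) (l : Fin 2) :
    ∫ x, normalL2 D l x ∂(bdry D) = 0 := by
  rw [integral_congr_ae (hD.normalL2_ae ha l), integral_complex_ofReal]
  have h := hD.integral_fderiv_eq ha (f := fun _ => 1) contDiff_const (EuclideanSpace.single l 1)
  have hin : ∀ v : Plane, inner ℝ (EuclideanSpace.single l (1 : ℝ)) v = v l := by
    simp [EuclideanSpace.inner_single_left]
  simp only [hin, one_mul] at h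
  rw [← h]
  simp

end Green

/-! ### A Fubini identity for products of integrals -/

section Fubini

variable {X Z : Type*} [MeasurableSpace X] [MeasurableSpace Z] {ν : Measure Z} {μ : Measure X}

theorem integral_mul_integral_swap [IsFiniteMeasure ν] [IsFiniteMeasure μ] {A B : Z → X → ℂ}
    {CA CB : ℝ}
    (hA : AEStronglyMeasurable (Function.uncurry A) (ν.prod μ))
    (hB : AEStronglyMeasurable (Function.uncurry B) (ν.prod μ))
    (hA' : ∀ᵐ p ∂(ν.prod μ), ‖A p.1 p.2‖ ≤ CA) (hB' : ∀ᵐ p ∂(ν.prod μ), ‖B p.1 p.2‖ ≤ CB) :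
    Integrable (fun p : X × X => ∫ z, A z p.1 * B z p.2 ∂ν) (μ.prod μ) ∧
      ∫ z, (∫ x, A z x ∂μ) * (∫ y, B z y ∂μ) ∂ν =
        ∫ p : X × X, ∫ z, A z p.1 * B z p.2 ∂ν ∂(μ.prod μ) := by
  have q1 : Measure.QuasiMeasurePreserving (Prod.map id Prod.fst : Z × (X × X) → Z × X)
      (ν.prod (μ.prod μ)) (ν.prod μ) :=
    QuasiMeasurePreserving.prodMap (Measure.QuasiMeasurePreserving.id ν)
      Measure.quasiMeasurePreserving_fst
  have q2 : Measure.QuasiMeasurePreserving (Prod.map id Prod.snd : Z × (X × X) → Z × X)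
      (ν.prod (μ.prod μ)) (ν.prod μ) :=
    QuasiMeasurePreserving.prodMap (Measure.QuasiMeasurePreserving.id ν)
      Measure.quasiMeasurePreserving_snd
  have hint : Integrable (Function.uncurry fun z (p : X × X) => A z p.1 * B z p.2)
      (ν.prod (μ.prod μ)) := by
    refine Integrable.of_bound ((hA.comp_quasiMeasurePreserving q1).mul
      (hB.comp_quasiMeasurePreserving q2)) (CA * CB) ?_
    filter_upwards [q1.ae hA', q2.ae hB'] with p h1 h2
    simp only [Prod.map_fst, Prod.map_snd, id_eq] at h1 h2
    rw [Function.uncurry, norm_mul]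
    exact mul_le_mul h1 h2 (norm_nonneg _) ((norm_nonneg _).trans h1)
  refine ⟨hint.integral_prod_right, ?_⟩
  rw [← integral_integral_swap hint]
  refine integral_congr_ae (Eventually.of_forall fun z => ?_)
  exact (integral_prod_mul (μ := μ) (ν := μ) (A z) (B z)).symm

end Fubini

/-! ### Regularized single layer potentials -/

section Plemelj

variable {a : ℝ≥0} {D : Set Plane}

/-- With s = √t, the bound 1 + s⁴ ≤ (1 + s)⁴ reduces the claim to log(1 + s) ≤ s. -/
theorem log_one_add_sq_le {t : ℝ} (ht : 0 ≤ t) : Real.log (1 + t ^ 2) ≤ 4 * t ^ (1 / 2 : ℝ) := by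
  have hs : (t ^ (1 / 2 : ℝ)) ^ 2 = t := by
    rw [← Real.rpow_natCast, ← Real.rpow_mul ht]; norm_num
  set s := t ^ (1 / 2 : ℝ) with hsd
  have hs0 : 0 ≤ s := Real.rpow_nonneg ht _
  have h1 : 1 + t ^ 2 ≤ (1 + s) ^ 4 := by
    rw [← hs]
    nlinarith [pow_nonneg hs0 2, pow_nonneg hs0 3]
  calc Real.log (1 + t ^ 2) ≤ Real.log ((1 + s) ^ 4) := Real.log_le_log (by positivity) h1
    _ = 4 * Real.log (1 + s) := by rw [Real.log_pow]; norm_num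
    _ ≤ 4 * s := by
      have := Real.log_le_sub_one_of_pos (show 0 < 1 + s by positivity)
      linarith

/-- The difference is (1/4π) log(1 + (ε/‖x - y‖)²). Bounding it by a square root separates a rate in
ε from a singularity integrable over the boundary, uniformly in the pole. -/
theorem abs_logReg_sub_le {ε : ℝ} (hε : 0 < ε) {x y : Plane} (hxy : y ≠ x) :
    |logReg ε (x - y) - logKernel x y| ≤ ε ^ (1 / 2 : ℝ) * ‖x - y‖ ^ (-(1 / 2) : ℝ) := by
  have hpos : 0 < ‖x - y‖ := norm_pos_iff.2 (sub_ne_zero.2 hxy.symm)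
  have hpi := Real.pi_gt_three
  have h1 : logReg ε (x - y) - logKernel x y =
      1 / (4 * Real.pi) * Real.log (1 + (ε / ‖x - y‖) ^ 2) := by
    have h2 : Real.log (‖x - y‖ ^ 2 + ε ^ 2) =
        Real.log (1 + (ε / ‖x - y‖) ^ 2) + 2 * Real.log ‖x - y‖ := by
      have h3 := Real.log_pow ‖x - y‖ 2
      rw [Nat.cast_ofNat] at h3
      rw [← h3, ← Real.log_mul (by positivity) (by positivity)]
      congr 1
      field_simp
    rw [logReg, logKernel, h2]
    field_simp
    ring
  have h3 : ε ^ (1 / 2 : ℝ) * ‖x - y‖ ^ (-(1 / 2) : ℝ) = (ε / ‖x - y‖) ^ (1 / 2 : ℝ) := by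
    rw [Real.div_rpow hε.le hpos.le, Real.rpow_neg hpos.le]; rfl
  have h4 : 0 ≤ Real.log (1 + (ε / ‖x - y‖) ^ 2) := by
    refine Real.log_nonneg ?_
    linarith [sq_nonneg (ε / ‖x - y‖)]
  rw [h1, h3, abs_of_nonneg (by positivity)]
  have h5 := log_one_add_sq_le (t := ε / ‖x - y‖) (by positivity)
  have h6 : 0 ≤ (ε / ‖x - y‖) ^ (1 / 2 : ℝ) := by positivity
  rw [one_div_mul_eq_div, div_le_iff₀ (by positivity)]
  nlinarith

/-- The single layer potential of a continuous density. -/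
def logPotential (D : Set Plane) (f : Plane → ℂ) (z : Plane) : ℂ :=
  ∫ x, (logKernel z x : ℂ) * f x ∂(bdry D)

/-- The regularized single layer potential. -/
def regPotential (D : Set Plane) (ε : ℝ) (f : Plane → ℂ) (z : Plane) : ℂ :=
  ∫ x, (logReg ε (z - x) : ℂ) * f x ∂(bdry D)

theorem bdry_restrict_frontier (D : Set Plane) : (bdry D).restrict (frontier D) = bdry D := by
  rw [bdry, Measure.restrict_restrict isClosed_frontier.measurableSet, Set.inter_self]

theorem integrable_bdry_of_continuous [IsFiniteMeasure (bdry D)]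
    (hD : IsC1HolderDomain a D) {f : Plane → ℂ} (hf : Continuous f) :
    Integrable f (bdry D) := by
  rw [← bdry_restrict_frontier]
  exact hf.continuousOn.integrableOn_compact hD.isCompact_frontier

theorem continuous_regPotential [IsFiniteMeasure (bdry D)] (hD : IsC1HolderDomain a D)
    {ε : ℝ} (hε : 0 < ε) {f : Plane → ℂ} (hf : Continuous f) :
    Continuous (regPotential D ε f) := by
  have h1 : Continuous (Function.uncurry fun z x : Plane => (logReg ε (z - x) : ℂ) * f x) :=
    (Complex.continuous_ofReal.comp ((continuous_logReg hε).comp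
      (continuous_fst.sub continuous_snd))).mul (hf.comp continuous_snd)
  have h2 := continuous_parametric_integral_of_continuous (μ := bdry D) h1 hD.isCompact_frontier
  rwa [bdry_restrict_frontier] at h2

theorem measurable_logKernel_left (z : Plane) : Measurable (logKernel z) := by
  unfold logKernel
  fun_prop

/-- The regularized single layer potentials converge uniformly on the plane. -/
theorem IsC1HolderDomain.exists_norm_regPotential_sub_le (hD : IsC1HolderDomain a D) (ha : 0 < a)
    {f : Plane → ℂ} (hf : Continuous f) {B : ℝ} (hB : ∀ x, ‖f x‖ ≤ B) :
    ∃ C : ℝ, 0 ≤ C ∧ ∀ ε : ℝ, 0 < ε → ∀ z,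
      ‖regPotential D ε f z - logPotential D f z‖ ≤ C * ε ^ (1 / 2 : ℝ) := by
  have hfin := hD.isFiniteMeasure_bdry ha
  obtain ⟨M, -, hM0, hM⟩ := hD.exists_lintegral_rpow_le ha (s := 1 / 2) (by norm_num)
    (by norm_num)
  have hB0 : 0 ≤ B := (norm_nonneg _).trans (hB 0)
  have hr : ∀ z, Integrable (fun x => ‖z - x‖ ^ (-(1 / 2) : ℝ)) (bdry D) := by
    intro z
    refine ⟨Measurable.aestronglyMeasurable (by fun_prop), ?_⟩
    refine lt_of_le_of_lt (lintegral_mono fun x => ?_) ((hM z).trans_lt ENNReal.coe_lt_top)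
    rw [← ofReal_norm, Real.norm_of_nonneg (by positivity)]
  have hr' : ∀ z, ∫ x, ‖z - x‖ ^ (-(1 / 2) : ℝ) ∂(bdry D) ≤ M := by
    intro z
    rw [integral_eq_lintegral_of_nonneg_ae (Eventually.of_forall fun x => by positivity) (hr z).1]
    exact ENNReal.toReal_le_coe_of_le_coe (hM z)
  have hreg : ∀ ε : ℝ, 0 < ε → ∀ z, Integrable (fun x => (logReg ε (z - x) : ℂ) * f x) (bdry D) := by
    intro ε hε z
    refine integrable_bdry_of_continuous hD (Continuous.mul ?_ hf)
    exact Complex.continuous_ofReal.comp ((continuous_logReg hε).comp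
      (continuous_const.sub continuous_id))
  have hdiffbound : ∀ ε : ℝ, 0 < ε → ∀ z, ∀ᵐ x ∂(bdry D),
      ‖(logReg ε (z - x) : ℂ) * f x - (logKernel z x : ℂ) * f x‖ ≤
        B * ε ^ (1 / 2 : ℝ) * ‖z - x‖ ^ (-(1 / 2) : ℝ) := by
    intro ε hε z
    filter_upwards [ae_ne D z] with x hx
    rw [← sub_mul, norm_mul, ← Complex.ofReal_sub, Complex.norm_real, mul_comm, mul_assoc]
    exact mul_le_mul (hB x) (abs_logReg_sub_le hε hx) (norm_nonneg _) hB0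
  have hlogm : ∀ z, AEStronglyMeasurable (fun x => (logKernel z x : ℂ) * f x) (bdry D) := fun z =>
    ((Complex.continuous_ofReal.measurable.comp (measurable_logKernel_left z)).mul
      hf.measurable).aestronglyMeasurable
  have hlog : ∀ z, Integrable (fun x => (logKernel z x : ℂ) * f x) (bdry D) := by
    intro z
    -- Integrability of the logarithm itself follows from the case ε = 1: a continuous function
    -- minus a difference already dominated.
    have h1 : Integrable (fun x => (logReg 1 (z - x) : ℂ) * f x - (logKernel z x : ℂ) * f x)
        (bdry D) :=
      ((hr z).const_mul _).mono' ((hreg 1 one_pos z).1.sub (hlogm z)) (hdiffbound 1 one_pos z)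
    refine ((hreg 1 one_pos z).sub h1).congr (Eventually.of_forall fun x => ?_)
    simp
  refine ⟨B * M, by positivity, fun ε hε z => ?_⟩
  rw [regPotential, logPotential, ← integral_sub (hreg ε hε z) (hlog z)]
  calc _ ≤ ∫ x, B * ε ^ (1 / 2 : ℝ) * ‖z - x‖ ^ (-(1 / 2) : ℝ) ∂(bdry D) :=
        norm_integral_le_of_norm_le ((hr z).const_mul _) (hdiffbound ε hε z)
    _ = B * ε ^ (1 / 2 : ℝ) * ∫ x, ‖z - x‖ ^ (-(1 / 2) : ℝ) ∂(bdry D) := integral_const_mul _ _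
    _ ≤ B * ε ^ (1 / 2 : ℝ) * M := by
        gcongr
        exact hr' z
    _ = _ := by ring

theorem tendsto_const_mul_sqrt_nhdsGT_zero (C : ℝ) :
    Tendsto (fun ε : ℝ => C * ε ^ (1 / 2 : ℝ)) (𝓝[>] 0) (𝓝 0) := by
  have h1 : Tendsto (fun ε : ℝ => ε ^ (1 / 2 : ℝ)) (𝓝 0) (𝓝 0) := by
    have := (Real.continuousAt_rpow_const 0 (1 / 2 : ℝ) (Or.inr (by positivity))).tendsto
    rwa [Real.zero_rpow (by positivity)] at this
  simpa using (h1.mono_left nhdsWithin_le_nhds).const_mul C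

/-- A uniform limit of continuous potentials. Continuity across the boundary is needed when the
potential is integrated against the approximate identity. -/
theorem IsC1HolderDomain.continuous_logPotential (hD : IsC1HolderDomain a D) (ha : 0 < a)
    {f : Plane → ℂ} (hf : Continuous f) {B : ℝ} (hB : ∀ x, ‖f x‖ ≤ B) :
    Continuous (logPotential D f) := by
  have hfin := hD.isFiniteMeasure_bdry ha
  obtain ⟨C, hC0, hC⟩ := hD.exists_norm_regPotential_sub_le ha hf hB
  have hu : TendstoUniformly (fun ε => regPotential D ε f) (logPotential D f) (𝓝[>] 0) := by
    rw [Metric.tendstoUniformly_iff]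
    intro η hη
    filter_upwards [(tendsto_const_mul_sqrt_nhdsGT_zero C).eventually (gt_mem_nhds hη),
      self_mem_nhdsWithin] with ε h1 hε z
    rw [dist_comm, dist_eq_norm]
    exact (hC ε hε z).trans_lt h1
  refine hu.continuous (Eventually.frequently ?_)
  filter_upwards [self_mem_nhdsWithin] with ε hε using continuous_regPotential hD hε hf

theorem norm_regDelta_le {ε : ℝ} (hε : 0 < ε) (w : Plane) :
    ‖regDelta ε w‖ ≤ 1 / (Real.pi * ε ^ 2) := by
  have hpi := Real.pi_pos
  rw [Real.norm_of_nonneg (regDelta_nonneg _ _), regDelta,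
    div_le_div_iff₀ (by positivity) (by positivity)]
  have h1 : ε ^ 4 ≤ (‖w‖ ^ 2 + ε ^ 2) ^ 2 := by
    nlinarith [sq_nonneg ‖w‖, sq_nonneg ε, mul_nonneg (sq_nonneg ‖w‖) (sq_nonneg ε),
      sq_nonneg (‖w‖ ^ 2)]
  nlinarith

/-- Stated for a general measure ν so as to cover both terms of Green's identity: arc length with
`npReg`, and area on D with `regDelta`. -/
theorem regPotential_mul_integral [IsFiniteMeasure (bdry D)] (hD : IsC1HolderDomain a D)
    {ν : Measure Plane} [IsFiniteMeasure ν] (hν : ∀ᵐ z ∂ν, z ∈ closure D) {ε : ℝ} (hε : 0 < ε)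
    {b : Plane → Plane → ℝ} (hb : AEStronglyMeasurable (Function.uncurry b) (ν.prod (bdry D)))
    {K : ℝ} (hK : ∀ z y, ‖b z y‖ ≤ K) {f g : Plane → ℂ} (hf : Continuous f) (hg : Continuous g)
    {B : ℝ} (hfB : ∀ x, ‖f x‖ ≤ B) (hgB : ∀ x, ‖g x‖ ≤ B) :
    Integrable (fun p : Plane × Plane =>
        f p.1 * g p.2 * ((∫ z, logReg ε (z - p.1) * b z p.2 ∂ν : ℝ) : ℂ))
        ((bdry D).prod (bdry D)) ∧
      ∫ z, regPotential D ε f z * (∫ y, (b z y : ℂ) * g y ∂(bdry D)) ∂ν =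
        ∫ p : Plane × Plane, f p.1 * g p.2 * ((∫ z, logReg ε (z - p.1) * b z p.2 ∂ν : ℝ) : ℂ)
          ∂((bdry D).prod (bdry D)) := by
  have hB0 : 0 ≤ B := (norm_nonneg _).trans (hfB 0)
  have hK0 : 0 ≤ K := (norm_nonneg _).trans (hK 0 0)
  have hL : Continuous fun p : Plane × Plane => logReg ε (p.1 - p.2) :=
    (continuous_logReg hε).comp (continuous_fst.sub continuous_snd)
  obtain ⟨R, hR⟩ := (hD.isCompact_closure.prod hD.isCompact_closure).exists_bound_of_continuousOn
    hL.continuousOn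
  have h := integral_mul_integral_swap (ν := ν) (μ := bdry D)
    (A := fun z x => (logReg ε (z - x) : ℂ) * f x) (B := fun z y => (b z y : ℂ) * g y)
    (CA := R * B) (CB := K * B) ?_ ?_ ?_ ?_
  · have heq : ∀ p : Plane × Plane, ∫ z, (logReg ε (z - p.1) : ℂ) * f p.1 * (b z p.2 * g p.2) ∂ν =
        f p.1 * g p.2 * ((∫ z, logReg ε (z - p.1) * b z p.2 ∂ν : ℝ) : ℂ) := by
      intro p
      rw [← integral_complex_ofReal, ← integral_const_mul]
      congr 1
      funext z
      push_cast
      ring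
    simp only [heq] at h
    exact h
  · exact ((Complex.continuous_ofReal.comp hL).mul (hf.comp continuous_snd)).aestronglyMeasurable
  · exact (Complex.continuous_ofReal.comp_aestronglyMeasurable hb).mul
      (hg.comp continuous_snd).aestronglyMeasurable
  · filter_upwards [Measure.quasiMeasurePreserving_fst.ae hν,
      Measure.quasiMeasurePreserving_snd.ae (ae_mem_frontier D)] with p h1 h2
    rw [norm_mul, Complex.norm_real]
    have h3 := hR p ⟨h1, frontier_subset_closure h2⟩
    exact mul_le_mul h3 (hfB _) (norm_nonneg _) ((norm_nonneg _).trans h3)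
  · refine Eventually.of_forall fun p => ?_
    rw [norm_mul, Complex.norm_real]
    exact mul_le_mul (hK _ _) (hgB _) (norm_nonneg _) hK0

/-- Green's second identity for two regularized single layer potentials. -/
theorem IsC1HolderDomain.regPotential_green (hD : IsC1HolderDomain a D) (ha : 0 < a)
    {ε : ℝ} (hε : 0 < ε) {f g : Plane → ℂ} (hf : Continuous f) (hg : Continuous g)
    {B : ℝ} (hfB : ∀ x, ‖f x‖ ≤ B) (hgB : ∀ x, ‖g x‖ ≤ B) :
    (∫ z, regPotential D ε f z * (∫ y, (npReg D ε z y : ℂ) * g y ∂(bdry D)) ∂(bdry D)) -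
        ∫ z in D, regPotential D ε f z * (∫ y, (regDelta ε (z - y) : ℂ) * g y ∂(bdry D)) =
      (∫ z, regPotential D ε g z * (∫ y, (npReg D ε z y : ℂ) * f y ∂(bdry D)) ∂(bdry D)) -
        ∫ z in D, regPotential D ε g z * (∫ y, (regDelta ε (z - y) : ℂ) * f y ∂(bdry D)) := by
  have hfin := hD.isFiniteMeasure_bdry ha
  have hfinD : IsFiniteMeasure (volume.restrict D) :=
    ⟨by rw [Measure.restrict_apply_univ]; exact hD.isBounded.measure_lt_top⟩
  have hν1 : ∀ᵐ z ∂(bdry D), z ∈ closure D :=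
    (ae_mem_frontier D).mono fun z hz => frontier_subset_closure hz
  have hν2 : ∀ᵐ z ∂(volume.restrict D), z ∈ closure D :=
    (ae_restrict_mem hD.isOpen.measurableSet).mono fun z hz => subset_closure hz
  have hm1 := hD.aestronglyMeasurable_npReg_comp ha ε measurable_id
  have hm2 : AEStronglyMeasurable (Function.uncurry fun z y : Plane => regDelta ε (z - y))
      ((volume.restrict D).prod (bdry D)) :=
    ((continuous_regDelta hε).comp (continuous_fst.sub continuous_snd)).aestronglyMeasurable
  -- Both sides become double integrals of the densities against the kernel of Green's pointwise
  -- identity, which is symmetric; swapping the variables exchanges f and g.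
  have key : ∀ f g : Plane → ℂ, Continuous f → Continuous g → (∀ x, ‖f x‖ ≤ B) →
      (∀ x, ‖g x‖ ≤ B) →
      (∫ z, regPotential D ε f z * (∫ y, (npReg D ε z y : ℂ) * g y ∂(bdry D)) ∂(bdry D)) -
        ∫ z in D, regPotential D ε f z * (∫ y, (regDelta ε (z - y) : ℂ) * g y ∂(bdry D)) =
      ∫ p : Plane × Plane, f p.1 * g p.2 *
        (((∫ z, logReg ε (z - p.1) * npReg D ε z p.2 ∂(bdry D)) -
          ∫ z in D, logReg ε (z - p.1) * regDelta ε (z - p.2) : ℝ) : ℂ)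
          ∂((bdry D).prod (bdry D)) := by
    intro f g hf hg hfB hgB
    have h1 := regPotential_mul_integral hD hν1 hε hm1 (abs_npReg_le_inv D hε) hf hg hfB hgB
    have h2 := regPotential_mul_integral hD hν2 hε hm2 (fun z y => norm_regDelta_le hε (z - y))
      hf hg hfB hgB
    rw [h2.2]
    refine (congrArg₂ _ h1.2 rfl).trans ?_
    rw [← integral_sub h1.1 h2.1]
    congr 1
    funext p
    push_cast
    simp only [id]
    ring
  rw [key f g hf hg hfB hgB, key g f hg hf hgB hfB, ← integral_prod_swap]
  congr 1
  funext p
  simp only [Prod.fst_swap, Prod.snd_swap]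
  rw [hD.integral_logReg_mul_npReg_sub ha hε]
  ring

theorem IsC1HolderDomain.setIntegral_regPotential_mul (hD : IsC1HolderDomain a D) (ha : 0 < a)
    {ε : ℝ} (hε : 0 < ε) {f g : Plane → ℂ} (hf : Continuous f) (hg : Continuous g)
    {B : ℝ} (hgB : ∀ x, ‖g x‖ ≤ B) :
    Integrable (fun y => g y * ∫ z in D, (regDelta ε (z - y) : ℂ) * regPotential D ε f z)
      (bdry D) ∧
    ∫ z in D, regPotential D ε f z * (∫ y, (regDelta ε (z - y) : ℂ) * g y ∂(bdry D)) =
      ∫ y, g y * (∫ z in D, (regDelta ε (z - y) : ℂ) * regPotential D ε f z) ∂(bdry D) := by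
  have hfin := hD.isFiniteMeasure_bdry ha
  have hfinD : IsFiniteMeasure (volume.restrict D) :=
    ⟨by rw [Measure.restrict_apply_univ]; exact hD.isBounded.measure_lt_top⟩
  have hV := continuous_regPotential hD hε hf
  obtain ⟨R, hR⟩ := hD.isCompact_closure.exists_bound_of_continuousOn hV.continuousOn
  have hint : Integrable (Function.uncurry fun z y =>
      regPotential D ε f z * ((regDelta ε (z - y) : ℂ) * g y))
      ((volume.restrict D).prod (bdry D)) := by
    refine Integrable.of_bound ?_ (R * (1 / (Real.pi * ε ^ 2) * B)) ?_
    · exact ((hV.comp continuous_fst).mul ((Complex.continuous_ofReal.comp ((continuous_regDelta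
        hε).comp (continuous_fst.sub continuous_snd))).mul
          (hg.comp continuous_snd))).aestronglyMeasurable
    · filter_upwards [Measure.quasiMeasurePreserving_fst.ae
        (ae_restrict_mem hD.isOpen.measurableSet)] with p hp
      have h1 := hR p.1 (subset_closure hp)
      rw [Function.uncurry, norm_mul, norm_mul, Complex.norm_real]
      have := Real.pi_pos
      exact mul_le_mul h1 (mul_le_mul (norm_regDelta_le hε _) (hgB _) (norm_nonneg _)
        (by positivity)) (by positivity) ((norm_nonneg _).trans h1)
  have heq : ∀ y, ∫ z in D, regPotential D ε f z * ((regDelta ε (z - y) : ℂ) * g y) =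
      g y * ∫ z in D, (regDelta ε (z - y) : ℂ) * regPotential D ε f z := by
    intro y
    rw [← integral_const_mul]
    congr 1
    funext z
    ring
  constructor
  · have h := hint.integral_prod_right
    simpa only [Function.uncurry, heq] using h
  · calc _ = ∫ z in D, ∫ y, regPotential D ε f z * ((regDelta ε (z - y) : ℂ) * g y) ∂(bdry D) := by
          simp only [integral_const_mul]
      _ = _ := by
          rw [integral_integral_swap hint]
          simp only [heq]

theorem IsC1HolderDomain.exists_integral_abs_npKernel_le (hD : IsC1HolderDomain a D) (ha : 0 < a)
    (ha1 : a ≤ 1) : ∃ C : ℝ, 0 ≤ C ∧ ∀ z ∈ frontier D,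
      Integrable (fun y => npKernel D z y) (bdry D) ∧ ∫ y, ‖npKernel D z y‖ ∂(bdry D) ≤ C := by
  obtain ⟨M, -, hM0, hM⟩ := hD.exists_lintegral_rpow_le ha (half_exponent_pos ha1)
    (half_exponent_lt_one ha)
  obtain ⟨C, hC0, hC, -⟩ := hD.exists_npKernel_bound ha1
  refine ⟨((C.toNNReal + (0 : ℝ).toNNReal) * M : ℝ≥0), NNReal.coe_nonneg _, fun z hz => ?_⟩
  have hb : ∫⁻ y, ‖npKernel D z y‖ₑ ∂(bdry D) ≤ ((C.toNNReal + (0 : ℝ).toNNReal) * M : ℝ≥0) := by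
    refine lintegral_enorm_le_of_rpow_bound (d := 0) hC0 (hM z) hM0 ?_
    filter_upwards [ae_mem_frontier D, ae_ne D z] with y hy hyz
    rw [add_zero]
    exact hC z hz y hy hyz.symm
  have hm : Measurable fun y => npKernel D z y := by
    unfold npKernel
    fun_prop
  refine ⟨⟨hm.aestronglyMeasurable, hb.trans_lt ENNReal.coe_lt_top⟩, ?_⟩
  rw [integral_norm_eq_lintegral_enorm hm.aestronglyMeasurable]
  exact ENNReal.toReal_le_coe_of_le_coe hb

end Plemelj

/-! ### Plemelj's symmetrization principle -/

section PlemeljLimit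

variable {a : ℝ≥0} {D : Set Plane}

theorem IsC1HolderDomain.exists_regPotential_bound (hD : IsC1HolderDomain a D) (ha : 0 < a)
    {f : Plane → ℂ} (hf : Continuous f) {B : ℝ} (hfB : ∀ x, ‖f x‖ ≤ B) :
    ∃ R : ℝ, 0 ≤ R ∧ ∀ᶠ ε in 𝓝[>] (0 : ℝ), ∀ z ∈ closure D, ‖regPotential D ε f z‖ ≤ R := by
  obtain ⟨C, hC0, hC⟩ := hD.exists_norm_regPotential_sub_le ha hf hfB
  obtain ⟨R, hR⟩ := hD.isCompact_closure.exists_bound_of_continuousOn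
    (hD.continuous_logPotential ha hf hfB).continuousOn
  refine ⟨1 + |R|, by positivity, ?_⟩
  filter_upwards [(tendsto_const_mul_sqrt_nhdsGT_zero C).eventually (gt_mem_nhds one_pos),
      self_mem_nhdsWithin] with ε h1 hε z hz
  calc ‖regPotential D ε f z‖
      = ‖(regPotential D ε f z - logPotential D f z) + logPotential D f z‖ := by
        rw [sub_add_cancel]
    _ ≤ _ := norm_add_le _ _
    _ ≤ _ := add_le_add ((hC ε hε z).trans h1.le) ((hR z hz).trans (le_abs_self R))

theorem IsC1HolderDomain.tendsto_regPotential (hD : IsC1HolderDomain a D) (ha : 0 < a)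
    {f : Plane → ℂ} (hf : Continuous f) {B : ℝ} (hfB : ∀ x, ‖f x‖ ≤ B) (p w : Plane) :
    Tendsto (fun ε : ℝ => regPotential D ε f (p + ε • w)) (𝓝[>] 0) (𝓝 (logPotential D f p)) := by
  obtain ⟨C, hC0, hC⟩ := hD.exists_norm_regPotential_sub_le ha hf hfB
  have hlim : Tendsto (fun ε : ℝ => p + ε • w) (𝓝[>] 0) (𝓝 p) := by
    have : Continuous fun ε : ℝ => p + ε • w := by fun_prop
    simpa using (this.tendsto 0).mono_left nhdsWithin_le_nhds
  have h1 := ((hD.continuous_logPotential ha hf hfB).tendsto p).comp hlim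
  have h2 : Tendsto (fun ε : ℝ => regPotential D ε f (p + ε • w) - logPotential D f (p + ε • w))
      (𝓝[>] 0) (𝓝 0) := by
    refine squeeze_zero_norm' ?_ (tendsto_const_mul_sqrt_nhdsGT_zero C)
    filter_upwards [self_mem_nhdsWithin] with ε hε using hC ε hε _
  simpa using h2.add h1

/-- Dominated convergence twice: the regularized kernel is at most the true one, whose integrals in
y are uniformly bounded, and the potentials are uniformly bounded on the closure of D. -/
theorem IsC1HolderDomain.tendsto_integral_regPotential_mul (hD : IsC1HolderDomain a D)
    (ha : 0 < a) (ha1 : a ≤ 1) {f g : Plane → ℂ} (hf : Continuous f) (hg : Continuous g)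
    {B : ℝ} (hfB : ∀ x, ‖f x‖ ≤ B) (hgB : ∀ x, ‖g x‖ ≤ B) :
    Tendsto (fun ε : ℝ => ∫ z, regPotential D ε f z *
        (∫ y, (npReg D ε z y : ℂ) * g y ∂(bdry D)) ∂(bdry D)) (𝓝[>] 0)
      (𝓝 (∫ z, logPotential D f z * (∫ y, (npKernel D z y : ℂ) * g y ∂(bdry D)) ∂(bdry D))) := by
  have hfin := hD.isFiniteMeasure_bdry ha
  have hB0 : 0 ≤ B := (norm_nonneg _).trans (hfB 0)
  obtain ⟨R, hR0, hR⟩ := hD.exists_regPotential_bound ha hf hfB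
  obtain ⟨K, hK0, hK⟩ := hD.exists_integral_abs_npKernel_le ha ha1
  have hmL : ∀ ε z, AEStronglyMeasurable (fun y => (npReg D ε z y : ℂ) * g y) (bdry D) := by
    intro ε z
    have : Measurable fun y => npReg D ε z y := by
      unfold npReg
      fun_prop
    exact ((Complex.continuous_ofReal.measurable.comp this).mul
      hg.measurable).aestronglyMeasurable
  have hle : ∀ ε z y, ‖(npReg D ε z y : ℂ) * g y‖ ≤ ‖npKernel D z y‖ * B := by
    intro ε z y
    rw [norm_mul, Complex.norm_real]
    exact mul_le_mul (abs_npReg_le D ε z y) (hgB y) (norm_nonneg _) (norm_nonneg _)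
  refine tendsto_integral_filter_of_dominated_convergence (fun _ => R * (K * B)) ?_ ?_
    (integrable_const _) ?_
  · filter_upwards [self_mem_nhdsWithin] with ε hε
    refine (continuous_regPotential hD hε hf).aestronglyMeasurable.mul ?_
    have h1 := hD.aestronglyMeasurable_npReg_comp ha ε measurable_id
    exact AEStronglyMeasurable.integral_prod_right'
      ((Complex.continuous_ofReal.comp_aestronglyMeasurable h1).mul
        (hg.comp continuous_snd).aestronglyMeasurable)
  · filter_upwards [hR] with ε hε
    filter_upwards [ae_mem_frontier D] with z hz
    rw [norm_mul]
    refine mul_le_mul (hε z (frontier_subset_closure hz)) ?_ (norm_nonneg _) hR0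
    calc _ ≤ ∫ y, ‖npKernel D z y‖ * B ∂(bdry D) :=
          norm_integral_le_of_norm_le ((hK z hz).1.norm.mul_const B)
            (Eventually.of_forall fun y => hle ε z y)
      _ = (∫ y, ‖npKernel D z y‖ ∂(bdry D)) * B := integral_mul_const _ _
      _ ≤ _ := by gcongr; exact (hK z hz).2
  · filter_upwards [ae_mem_frontier D] with z hz
    have h1 := hD.tendsto_regPotential ha hf hfB z 0
    simp only [smul_zero, add_zero] at h1
    refine h1.mul ?_
    refine tendsto_integral_filter_of_dominated_convergence (fun y => ‖npKernel D z y‖ * B)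
      (Eventually.of_forall fun ε => hmL ε z)
      (Eventually.of_forall fun ε => Eventually.of_forall fun y => hle ε z y)
      ((hK z hz).1.norm.mul_const B) (Eventually.of_forall fun y => ?_)
    exact ((Complex.continuous_ofReal.tendsto _).comp (tendsto_npReg D z y)).mul_const _

theorem IsC1HolderDomain.tendsto_setIntegral_regPotential_mul (hD : IsC1HolderDomain a D)
    (ha : 0 < a) {f g : Plane → ℂ} (hf : Continuous f) (hg : Continuous g)
    {B : ℝ} (hfB : ∀ x, ‖f x‖ ≤ B) (hgB : ∀ x, ‖g x‖ ≤ B) :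
    Tendsto (fun ε : ℝ => ∫ z in D, regPotential D ε f z *
        (∫ y, (regDelta ε (z - y) : ℂ) * g y ∂(bdry D))) (𝓝[>] 0)
      (𝓝 (∫ y, g y * (logPotential D f y / 2) ∂(bdry D))) := by
  have hfin := hD.isFiniteMeasure_bdry ha
  have hB0 : 0 ≤ B := (norm_nonneg _).trans (hfB 0)
  obtain ⟨R, hR0, hR⟩ := hD.exists_regPotential_bound ha hf hfB
  have hcongr : (fun ε : ℝ => ∫ y, g y * (∫ z in D, (regDelta ε (z - y) : ℂ) *
      regPotential D ε f z) ∂(bdry D)) =ᶠ[𝓝[>] 0] fun ε : ℝ => ∫ z in D, regPotential D ε f z *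
        (∫ y, (regDelta ε (z - y) : ℂ) * g y ∂(bdry D)) := by
    filter_upwards [self_mem_nhdsWithin] with ε hε
    exact (hD.setIntegral_regPotential_mul ha hε hf hg hgB).2.symm
  refine Tendsto.congr' hcongr ?_
  refine tendsto_integral_filter_of_dominated_convergence (fun _ => B * R) ?_ ?_
    (integrable_const _) ?_
  · filter_upwards [self_mem_nhdsWithin] with ε hε
    exact (hD.setIntegral_regPotential_mul ha hε hf hg hgB).1.1
  · filter_upwards [hR, self_mem_nhdsWithin] with ε hε hε0
    refine Eventually.of_forall fun y => ?_
    rw [norm_mul]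
    exact mul_le_mul (hgB y) (norm_setIntegral_regDelta_mul_le hD.isOpen.measurableSet hε0 y hR0
      fun z hz => hε z (subset_closure hz)) (norm_nonneg _) hB0
  · filter_upwards [ae_mem_frontier D] with y hy
    refine Tendsto.const_mul _ ?_
    refine (hD.exists_isOutwardNormal hy).tendsto_setIntegral_regDelta hD.isOpen.measurableSet hR0
      ?_ ?_ (hD.tendsto_regPotential ha hf hfB y)
    · filter_upwards [self_mem_nhdsWithin] with ε hε
      exact (continuous_regPotential hD hε hf).measurable
    · filter_upwards [hR] with ε hε z hz using hε z (subset_closure hz)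

theorem logKernel_comm (x y : Plane) : logKernel x y = logKernel y x := by
  rw [logKernel, logKernel, norm_sub_rev]

theorem IsC1HolderDomain.integral_mul_logPotential_comm (hD : IsC1HolderDomain a D) (ha : 0 < a)
    {f g : Plane → ℂ} (hf : MemLp f 2 (bdry D)) (hg : MemLp g 2 (bdry D)) :
    ∫ x, g x * logPotential D f x ∂(bdry D) = ∫ x, f x * logPotential D g x ∂(bdry D) := by
  have hfin := hD.isFiniteMeasure_bdry ha
  obtain ⟨C, hk⟩ := hD.exists_isSchurKernel_logKernel ha
  have hint := hk.integrable_prod hf hg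
  simp only [logPotential, ← integral_const_mul]
  rw [integral_integral_swap hint]
  congr 1
  funext x
  congr 1
  funext y
  rw [logKernel_comm]
  ring

/-- The limit ε → 0 of Green's second identity. The area terms tend to half the single layer pairing
of f and g, which is symmetric and cancels. -/
theorem IsC1HolderDomain.integral_logPotential_mul_comm_of_continuous (hD : IsC1HolderDomain a D)
    (ha : 0 < a) (ha1 : a ≤ 1) {f g : Plane → ℂ} (hf : Continuous f) (hg : Continuous g)
    {B : ℝ} (hfB : ∀ x, ‖f x‖ ≤ B) (hgB : ∀ x, ‖g x‖ ≤ B) :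
    ∫ z, logPotential D f z * (∫ y, (npKernel D z y : ℂ) * g y ∂(bdry D)) ∂(bdry D) =
      ∫ z, logPotential D g z * (∫ y, (npKernel D z y : ℂ) * f y ∂(bdry D)) ∂(bdry D) := by
  have hfin := hD.isFiniteMeasure_bdry ha
  have h1 := (hD.tendsto_integral_regPotential_mul ha ha1 hf hg hfB hgB).sub
    (hD.tendsto_setIntegral_regPotential_mul ha hf hg hfB hgB)
  have h2 := (hD.tendsto_integral_regPotential_mul ha ha1 hg hf hgB hfB).sub
    (hD.tendsto_setIntegral_regPotential_mul ha hg hf hgB hfB)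
  have h3 := tendsto_nhds_unique h1 (h2.congr' (by
    filter_upwards [self_mem_nhdsWithin] with ε hε
    exact hD.regPotential_green ha hε hg hf hgB hfB))
  have h4 := hD.integral_mul_logPotential_comm ha
    (MemLp.of_bound hf.aestronglyMeasurable B (Eventually.of_forall hfB))
    (MemLp.of_bound hg.aestronglyMeasurable B (Eventually.of_forall hgB))
  simp only [← mul_div_assoc, integral_div] at h3
  rw [h4] at h3
  exact sub_left_inj.1 h3

/-- The single layer operator on `L²(∂D)`. -/
theorem IsC1HolderDomain.exists_singleLayer_op (hD : IsC1HolderDomain a D) (ha : 0 < a) :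
    ∃ S : L2 D →L[ℂ] L2 D, ∀ φ, S φ =ᵐ[bdry D] logPotential D φ := by
  have hfin := hD.isFiniteMeasure_bdry ha
  obtain ⟨C, hk⟩ := hD.exists_isSchurKernel_logKernel ha
  exact ⟨hk.op, hk.op_ae⟩

theorem singleLayer_eq_logPotential (D : Set Plane) (φ : L2 D) :
    singleLayer D φ = logPotential D φ := rfl

theorem innerH_eq_neg_inner {S : L2 D →L[ℂ] L2 D} (hS : ∀ φ, S φ =ᵐ[bdry D] logPotential D φ)
    (φ ψ : L2 D) : innerH D φ ψ = -inner ℂ φ (S ψ) := by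
  rw [innerH, L2.inner_def]
  congr 1
  refine integral_congr_ae ?_
  filter_upwards [hS ψ] with x hx
  rw [hx, singleLayer_eq_logPotential, RCLike.inner_apply, mul_comm]

theorem logPotential_conj (D : Set Plane) (f : Plane → ℂ) (z : Plane) :
    logPotential D (fun x => conj (f x)) z = conj (logPotential D f z) := by
  rw [logPotential, logPotential, ← integral_conj]
  congr 1
  funext x
  simp

theorem IsC1HolderDomain.inner_singleLayer_comm (hD : IsC1HolderDomain a D) (ha : 0 < a)
    {S : L2 D →L[ℂ] L2 D} (hS : ∀ φ, S φ =ᵐ[bdry D] logPotential D φ) (φ ψ : L2 D) :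
    inner ℂ (S φ) ψ = inner ℂ φ (S ψ) := by
  have h := hD.integral_mul_logPotential_comm ha (f := ψ) (g := fun x => conj (φ x))
    (Lp.memLp ψ) (Lp.memLp φ).star
  rw [L2.inner_def, L2.inner_def]
  refine Eq.trans ?_ (h.symm.trans ?_)
  · refine integral_congr_ae ?_
    filter_upwards [hS φ] with x hx
    rw [hx, logPotential_conj, RCLike.inner_apply]
  · refine integral_congr_ae ?_
    filter_upwards [hS ψ] with x hx
    rw [hx, RCLike.inner_apply, mul_comm]

/-- Plemelj's symmetrization principle `K S = S K*`. -/
theorem IsC1HolderDomain.inner_apply_singleLayer_comm (hD : IsC1HolderDomain a D) (ha : 0 < a)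
    (ha1 : a ≤ 1) {S T : L2 D →L[ℂ] L2 D} (hS : ∀ φ, S φ =ᵐ[bdry D] logPotential D φ)
    (hT : IsNPOperator D T) (φ ψ : L2 D) :
    inner ℂ (T φ) (S ψ) = inner ℂ (S φ) (T ψ) := by
  have hfin := hD.isFiniteMeasure_bdry ha
  -- Both sides are continuous on L², so bounded continuous densities suffice; the first one is
  -- conjugated because the identity for continuous densities is bilinear.
  have hdense := BoundedContinuousFunction.toLp_denseRange (E := ℂ) (bdry D) ℂ
    (p := 2) ENNReal.ofNat_ne_top
  refine hdense.induction_on₂ (p := fun φ ψ => inner ℂ (T φ) (S ψ) = inner ℂ (S φ) (T ψ))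
    (isClosed_eq (by fun_prop) (by fun_prop)) (fun f g => ?_) φ ψ
  set φ := (BoundedContinuousFunction.toLp 2 (bdry D) ℂ : _ →L[ℂ] Lp ℂ 2 (bdry D)) f
  set ψ := (BoundedContinuousFunction.toLp 2 (bdry D) ℂ : _ →L[ℂ] Lp ℂ 2 (bdry D)) g
  have hφ : φ =ᵐ[bdry D] f := BoundedContinuousFunction.coeFn_toLp 2 (bdry D) ℂ f
  have hψ : ψ =ᵐ[bdry D] g := BoundedContinuousFunction.coeFn_toLp 2 (bdry D) ℂ g
  have hS' : ∀ {χ : L2 D} {h : Plane → ℂ}, χ =ᵐ[bdry D] h →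
      S χ =ᵐ[bdry D] logPotential D h := by
    intro χ h hχ
    filter_upwards [hS χ] with x hx
    rw [hx]
    refine integral_congr_ae ?_
    filter_upwards [hχ] with y hy
    rw [hy]
  have hT' : ∀ {χ : L2 D} {h : Plane → ℂ}, χ =ᵐ[bdry D] h →
      T χ =ᵐ[bdry D] fun x => ∫ y, (npKernel D x y : ℂ) * h y ∂(bdry D) := by
    intro χ h hχ
    filter_upwards [hT χ] with x hx
    rw [hx]
    refine integral_congr_ae ?_
    filter_upwards [hχ] with y hy
    rw [hy]
  have key := hD.integral_logPotential_mul_comm_of_continuous ha ha1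
    (f := fun x => conj (f x)) (g := g) (Complex.continuous_conj.comp f.continuous) g.continuous
    (B := max ‖f‖ ‖g‖)
    (fun x => by rw [RCLike.norm_conj]; exact (f.norm_coe_le_norm x).trans (le_max_left _ _))
    (fun x => (g.norm_coe_le_norm x).trans (le_max_right _ _))
  rw [L2.inner_def, L2.inner_def]
  refine Eq.trans ?_ (key.symm.trans ?_)
  · refine integral_congr_ae ?_
    filter_upwards [hT' hφ, hS' hψ] with x h1 h2
    rw [h1, h2, RCLike.inner_apply, ← integral_conj]
    simp
  · refine integral_congr_ae ?_
    filter_upwards [hS' hφ, hT' hψ] with x h1 h2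
    rw [h1, h2, RCLike.inner_apply, logPotential_conj, mul_comm]

end PlemeljLimit

/-! ### Uniqueness from exponential moments -/

section ExponentialMoments

variable {μ : Measure Plane} {K : Set Plane}

theorem integrable_continuous_smul (hK : IsCompact K) (hμ : ∀ᵐ x ∂μ, x ∈ K) {f : Plane → ℂ}
    (hf : Integrable f μ) {g : Plane → ℝ} (hg : Continuous g) :
    Integrable (fun x => g x • f x) μ := by
  obtain ⟨C, hC⟩ := hK.exists_bound_of_continuousOn hg.continuousOn
  refine (hf.norm.const_mul C).mono' (hg.aestronglyMeasurable.smul hf.1) ?_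
  filter_upwards [hμ] with x hx
  rw [norm_smul]
  exact mul_le_mul_of_nonneg_right (hC x hx) (norm_nonneg _)

/-- A compactly supported complex density is determined by its exponential moments. -/
theorem ae_eq_zero_of_integral_exp_smul_eq_zero [IsFiniteMeasure μ] (hK : IsCompact K)
    (hμ : ∀ᵐ x ∂μ, x ∈ K) {f : Plane → ℂ} (hf : Integrable f μ)
    (h : ∀ w : Plane, ∫ x, Real.exp (inner ℝ x w) • f x ∂μ = 0) : f =ᵐ[μ] 0 := by
  have : CompactSpace K := isCompact_iff_compactSpace.1 hK
  let e : Plane → C(K, ℝ) := fun w => ⟨fun x => Real.exp (inner ℝ (x : Plane) w), by fun_prop⟩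
  -- Exponentials are closed under products, so the algebra they generate is their linear span, on
  -- which the moments vanish. Stone–Weierstrass then reaches every continuous test function.
  have hmul : ((Submonoid.closure (Set.range e) : Submonoid C(K, ℝ)) : Set C(K, ℝ)) ⊆
      Submodule.span ℝ (Set.range e) := by
    intro s hs
    refine Submodule.subset_span ?_
    induction hs using Submonoid.closure_induction with
    | mem x hx => exact hx
    | one => exact ⟨0, by ext x; simp [e]⟩
    | mul x y _ _ hx hy =>
      obtain ⟨w, rfl⟩ := hx
      obtain ⟨v, rfl⟩ := hy
      exact ⟨w + v, by ext x; simp [e, inner_add_right, Real.exp_add]⟩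
  have hA := Algebra.adjoin_eq_span_of_subset ℝ (A := C(K, ℝ)) hmul
  have hspan : ∀ s ∈ Submodule.span ℝ (Set.range e), ∃ S : Plane → ℝ, Continuous S ∧
      (∀ x : K, S x = s x) ∧ ∫ x, S x • f x ∂μ = 0 := by
    intro s hs
    induction hs using Submodule.span_induction with
    | mem x hx =>
      obtain ⟨w, rfl⟩ := hx
      exact ⟨fun x => Real.exp (inner ℝ x w), by fun_prop, fun x => rfl, h w⟩
    | zero => exact ⟨0, continuous_const, fun x => rfl, by simp⟩
    | add s t _ _ hs ht =>
      obtain ⟨S, hS, hS1, hS2⟩ := hs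
      obtain ⟨T, hT, hT1, hT2⟩ := ht
      refine ⟨fun x => S x + T x, hS.add hT, fun x => by simp [hS1, hT1], ?_⟩
      simp only [add_smul]
      rw [integral_add (integrable_continuous_smul hK hμ hf hS)
        (integrable_continuous_smul hK hμ hf hT), hS2, hT2, add_zero]
    | smul c s _ hs =>
      obtain ⟨S, hS, hS1, hS2⟩ := hs
      refine ⟨fun x => c * S x, continuous_const.mul hS, fun x => by simp [hS1], ?_⟩
      simp only [mul_smul]
      rw [integral_smul, hS2, smul_zero]
  have hsep : (Algebra.adjoin ℝ (Set.range e)).SeparatesPoints := by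
    intro x y hxy
    -- With exponent x - y, equal values at x and y give ‖x - y‖² = 0.
    refine ⟨_, ⟨e ((x : Plane) - y), Algebra.subset_adjoin ⟨_, rfl⟩, rfl⟩, fun heq => hxy ?_⟩
    have h1 : inner ℝ (x : Plane) ((x : Plane) - y) = inner ℝ (y : Plane) ((x : Plane) - y) :=
      Real.exp_injective heq
    rw [← sub_eq_zero, ← inner_sub_left, inner_self_eq_zero, sub_eq_zero] at h1
    exact Subtype.ext h1
  refine ae_eq_zero_of_integral_contDiff_smul_eq_zero hf.locallyIntegrable fun g hg _ => ?_
  refine norm_le_zero_iff.1 (le_of_forall_pos_le_add fun η hη => ?_)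
  set N := ∫ x, ‖f x‖ ∂μ with hN
  have hN0 : 0 ≤ N := integral_nonneg fun x => norm_nonneg _
  obtain ⟨⟨s, hs⟩, hsg⟩ :=
    ContinuousMap.exists_mem_subalgebra_near_continuousMap_of_separatesPoints _ hsep
      ⟨fun x : K => g x, hg.continuous.comp continuous_subtype_val⟩ (η / (N + 1)) (by positivity)
  rw [← Subalgebra.mem_toSubmodule, hA] at hs
  obtain ⟨S, hS, hS1, hS2⟩ := hspan s hs
  have hdiff : ∫ x, g x • f x ∂μ = ∫ x, (g x - S x) • f x ∂μ := by
    simp only [sub_smul]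
    rw [integral_sub (integrable_continuous_smul hK hμ hf hg.continuous)
      (integrable_continuous_smul hK hμ hf hS), hS2, sub_zero]
  rw [hdiff]
  calc ‖∫ x, (g x - S x) • f x ∂μ‖ ≤ ∫ x, η / (N + 1) * ‖f x‖ ∂μ := by
        refine norm_integral_le_of_norm_le (hf.norm.const_mul _) ?_
        filter_upwards [hμ] with x hx
        rw [norm_smul]
        refine mul_le_mul_of_nonneg_right ?_ (norm_nonneg _)
        have h1 := (ContinuousMap.norm_coe_le_norm _ (⟨x, hx⟩ : K)).trans hsg.le
        rw [norm_sub_rev, hS1 ⟨x, hx⟩]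
        exact h1
    _ = η * (N / (N + 1)) := by rw [integral_const_mul]; ring
    _ ≤ η * 1 := by
        gcongr
        rw [div_le_one (by positivity)]
        linarith
    _ = 0 + η := by ring

end ExponentialMoments

/-! ### Positivity of the Gaussian energy -/

section Gaussian

variable {μ : Measure Plane} {K : Set Plane}

theorem integrable_exp_neg_mul_norm_sq {b : ℝ} (hb : 0 < b) :
    Integrable fun w : Plane => Real.exp (-b * ‖w‖ ^ 2) := by
  refine Integrable.of_integral_ne_zero ?_
  rw [GaussianFourier.integral_rexp_neg_mul_sq_norm hb]
  have := Real.pi_pos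
  positivity

/-- The parallelogram law 2|x - z|² + 2|y - z|² = |x - y|² + 4|z - (x + y)/2|². -/
theorem gaussian_parallelogram (t : ℝ) (x y z : Plane) :
    Real.exp (-(2 * t) * ‖x - z‖ ^ 2) * Real.exp (-(2 * t) * ‖y - z‖ ^ 2) =
      Real.exp (-t * ‖x - y‖ ^ 2) * Real.exp (-(4 * t) * ‖z - (1 / 2 : ℝ) • (x + y)‖ ^ 2) := by
  rw [← Real.exp_add, ← Real.exp_add]
  congr 1
  simp only [norm_plane_sq]
  simp
  ring

/-- The Gaussian transform of a density. -/
def gaussianTransform (μ : Measure Plane) (t : ℝ) (f : Plane → ℂ) (z : Plane) : ℂ :=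
  ∫ x, (Real.exp (-(2 * t) * ‖x - z‖ ^ 2) : ℂ) * f x ∂μ

theorem gaussianTransform_conj (t : ℝ) (f : Plane → ℂ) (z : Plane) :
    gaussianTransform μ t (fun x => conj (f x)) z = conj (gaussianTransform μ t f z) := by
  rw [gaussianTransform, gaussianTransform, ← integral_conj]
  congr 1
  funext x
  rw [map_mul, Complex.conj_ofReal]

theorem integrable_prod_conj_mul [IsFiniteMeasure μ] {f : Plane → ℂ} (hf : Integrable f μ) :
    Integrable (fun p : Plane × Plane => conj (f p.1) * f p.2) (μ.prod μ) :=
  Integrable.mul_prod (f := fun x => conj (f x))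
    (Complex.conjLIE.toContinuousLinearEquiv.toContinuousLinearMap.integrable_comp hf) hf

/-- Integrating the parallelogram identity in z exhibits the Gaussian kernel as a convolution
square, so its energy is a squared L² norm; no Fourier transform is needed. -/
theorem integral_gaussian_energy [IsFiniteMeasure μ] {f : Plane → ℂ} (hf : Integrable f μ) {t : ℝ}
    (ht : 0 < t) :
    Integrable (fun z => ‖gaussianTransform μ t f z‖ ^ 2) ∧
    ((∫ w : Plane, Real.exp (-(4 * t) * ‖w‖ ^ 2) : ℝ) : ℂ) *
        ∫ p : Plane × Plane, conj (f p.1) * f p.2 * (Real.exp (-t * ‖p.1 - p.2‖ ^ 2) : ℂ)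
          ∂(μ.prod μ) =
      ((∫ z, ‖gaussianTransform μ t f z‖ ^ 2 : ℝ) : ℂ) := by
  set c := ∫ w : Plane, Real.exp (-(4 * t) * ‖w‖ ^ 2) with hc
  have hF := integrable_prod_conj_mul hf
  set G : Plane × Plane → Plane → ℂ := fun p z => conj (f p.1) * f p.2 *
    ((Real.exp (-(2 * t) * ‖p.1 - z‖ ^ 2) * Real.exp (-(2 * t) * ‖p.2 - z‖ ^ 2) : ℝ) : ℂ) with hG
  have hG' : ∀ p z, G p z = conj (f p.1) * f p.2 * (Real.exp (-t * ‖p.1 - p.2‖ ^ 2) : ℂ) *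
      (Real.exp (-(4 * t) * ‖z - (1 / 2 : ℝ) • (p.1 + p.2)‖ ^ 2) : ℂ) := by
    intro p z
    simp only [hG, gaussian_parallelogram]
    push_cast
    ring
  have hgi : ∀ q : Plane, Integrable fun z : Plane => Real.exp (-(4 * t) * ‖z - q‖ ^ 2) := fun q =>
    (integrable_exp_neg_mul_norm_sq (by positivity : 0 < 4 * t)).comp_sub_right q
  have hgv : ∀ q : Plane, ∫ z : Plane, Real.exp (-(4 * t) * ‖z - q‖ ^ 2) = c := fun q =>
    integral_sub_right_eq_self (fun w : Plane => Real.exp (-(4 * t) * ‖w‖ ^ 2)) q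
  have hm : AEStronglyMeasurable (Function.uncurry G) ((μ.prod μ).prod volume) := by
    refine hF.1.comp_fst.mul (Continuous.aestronglyMeasurable ?_)
    fun_prop
  have hint : Integrable (Function.uncurry G) ((μ.prod μ).prod volume) := by
    rw [integrable_prod_iff hm]
    refine ⟨Eventually.of_forall fun p => ?_, ?_⟩
    · simp only [Function.uncurry, hG']
      exact (hgi _).ofReal.const_mul _
    · have h1 : ∀ p, ∫ z, ‖Function.uncurry G (p, z)‖ =
          ‖conj (f p.1) * f p.2 * (Real.exp (-t * ‖p.1 - p.2‖ ^ 2) : ℂ)‖ * c := by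
        intro p
        simp only [Function.uncurry, hG']
        rw [← hgv ((1 / 2 : ℝ) • (p.1 + p.2)), ← integral_const_mul]
        congr 1
        funext z
        rw [norm_mul _ (Complex.ofReal _), Complex.norm_real,
          Real.norm_of_nonneg (Real.exp_pos _).le]
      simp only [h1]
      refine (Integrable.norm ?_).mul_const c
      refine hF.mul_bdd (c := 1) (Continuous.aestronglyMeasurable (by fun_prop))
        (Eventually.of_forall fun p => ?_)
      rw [Complex.norm_real, Real.norm_of_nonneg (Real.exp_pos _).le, Real.exp_le_one_iff]
      have : 0 ≤ t * ‖p.1 - p.2‖ ^ 2 := by positivity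
      linarith
  have hz : ∀ z, ∫ p, G p z ∂(μ.prod μ) = ((‖gaussianTransform μ t f z‖ ^ 2 : ℝ) : ℂ) := by
    intro z
    have h1 := integral_prod_mul (μ := μ) (ν := μ)
      (fun x => (Real.exp (-(2 * t) * ‖x - z‖ ^ 2) : ℂ) * conj (f x))
      (fun y => (Real.exp (-(2 * t) * ‖y - z‖ ^ 2) : ℂ) * f y)
    have h2 : (∫ x, (Real.exp (-(2 * t) * ‖x - z‖ ^ 2) : ℂ) * conj (f x) ∂μ) =
      conj (gaussianTransform μ t f z) := gaussianTransform_conj t f z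
    rw [h2] at h1
    calc _ = _ := ?_
      _ = _ := h1
      _ = _ := ?_
    · congr 1
      funext p
      simp only [hG]
      push_cast
      ring
    · rw [← gaussianTransform, RCLike.conj_mul]
      push_cast
      rfl
  constructor
  · have h1 := hint.integral_prod_right
    simp only [Function.uncurry, hz] at h1
    exact h1.re
  · have h1 : ((∫ z, ‖gaussianTransform μ t f z‖ ^ 2 : ℝ) : ℂ) = ∫ z, ∫ p, G p z ∂(μ.prod μ) := by
      rw [← integral_complex_ofReal]
      simp only [hz]
    rw [h1, ← integral_integral_swap hint, ← integral_const_mul]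
    congr 1
    funext p
    simp only [hG']
    rw [integral_const_mul, integral_complex_ofReal, hgv, mul_comm]

theorem continuous_gaussianTransform {f : Plane → ℂ} (hf : Integrable f μ) {t : ℝ}
    (ht : 0 < t) : Continuous (gaussianTransform μ t f) := by
  refine continuous_of_dominated (bound := fun x => ‖f x‖) (fun z => ?_)
    (fun z => Eventually.of_forall fun x => ?_) hf.norm (Eventually.of_forall fun x => by fun_prop)
  · exact (Continuous.aestronglyMeasurable (by fun_prop)).mul hf.1
  · rw [norm_mul, Complex.norm_real, Real.norm_of_nonneg (Real.exp_pos _).le]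
    refine mul_le_of_le_one_left (norm_nonneg _) (Real.exp_le_one_iff.2 ?_)
    have : 0 ≤ t * ‖x - z‖ ^ 2 := by positivity
    linarith

theorem ae_eq_zero_of_gaussianTransform_eq_zero [IsFiniteMeasure μ] (hK : IsCompact K)
    (hμ : ∀ᵐ x ∂μ, x ∈ K) {f : Plane → ℂ} (hf : Integrable f μ) {t : ℝ} (ht : 0 < t)
    (h : ∀ z, gaussianTransform μ t f z = 0) : f =ᵐ[μ] 0 := by
  have h1 : (fun x => Real.exp (-(2 * t) * ‖x‖ ^ 2) • f x) =ᵐ[μ] 0 := by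
    refine ae_eq_zero_of_integral_exp_smul_eq_zero hK hμ
      (integrable_continuous_smul hK hμ hf (by fun_prop)) fun w => ?_
    -- At this z the cross term 4t⟨x, z⟩ in the exponent becomes ⟨x, w⟩, so the transform is a
    -- nonzero multiple of an exponential moment of exp(-2t|x|²) f.
    have h2 := h ((1 / (4 * t)) • w)
    rw [gaussianTransform] at h2
    have h3 : ∀ x, (Real.exp (-(2 * t) * ‖x - (1 / (4 * t)) • w‖ ^ 2) : ℂ) * f x =
        (Real.exp (-(2 * t) * ‖(1 / (4 * t)) • w‖ ^ 2) : ℂ) *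
          (Real.exp (inner ℝ x w) • Real.exp (-(2 * t) * ‖x‖ ^ 2) • f x) := by
      intro x
      rw [Complex.real_smul, Complex.real_smul, ← mul_assoc, ← mul_assoc, ← Complex.ofReal_mul,
        ← Complex.ofReal_mul, ← Real.exp_add, ← Real.exp_add, norm_sub_sq_real,
        real_inner_smul_right]
      congr 4
      field_simp
      ring
    simp only [h3] at h2
    rw [integral_const_mul] at h2
    refine (mul_eq_zero.1 h2).resolve_left ?_
    exact_mod_cast (Real.exp_pos _).ne'
  filter_upwards [h1] with x hx
  exact (smul_eq_zero.1 hx).resolve_left (Real.exp_pos _).ne'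

end Gaussian

/-! ### The logarithm as an integral of exponentials -/

section Frullani

theorem integrableOn_inv_mul_exp_sub_exp {a b : ℝ} (ha : 0 < a) (hab : a ≤ b) :
    IntegrableOn (fun t : ℝ => t⁻¹ * (Real.exp (-(a * t)) - Real.exp (-(b * t)))) (Set.Ioi 0) := by
  have h1 : IntegrableOn (fun t : ℝ => (b - a) * Real.exp (-a * t)) (Set.Ioi 0) :=
    (integrableOn_exp_mul_Ioi (neg_lt_zero.2 ha) 0).const_mul _
  refine h1.mono' (Measurable.aestronglyMeasurable (by fun_prop)) ?_
  filter_upwards [ae_restrict_mem measurableSet_Ioi] with t ht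
  have ht : 0 < t := ht
  have h2 : Real.exp (-(b * t)) = Real.exp (-a * t) * Real.exp (-((b - a) * t)) := by
    rw [← Real.exp_add]; congr 1; ring
  have h3 := Real.add_one_le_exp (-((b - a) * t))
  have h4 : Real.exp (-((b - a) * t)) ≤ 1 := by
    rw [Real.exp_le_one_iff]
    nlinarith
  have h5 := Real.exp_pos (-a * t)
  rw [show -(a * t) = -a * t by ring, h2, norm_mul, norm_inv, Real.norm_of_nonneg ht.le,
    Real.norm_of_nonneg (by nlinarith), inv_mul_le_iff₀ ht]
  nlinarith

/-- The integrand has a constant sign, so its absolute integral is |log(b/a)|; that clause makes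
Fubini available against the logarithmic energy. -/
theorem integral_inv_mul_exp_sub_exp {a b : ℝ} (ha : 0 < a) (hb : 0 < b) :
    IntegrableOn (fun t : ℝ => t⁻¹ * (Real.exp (-(a * t)) - Real.exp (-(b * t)))) (Set.Ioi 0) ∧
    ∫ t in Set.Ioi (0 : ℝ), t⁻¹ * (Real.exp (-(a * t)) - Real.exp (-(b * t))) = Real.log (b / a) ∧
    ∫ t in Set.Ioi (0 : ℝ), ‖t⁻¹ * (Real.exp (-(a * t)) - Real.exp (-(b * t)))‖ =
      |Real.log (b / a)| := by
  have hL : Tendsto (fun t : ℝ => Real.exp (-t)) (𝓝[>] 0) (𝓝 1) := by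
    have : Continuous fun t : ℝ => Real.exp (-t) := by fun_prop
    simpa using (this.tendsto 0).mono_left nhdsWithin_le_nhds
  have hR : Tendsto (fun t : ℝ => Real.exp (-t)) atTop (𝓝 0) :=
    Real.tendsto_exp_neg_atTop_nhds_zero
  have hloc : LocallyIntegrableOn (fun t : ℝ => Real.exp (-t)) (Set.Ioi 0) :=
    (Continuous.locallyIntegrable (by fun_prop)).locallyIntegrableOn _
  have key : ∀ {a b : ℝ}, 0 < a → a ≤ b →
      ∫ t in Set.Ioi (0 : ℝ), t⁻¹ * (Real.exp (-(a * t)) - Real.exp (-(b * t))) =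
        Real.log (b / a) := by
    intro a b ha hab
    have := Frullani.integral_Ioi_eq hloc ha (ha.trans_le hab) hL hR
      (integrableOn_inv_mul_exp_sub_exp ha hab)
    simpa using this
  have hsign : ∀ {a b t : ℝ}, a ≤ b → t ∈ Set.Ioi (0 : ℝ) →
      0 ≤ t⁻¹ * (Real.exp (-(a * t)) - Real.exp (-(b * t))) := by
    intro a b t hab ht
    have ht : 0 < t := ht
    refine mul_nonneg (by positivity) (sub_nonneg.2 (Real.exp_le_exp.2 ?_))
    nlinarith
  have hneg : ∀ t : ℝ, t⁻¹ * (Real.exp (-(a * t)) - Real.exp (-(b * t))) =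
      -(t⁻¹ * (Real.exp (-(b * t)) - Real.exp (-(a * t)))) := fun t => by ring
  rcases le_total a b with hab | hab
  · refine ⟨integrableOn_inv_mul_exp_sub_exp ha hab, key ha hab, ?_⟩
    rw [abs_of_nonneg (Real.log_nonneg ((one_le_div ha).2 hab)), ← key ha hab]
    exact setIntegral_congr_fun measurableSet_Ioi fun t ht => Real.norm_of_nonneg (hsign hab ht)
  · have hlog : Real.log (b / a) = -Real.log (a / b) := by rw [← Real.log_inv, inv_div]
    refine ⟨?_, ?_, ?_⟩
    · simp only [hneg]
      exact (integrableOn_inv_mul_exp_sub_exp hb hab).neg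
    · simp only [hneg]
      rw [integral_neg, key hb hab, hlog]
    · simp only [hneg, norm_neg]
      rw [hlog, abs_neg, abs_of_nonneg (Real.log_nonneg ((one_le_div hb).2 hab)), ← key hb hab]
      exact setIntegral_congr_fun measurableSet_Ioi fun t ht => Real.norm_of_nonneg (hsign hab ht)

end Frullani

/-! ### Definiteness of the single layer on mean-zero densities -/

section Positivity

variable {a : ℝ≥0} {D : Set Plane}

theorem ae_prod_fst_ne_snd [IsFiniteMeasure (bdry D)] :
    ∀ᵐ p : Plane × Plane ∂((bdry D).prod (bdry D)), p.1 ≠ p.2 := by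
  rw [ae_iff]
  have hm : MeasurableSet {p : Plane × Plane | ¬p.1 ≠ p.2} := by
    simpa using measurableSet_eq_fun measurable_fst measurable_snd
  refine Measure.measure_prod_null_of_ae_null hm (Eventually.of_forall fun x => ?_)
  simp only [ne_eq, not_not, Set.preimage_ofPred_eq, Pi.zero_apply]
  have : {y : Plane | x = y} = {x} := by ext; simp [eq_comm]
  rw [this]
  exact measure_singleton x

/-- The single layer potential is definite on densities of mean zero. -/
theorem IsC1HolderDomain.ae_eq_zero_of_integral_logPotential (hD : IsC1HolderDomain a D)
    (ha : 0 < a) {f : Plane → ℂ} (hf : MemLp f 2 (bdry D)) (hmean : ∫ x, f x ∂(bdry D) = 0)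
    (h0 : ∫ x, conj (f x) * logPotential D f x ∂(bdry D) = 0) : f =ᵐ[bdry D] 0 := by
  have hfin := hD.isFiniteMeasure_bdry ha
  have hfi : Integrable f (bdry D) := hf.integrable one_le_two
  set σ := bdry D with hσ
  have hF := integrable_prod_conj_mul hfi
  obtain ⟨C, hk⟩ := hD.exists_isSchurKernel_logKernel ha
  have hlog := hk.integrable_prod hf (ψ := fun x => conj (f x)) hf.star
  have h0' : ∫ p : Plane × Plane, conj (f p.1) * ((logKernel p.1 p.2 : ℂ) * f p.2) ∂(σ.prod σ) = 0 := by
    rw [integral_prod _ hlog, ← h0]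
    congr 1
    funext x
    exact integral_const_mul (conj (f x)) fun y => (logKernel x y : ℂ) * f y
  -- Frullani with a = |x - y|² and b = 1: integrating in t yields -log|x - y|², that is, -4π times
  -- the logarithmic kernel.
  set G : Plane × Plane → ℝ → ℂ := fun p t => conj (f p.1) * f p.2 *
    ((t⁻¹ * (Real.exp (-(‖p.1 - p.2‖ ^ 2 * t)) - Real.exp (-(1 * t))) : ℝ) : ℂ) with hG
  have hm : AEStronglyMeasurable (Function.uncurry G)
      ((σ.prod σ).prod (volume.restrict (Set.Ioi 0))) := by
    refine hF.1.comp_fst.mul (Measurable.aestronglyMeasurable ?_)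
    fun_prop
  have hlog2 : ∀ p : Plane × Plane, p.1 ≠ p.2 →
      Real.log (1 / ‖p.1 - p.2‖ ^ 2) = -(4 * Real.pi) * logKernel p.1 p.2 := by
    intro p hp
    have hpi := Real.pi_pos
    have h1 := Real.log_pow ‖p.1 - p.2‖ 2
    rw [Nat.cast_ofNat] at h1
    rw [one_div, Real.log_inv, h1, logKernel]
    field_simp
    ring
  have hfru := fun (p : Plane × Plane) (hp : p.1 ≠ p.2) =>
    integral_inv_mul_exp_sub_exp (a := ‖p.1 - p.2‖ ^ 2) (b := 1)
      (by have := norm_pos_iff.2 (sub_ne_zero.2 hp); positivity) one_pos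
  have hint : Integrable (Function.uncurry G)
      ((σ.prod σ).prod (volume.restrict (Set.Ioi 0))) := by
    rw [integrable_prod_iff hm]
    constructor
    · filter_upwards [ae_prod_fst_ne_snd] with p hp
      simp only [Function.uncurry, hG]
      exact (hfru p hp).1.ofReal.const_mul _
    · refine ((hlog.norm).const_mul (4 * Real.pi)).congr ?_
      filter_upwards [ae_prod_fst_ne_snd] with p hp
      simp only [Function.uncurry, hG, norm_mul (_ * _) (Complex.ofReal _), Complex.norm_real]
      rw [integral_const_mul, (hfru p hp).2.2, hlog2 p hp, abs_mul, abs_neg,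
        abs_of_pos (by positivity : 0 < 4 * Real.pi)]
      simp only [norm_mul, Complex.norm_real, Real.norm_eq_abs]
      ring
  have hswap := integral_integral_swap hint
  have hleft : ∫ p, (∫ t in Set.Ioi (0 : ℝ), G p t) ∂(σ.prod σ) = 0 := by
    calc _ = ∫ p : Plane × Plane, ((-(4 * Real.pi) : ℝ) : ℂ) *
          (conj (f p.1) * ((logKernel p.1 p.2 : ℂ) * f p.2)) ∂(σ.prod σ) := by
          refine integral_congr_ae ?_
          filter_upwards [ae_prod_fst_ne_snd] with p hp
          simp only [hG]
          rw [integral_const_mul, integral_complex_ofReal, (hfru p hp).2.1, hlog2 p hp]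
          push_cast
          ring
      _ = 0 := by rw [integral_const_mul, h0', mul_zero]
  set c : ℝ → ℝ := fun t => ∫ w : Plane, Real.exp (-(4 * t) * ‖w‖ ^ 2) with hc
  have hcpos : ∀ t, 0 < t → 0 < c t := fun t ht =>
    integral_exp_pos (integrable_exp_neg_mul_norm_sq (by positivity))
  -- The mean-zero condition removes the exp(-t) term, leaving only the nonnegative Gaussian
  -- energies.
  have hF0 : ∫ p : Plane × Plane, conj (f p.1) * f p.2 ∂(σ.prod σ) = 0 := by
    rw [integral_prod_mul (fun x => conj (f x)) f, hmean, mul_zero]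
  have hFe : ∀ t : ℝ, 0 < t → Integrable (fun p : Plane × Plane =>
      conj (f p.1) * f p.2 * (Real.exp (-t * ‖p.1 - p.2‖ ^ 2) : ℂ)) (σ.prod σ) := by
    intro t ht
    refine hF.mul_bdd (c := 1) (Continuous.aestronglyMeasurable (by fun_prop))
      (Eventually.of_forall fun p => ?_)
    rw [Complex.norm_real, Real.norm_of_nonneg (Real.exp_pos _).le, Real.exp_le_one_iff]
    have : 0 ≤ t * ‖p.1 - p.2‖ ^ 2 := by positivity
    linarith
  set E : ℝ → ℝ := fun t => t⁻¹ * ((c t)⁻¹ * ∫ z, ‖gaussianTransform σ t f z‖ ^ 2) with hE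
  have hright : ∀ t : ℝ, 0 < t → ∫ p, G p t ∂(σ.prod σ) = (E t : ℂ) := by
    intro t ht
    have h1 := (integral_gaussian_energy hfi ht).2
    have h2 : ∀ p, G p t = (t⁻¹ : ℂ) *
        (conj (f p.1) * f p.2 * (Real.exp (-t * ‖p.1 - p.2‖ ^ 2) : ℂ) -
          conj (f p.1) * f p.2 * (Real.exp (-t) : ℂ)) := by
      intro p
      simp only [hG]
      rw [show -(‖p.1 - p.2‖ ^ 2 * t) = -t * ‖p.1 - p.2‖ ^ 2 by ring, one_mul]
      push_cast
      ring
    simp only [h2]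
    rw [integral_const_mul, integral_sub (hFe t ht) (hF.mul_const _), integral_mul_const, hF0,
      zero_mul, sub_zero]
    have hc0 : (c t : ℂ) ≠ 0 := by exact_mod_cast (hcpos t ht).ne'
    simp only [hE]
    push_cast
    congr 1
    rw [eq_inv_mul_iff_mul_eq₀ hc0]
    push_cast at h1
    exact h1
  have hEint : IntegrableOn E (Set.Ioi 0) := by
    have h1 := hint.integral_prod_right.re
    refine h1.congr ?_
    filter_upwards [ae_restrict_mem measurableSet_Ioi] with t ht
    have h2 := hright t ht
    simp only [Function.uncurry] at h2 ⊢
    rw [h2]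
    simp
  have hE0 : ∫ t in Set.Ioi (0 : ℝ), E t = 0 := by
    have h1 : ∫ t in Set.Ioi (0 : ℝ), (E t : ℂ) = 0 := by
      rw [← hleft, hswap]
      exact (setIntegral_congr_fun measurableSet_Ioi fun t ht => hright t ht).symm
    rw [integral_complex_ofReal] at h1
    exact_mod_cast h1
  have hEnn : ∀ t : ℝ, 0 < t → 0 ≤ E t := by
    intro t ht
    have := hcpos t ht
    exact mul_nonneg (by positivity) (mul_nonneg (by positivity)
      (integral_nonneg fun z => by positivity))
  have hEae : E =ᵐ[volume.restrict (Set.Ioi 0)] 0 := by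
    rw [← integral_eq_zero_iff_of_nonneg_ae ?_ hEint]
    · exact hE0
    · filter_upwards [ae_restrict_mem measurableSet_Ioi] with t ht using hEnn t ht
  have hne : (ae (volume.restrict (Set.Ioi (0 : ℝ)))).NeBot := by
    rw [ae_neBot]
    simp
  -- One vanishing Gaussian energy is enough, since a single Gaussian transform already determines
  -- f.
  obtain ⟨t, ht0, ht⟩ := (hEae.and (ae_restrict_mem measurableSet_Ioi)).exists
  have ht : 0 < t := ht
  have hg0 : ∫ z, ‖gaussianTransform σ t f z‖ ^ 2 = 0 := by
    have := (hcpos t ht).ne'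
    simp only [hE, Pi.zero_apply] at ht0
    simpa [ht.ne', this] using ht0
  have hcont := continuous_gaussianTransform hfi ht
  have hae : (fun z => ‖gaussianTransform σ t f z‖ ^ 2) =ᵐ[volume] fun _ => 0 :=
    (integral_eq_zero_iff_of_nonneg (fun z => by positivity)
      (integral_gaussian_energy hfi ht).1).1 hg0
  have heq := (Continuous.ae_eq_iff_eq volume (hcont.norm.pow 2) continuous_const).1 hae
  refine ae_eq_zero_of_gaussianTransform_eq_zero hD.isCompact_frontier (ae_mem_frontier D) hfi ht
    fun z => ?_
  have := congrFun heq z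
  simpa using this

theorem IsC1HolderDomain.eq_zero_of_inner_singleLayer (hD : IsC1HolderDomain a D) (ha : 0 < a)
    {S : L2 D →L[ℂ] L2 D} (hS : ∀ φ, S φ =ᵐ[bdry D] logPotential D φ) {φ : L2 D}
    (hmean : ∫ x, φ x ∂(bdry D) = 0) (h0 : inner ℂ φ (S φ) = 0) : φ = 0 := by
  have h1 : ∫ x, conj (φ x) * logPotential D φ x ∂(bdry D) = 0 := by
    rw [← h0, L2.inner_def]
    refine integral_congr_ae ?_
    filter_upwards [hS φ] with x hx
    rw [hx, RCLike.inner_apply, mul_comm]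
  have h2 := hD.ae_eq_zero_of_integral_logPotential ha (Lp.memLp φ) hmean h1
  exact Lp.ext (h2.trans (Lp.coeFn_zero ℂ 2 (bdry D)).symm)

end Positivity

/-! ### Contour moments and their asymptotics -/

section Moments

variable {E : Type*} [NormedAddCommGroup E] [NormedSpace ℂ E]
  {A : E →L[ℂ] E} {lam : ℕ → ℝ} {φ : ℕ → Bool → E} {f : ℕ → Bool → E →L[ℂ] ℂ} {m : E →L[ℂ] ℂ}
  {γ : ℝ → ℂ}

namespace IsBiorthogonalSystem

theorem signed_mem_spectrum [CompleteSpace E] (h : IsBiorthogonalSystem A lam φ f m) (i : ℕ)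
    (s : Bool) : signed lam i s ∈ spectrum ℂ A := by
  refine (h.compact.hasEigenvalue_iff_mem_spectrum ?_).1 (h.hasEigenvalue i s)
  have := (h.pos i).ne'
  cases s <;> simpa [signed]

/-- 0 is a limit of eigenvalues. It follows that γ avoids 0 and winds once around it, as the Neumann
expansion requires. -/
theorem zero_mem_spectrum [CompleteSpace E] (h : IsBiorthogonalSystem A lam φ f m) :
    (0 : ℂ) ∈ spectrum ℂ A := by
  have hlim := (Complex.continuous_ofReal.tendsto 0).comp h.tendsto_zero
  rw [Complex.ofReal_zero] at hlim
  exact (spectrum.isClosed (𝕜 := ℂ) A).mem_of_tendsto hlim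
    (Eventually.of_forall fun i => by simpa [signed] using h.signed_mem_spectrum i true)

/-- The vectors for which the formula holds form a subspace `W`. It contains the eigenvectors, where
the resolvent is scalar, and the tail of v as soon as `lam J` is below the distance δ from 0 to γ; v
is the sum of such a tail and finitely many eigenvectors. -/
theorem contourIntegral_resolvent [CompleteSpace E] (h : IsBiorthogonalSystem A lam φ f m)
    (hγ : IsSimpleClosedCurve γ) (hγA : Encloses γ (spectrum ℂ A)) (ℓ : E →L[ℂ] ℂ) (N : ℕ) {v : E}
    (hv : m v = 0) :
    (2 * Real.pi * Complex.I)⁻¹ * contourIntegral γ (fun z => z ^ N * ℓ (resolvent A z v)) =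
      ℓ ((A ^ N) v) := by
  have hdisj : Disjoint (γ '' Set.Icc 0 1) (spectrum ℂ A) :=
    Set.disjoint_left.2 fun z hz hzA => (hγA z hzA).1 hz
  have hzero := hγA 0 h.zero_mem_spectrum
  have hK : IsCompact (γ '' Set.Icc 0 1) := isCompact_Icc.image_of_continuousOn hγ.exists_bound.1
  obtain ⟨δ, hδ0, hδ⟩ : ∃ δ : ℝ, 0 < δ ∧ ∀ z ∈ γ '' Set.Icc 0 1, δ ≤ ‖z‖ := by
    obtain ⟨δ, hδ0, hδ⟩ := Metric.mem_nhds_iff.1 (hK.isClosed.isOpen_compl.mem_nhds hzero.1)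
    refine ⟨δ, hδ0, fun z hz => not_lt.1 fun hlt => hδ (mem_ball_zero_iff.2 hlt) hz⟩
  have hcont : ∀ u : E, ContinuousOn (fun z => z ^ N * ℓ (resolvent A z u)) (γ '' Set.Icc 0 1) :=
    fun u => (continuous_pow N).continuousOn.mul (ℓ.continuous.comp_continuousOn
      ((continuousOn_resolvent A hdisj).clm_apply continuousOn_const))
  let W : Submodule ℂ E :=
    { carrier := {u | (2 * Real.pi * Complex.I)⁻¹ *
        contourIntegral γ (fun z => z ^ N * ℓ (resolvent A z u)) = ℓ ((A ^ N) u)}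
      add_mem' := fun {u w} hu hw => by
        simp only [Set.mem_ofPred_eq, map_add, mul_add] at hu hw ⊢
        rw [hγ.contourIntegral_add (hcont u) (hcont w), mul_add, hu, hw]
      zero_mem' := by
        simp [contourIntegral]
      smul_mem' := fun c u hu => by
        simp only [Set.mem_ofPred_eq, map_smul, smul_eq_mul] at hu ⊢
        rw [← hu]
        have : ∀ z, z ^ N * (c * ℓ (resolvent A z u)) = c * (z ^ N * ℓ (resolvent A z u)) :=
          fun z => by ring
        simp only [this]
        rw [contourIntegral_const_mul]
        ring }
  have hφW : ∀ i s, φ i s ∈ W := by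
    intro i s
    have hmem := hγA _ (h.signed_mem_spectrum i s)
    change _ * contourIntegral γ _ = _
    have hres : Set.EqOn (fun z => z ^ N * ℓ (resolvent A z (φ i s)))
        (fun z => ℓ (φ i s) * (z ^ N * (z - signed lam i s)⁻¹)) (γ '' Set.Icc 0 1) := by
      intro z hz
      have hne : z - signed lam i s ≠ 0 := sub_ne_zero.2 fun heq => hmem.1 (heq ▸ hz)
      have h1 : resolvent A z (φ i s) = (z - signed lam i s)⁻¹ • φ i s := by
        refine resolvent_apply_eq (Set.disjoint_left.1 hdisj hz) ?_
        rw [map_smul, h.apply_eq, smul_comm z, ← smul_sub, ← sub_smul, smul_smul,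
          inv_mul_cancel₀ hne, one_smul]
      simp only [h1, map_smul, smul_eq_mul]
      ring
    rw [contourIntegral_congr hres, contourIntegral_const_mul, h.pow_apply, map_smul, smul_eq_mul,
      ← hγ.contourIntegral_pow_div hmem.1 hmem.2 N]
    ring
  obtain ⟨J, hJ⟩ := (h.tendsto_zero.eventually (gt_mem_nhds hδ0)).exists
  obtain ⟨r, hr1, hr2⟩ := exists_between hJ
  obtain ⟨C, hC⟩ := h.exists_norm_pow_tail_le J hv hr1
  have htail : tail φ f J v ∈ W :=
    hγ.contourIntegral_resolvent_of_decay hdisj hzero.1 hzero.2 ((h.nonneg J).trans hr1.le) hr2 hδ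
      hC ℓ N
  have hvW : v ∈ W := by
    have hsum : ∑ i ∈ Finset.range J, (f i true v • φ i true + f i false v • φ i false) ∈ W :=
      W.sum_mem fun i _ => W.add_mem (W.smul_mem _ (hφW i true)) (W.smul_mem _ (hφW i false))
    have := W.add_mem htail hsum
    rwa [tail, sub_add_cancel] at this
  exact hvW

theorem apply_pow_tail (h : IsBiorthogonalSystem A lam φ f m) (ℓ : E →L[ℂ] ℂ) (J n : ℕ) (v : E) :
    ℓ ((A ^ (2 * n)) (tail φ f J v)) = ℓ ((A ^ (2 * n)) v) - ∑ i ∈ Finset.range J,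
      (lam i : ℂ) ^ (2 * n) * (ℓ (φ i true) * f i true v + ℓ (φ i false) * f i false v) := by
  rw [tail, map_sub, map_sub, map_sum, map_sum]
  congr 1
  refine Finset.sum_congr rfl fun i _ => ?_
  simp only [map_add, map_smul, h.pow_apply, signed, smul_eq_mul]
  simp
  ring

/-- Consecutive tails differ by the pair of index j, on which an even power of A acts as λ_j^{2n}
for both signs. The next tail is O(r^{2n}) for some r between `lam (j + 1)` and `lam j`, hence
negligible. -/
theorem tendsto_inv_mul_apply_pow_tail [CompleteSpace E]
    (h : IsBiorthogonalSystem A lam φ f m) (ℓ : E →L[ℂ] ℂ)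
    (j : ℕ) {v : E} (hv : m v = 0) :
    Tendsto (fun n : ℕ => ((lam j : ℂ) ^ (2 * n))⁻¹ * ℓ ((A ^ (2 * n)) (tail φ f j v))) atTop
      (𝓝 (ℓ (φ j true) * f j true v + ℓ (φ j false) * f j false v)) := by
  have hpos := h.pos j
  obtain ⟨r, hr1, hr2⟩ := exists_between (h.strictAnti (Nat.lt_succ_self j))
  have hr0 : 0 < r := (h.pos _).trans hr1
  obtain ⟨C, hC⟩ := h.exists_norm_pow_tail_le (j + 1) hv hr1
  set c := ℓ (φ j true) * f j true v + ℓ (φ j false) * f j false v with hc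
  have hdec : ∀ n : ℕ, ((lam j : ℂ) ^ (2 * n))⁻¹ * ℓ ((A ^ (2 * n)) (tail φ f j v)) =
      c + ((lam j : ℂ) ^ (2 * n))⁻¹ * ℓ ((A ^ (2 * n)) (tail φ f (j + 1) v)) := by
    intro n
    have hne : (lam j : ℂ) ^ (2 * n) ≠ 0 := pow_ne_zero _ (by exact_mod_cast hpos.ne')
    rw [h.apply_pow_tail, h.apply_pow_tail, Finset.sum_range_succ]
    field_simp
    ring
  simp only [hdec]
  have hlim : Tendsto (fun n : ℕ => ‖ℓ‖ * C * ((r / lam j) ^ 2) ^ n) atTop (𝓝 0) := by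
    have hlt : (r / lam j) ^ 2 < 1 := by
      rw [sq_lt_one_iff₀ (by positivity), div_lt_one hpos]
      exact hr2
    simpa using (tendsto_pow_atTop_nhds_zero_of_lt_one (by positivity) hlt).const_mul (‖ℓ‖ * C)
  have hzero : Tendsto (fun n : ℕ => ((lam j : ℂ) ^ (2 * n))⁻¹ *
      ℓ ((A ^ (2 * n)) (tail φ f (j + 1) v))) atTop (𝓝 0) := by
    refine squeeze_zero_norm (fun n => ?_) hlim
    rw [norm_mul, norm_inv, norm_pow, Complex.norm_real, Real.norm_of_nonneg hpos.le,
      inv_mul_le_iff₀ (by positivity)]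
    calc _ ≤ ‖ℓ‖ * (C * r ^ (2 * n)) := (ℓ.le_opNorm _).trans (by gcongr; exact hC _)
      _ = _ := by
        rw [← pow_mul, div_pow]
        field_simp
  simpa using hzero.const_add c

end IsBiorthogonalSystem

theorem tendsto_ratio_of_tendsto_inv_mul {h : ℕ → ℂ} {c μ : ℂ} (hμ : μ ≠ 0) (hc : c ≠ 0)
    (hlim : Tendsto (fun n => (μ ^ (2 * n))⁻¹ * h n) atTop (𝓝 c)) :
    Tendsto (fun n => h (n + 1) / h n) atTop (𝓝 (μ ^ 2)) := by
  have h1 := ((hlim.comp (tendsto_add_atTop_nat 1)).div hlim hc).const_mul (μ ^ 2)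
  rw [div_self hc, mul_one] at h1
  refine h1.congr fun n => ?_
  have hn : μ ^ (2 * n) ≠ 0 := pow_ne_zero _ hμ
  simp only [Pi.div_apply, Function.comp_apply]
  rw [show 2 * (n + 1) = 2 * n + 2 by ring, pow_add, mul_inv, mul_assoc, mul_div_mul_left _ _
    (inv_ne_zero hn), ← mul_div_assoc, mul_inv_cancel_left₀ (pow_ne_zero _ hμ)]

end Moments

/-! ### The Neumann–Poincaré operator as a biorthogonal system -/

section Assembly

variable {a : ℝ≥0} {D : Set Plane}

theorem IsC1HolderDomain.isNPOperator_npOp (hD : IsC1HolderDomain a D) (ha : 0 < a)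
    (ha1 : a ≤ 1) : IsNPOperator D (npOp D) := by
  have hfin := hD.isFiniteMeasure_bdry ha
  obtain ⟨C, hk⟩ := hD.exists_isSchurKernel_npKernel ha ha1
  have hex : ∃ K, IsNPOperator D K := ⟨hk.op, hk.op_ae⟩
  rw [npOp, dif_pos hex]
  exact hex.choose_spec

theorem exists_clm_integral_mul {g : Plane → ℝ} (hg : MemLp (fun x => (g x : ℂ)) 2 (bdry D)) :
    ∃ ℓ : L2 D →L[ℂ] ℂ, ∀ φ, ℓ φ = ∫ y, (g y : ℂ) * φ y ∂(bdry D) := by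
  refine ⟨innerSL ℂ (hg.toLp _), fun φ => ?_⟩
  rw [innerSL_apply_apply, L2.inner_def]
  refine integral_congr_ae ?_
  filter_upwards [hg.coeFn_toLp] with x hx
  rw [hx, RCLike.inner_apply, Complex.conj_ofReal, mul_comm]

theorem IsC1HolderDomain.exists_clm_coordPairing (hD : IsC1HolderDomain a D) (ha : 0 < a)
    (k : Fin 2) : ∃ ℓ : L2 D →L[ℂ] ℂ, ∀ φ, ℓ φ = coordPairing D k φ := by
  have hfin := hD.isFiniteMeasure_bdry ha
  have hc : Continuous fun y : Plane => (y k : ℂ) :=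
    Complex.continuous_ofReal.comp (EuclideanSpace.proj k : Plane →L[ℝ] ℝ).continuous
  obtain ⟨R, hR⟩ := hD.isCompact_frontier.exists_bound_of_continuousOn hc.continuousOn
  exact exists_clm_integral_mul (MemLp.of_bound hc.aestronglyMeasurable R
    ((ae_mem_frontier D).mono hR))

theorem IsEigensystem.apply_eq {lam : ℕ → ℝ} {φ : ℕ → Bool → L2 D} (hφ : IsEigensystem D lam φ)
    (i : ℕ) (s : Bool) : npOp D (φ i s) = signed lam i s • φ i s := by
  cases s
  · simpa [signed] using hφ.eigen_neg i
  · simpa [signed] using hφ.eigen_pos i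

/-- Plemelj's identity makes A symmetric for the H-form, so pairing with an eigenfunction is a left
eigenvector for the same real eigenvalue. -/
theorem IsEigensystem.exists_isBiorthogonalSystem (hD : IsC1HolderDomain a D) (ha : 0 < a)
    (ha1 : a ≤ 1) (hsimple : SimpleEigenvalues D) {lam : ℕ → ℝ} {φ : ℕ → Bool → L2 D}
    (hφ : IsEigensystem D lam φ) :
    ∃ (f : ℕ → Bool → L2 D →L[ℂ] ℂ) (m : L2 D →L[ℂ] ℂ),
      (∀ i s v, f i s v = innerH D (φ i s) v) ∧ (∀ v, m v = ∫ x, v x ∂(bdry D)) ∧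
      IsBiorthogonalSystem (npOp D) lam φ f m := by
  have hfin := hD.isFiniteMeasure_bdry ha
  have hT := hD.isNPOperator_npOp ha ha1
  have hcpt := hD.isCompactOperator_of_isNPOperator ha ha1 hT
  obtain ⟨S, hS⟩ := hD.exists_singleLayer_op ha
  obtain ⟨m, hm⟩ := exists_clm_integral_mul (D := D) (g := fun _ => 1)
    (by simpa using hD.memLp_one ha)
  replace hm : ∀ v, m v = ∫ x, v x ∂(bdry D) := fun v => by simpa using hm v
  have hsym : ∀ φ ψ : L2 D, inner ℂ φ (S (npOp D ψ)) = inner ℂ (npOp D φ) (S ψ) := fun φ ψ => by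
    rw [← hD.inner_singleLayer_comm ha hS, hD.inner_apply_singleLayer_comm ha ha1 hS hT]
  have hmA : ∀ v, m (npOp D v) = 1 / 2 * m v := fun v => by
    rw [hm, hm]
    exact hD.integral_npOp ha ha1 hT v
  have hf : ∀ i s v, (-(innerSL ℂ (φ i s)).comp S : L2 D →L[ℂ] ℂ) v = innerH D (φ i s) v :=
    fun i s v => by
      rw [innerH_eq_neg_inner hS]
      rfl
  refine ⟨fun i s => -(innerSL ℂ (φ i s)).comp S, m, hf, hm, ?_⟩
  refine
    { compact := hcpt
      simple := hsimple
      antitone := hφ.antitone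
      nonneg := hφ.nonneg
      lt_half := hφ.lt_half
      apply_eq := hφ.apply_eq
      left_apply := fun i s v => ?_
      biorth := fun i s j t => by rw [hf]; exact hφ.orthonormal i s j t
      exhaustive := hφ.exhaustive
      mean_apply := hmA
      mean_φ := fun i s => by rw [hm]; exact hφ.mean_zero i s
      half := fun w hmw hw => ?_ }
  · have hconj : conj (signed lam i s) = signed lam i s := by cases s <;> simp [signed]
    rw [hf, hf, innerH_eq_neg_inner hS, innerH_eq_neg_inner hS, hsym, hφ.apply_eq,
      inner_smul_left, hconj, mul_neg]
  · by_contra hw0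
    have hev : Module.End.HasEigenvalue (npOp D : Module.End ℂ (L2 D)) (1 / 2) :=
      Module.End.hasEigenvalue_of_hasEigenvector (x := w)
        ⟨Module.End.mem_eigenspace_iff.2 hw, hw0⟩
    have h1 : ∀ x, npOp D x = (1 / 2 : ℂ) • x → ∃ c : ℂ, x = c • w := by
      intro x hx
      obtain ⟨c, hc⟩ := exists_smul_eq_of_finrank_eq_one (hsimple _ hev)
        (x := ⟨w, Module.End.mem_eigenspace_iff.2 hw⟩) (by simpa using hw0)
        ⟨x, Module.End.mem_eigenspace_iff.2 hx⟩
      exact ⟨c, by simpa using (congrArg Subtype.val hc).symm⟩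
    have hμ0 : bdry D ≠ 0 := by
      intro h0
      refine hw0 (Lp.ext ?_)
      simp [h0, EventuallyEq]
    -- The constant 1 has nonzero mean, because the presence of a nonzero w in L² excludes a null
    -- boundary measure.
    have hu : m ((hD.memLp_one ha).toLp _) ≠ 0 := by
      rw [hm, integral_congr_ae (hD.memLp_one ha).coeFn_toLp]
      simpa [measureReal_eq_zero_iff] using hμ0
    obtain ⟨x, hx⟩ := exists_apply_sub_smul_eq hcpt (by norm_num) hw0 h1 hmA hu hmw
    refine hw0 (hD.eq_zero_of_inner_singleLayer ha hS (by rw [← hm, hmw]) ?_)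
    conv_lhs => rw [← hx]
    -- Symmetry moves A - 1/2 onto its eigenvector w. As w itself is (A - 1/2)x, the energy of w
    -- vanishes.
    have h2 : inner ℂ w (S (npOp D x - (1 / 2 : ℂ) • x)) = 0 := by
      rw [map_sub, inner_sub_right, hsym, hw, map_smul, inner_smul_left, inner_smul_right]
      simp [map_ofNat]
    rw [hx] at h2 ⊢
    exact h2

end Assembly

end NP

end

/-! ### The two limits -/

theorem corollary3p2 (a : ℝ≥0) (ha0 : 0 < a) (ha1 : a ≤ 1) (D : Set NP.Plane)
    (hD : NP.IsC1HolderDomain a D) (hsimple : NP.SimpleEigenvalues D)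
    (lam : ℕ → ℝ) (φ : ℕ → Bool → NP.L2 D) (hφ : NP.IsEigensystem D lam φ)
    (γ : ℝ → ℂ) (hγ : NP.IsSimpleClosedCurve γ) (hγD : NP.Encloses γ (spectrum ℂ (NP.npOp D)))
    (j : ℕ) (hj : NP.coeff D (φ j true) + NP.coeff D (φ j false) ≠ 0) :
    (∀ k l : Fin 2, (NP.coeff D (φ j true) + NP.coeff D (φ j false)) k l ≠ 0 →
      Tendsto (fun n : ℕ => NP.moment D γ lam φ j (n + 1) k l / NP.moment D γ lam φ j n k l)
        atTop (𝓝 ((lam j : ℂ) ^ 2))) ∧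
    Tendsto (fun n : ℕ => ((lam j : ℂ) ^ (2 * n))⁻¹ • NP.moment D γ lam φ j n)
      atTop (𝓝 (NP.coeff D (φ j true) + NP.coeff D (φ j false))) := by
  obtain ⟨f, m, hf, hm, hsys⟩ := hφ.exists_isBiorthogonalSystem hD ha0 ha1 hsimple
  choose ℓ hℓ using hD.exists_clm_coordPairing ha0
  -- The components of the normal have mean zero, so the eigenvalue 1/2 contributes nothing to the
  -- moments.
  have hν : ∀ l, m (NP.normalL2 D l) = 0 := fun l => by rw [hm, hD.integral_normalL2 ha0]
  have hmom : ∀ n k l, NP.moment D γ lam φ j n k l =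
      ℓ k ((NP.npOp D ^ (2 * n)) (NP.IsBiorthogonalSystem.tail φ f j (NP.normalL2 D l))) := by
    intro n k l
    rw [hsys.apply_pow_tail, ← hsys.contourIntegral_resolvent hγ hγD (ℓ k) (2 * n) (hν l)]
    simp only [NP.moment, NP.polTensor, NP.coeff, hℓ, hf, Matrix.sub_apply, Matrix.of_apply,
      Matrix.sum_apply, Matrix.smul_apply, Matrix.add_apply, smul_eq_mul]
  have hlim : ∀ k l, Tendsto (fun n : ℕ => ((lam j : ℂ) ^ (2 * n))⁻¹ *
      NP.moment D γ lam φ j n k l) atTop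
      (𝓝 ((NP.coeff D (φ j true) + NP.coeff D (φ j false)) k l)) := by
    intro k l
    simp only [hmom]
    have := hsys.tendsto_inv_mul_apply_pow_tail (ℓ k) j (hν l)
    simpa only [NP.coeff, hℓ, hf, Matrix.of_apply, Matrix.add_apply] using this
  refine ⟨fun k l hkl => ?_, ?_⟩
  · have hpos : (lam j : ℂ) ≠ 0 := Complex.ofReal_ne_zero.2 (hsys.pos j).ne'
    exact NP.tendsto_ratio_of_tendsto_inv_mul
      (h := fun n => NP.moment D γ lam φ j n k l) hpos hkl (hlim k l)
  · exact tendsto_pi_nhds.2 fun k => tendsto_pi_nhds.2 fun l => hlim k l
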